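/- **Setting.** Let $d\in\mathbb N$, $\beta,\tau>0$, $t_o<t_f$, phase-space points $x=(q,p)\in\mathbb R^d\times\mathbb R^d$, and let $U_o,U_f:\mathbb R^d\to\mathbb R$ be such that $\tilde m_{o}=(\beta/2\pi)^{d/2}e^{-\beta U_{o}}$ and $\tilde m_{f}=(\beta/2\pi)^{d/2}e^{-\beta U_{f}}$ are probability densities with finite second moments. For $\lambda>0$ let $$m^\lambda_{o}(q,p)=\Big(\frac{\beta}{2\pi\lambda}\Big)^d e^{-\beta\|p\|^2/(2\lambda^2)-\beta U_{o}(q)},\qquad m^\lambda_{f}(q,p)=\Big(\frac{\beta}{2\pi\lambda}\Big)^d e^{-\beta\|p\|^2/(2\lambda^2)-\beta U_{f}(q)} .$$ *Langevin–Kramers transitions.* These are pairs of a positive probability density $m(q,p,t)$ and a Hamiltonian $H$, both of class $C^{2,1}$ ($C^2$ in space, $C^1$ in time), with $\tau\partial_t m=-\partial_q\cdot(m\,\partial_pH)+\partial_p\cdot(m(\partial_qH+\partial_pH))+\beta^{-1}\Delta_pm$ on $[t_o,t_f]$, given initial and final densities, $H(\cdot,t)\in L^2(m\,dx)$, and integrable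 space-time current $m\,\partial_xA$. Here $S=-\beta^{-1}\ln(m/\beta^d)$ is the microscopic entropy (in energy units) and $A=H-S$. The entropy production is $\mathcal E=\beta\int\frac{dt}{\tau}\int m\,\|\partial_pA\|^2dx$. *Langevin–Smoluchowski transitions.* These are pairs of a positive probability density $\rho(q,t)$ and a potential $H(q,t)$, both $C^{2,1}$, with $\tau\partial_t\rho=\partial_q\cdot(\rho\,\partial_qH)+\beta^{-1}\Delta\rho$. The entropy production is $\beta\int\frac{dt}{\tau}\int\rho\,\|\partial_q(H+\beta^{-1}\ln\rho)\|^2dq$. Let $\mathcal E_{LK}(\lambda)$ be the infimum of $\mathcal E$ over Langevin–Kramers transitions from $m_o^\lambda$ to $m_f^\lambda$, and $\mathcal E_{LS}$ the infimum over Langevin–Smoluchowski transitions from $\tilde m_o$ to $\tilde m_f$. *Extremal equations.* With $(f,g)=\partial_pf\cdot\partial_qg-\partial_qf\cdot\partial_pg$ and $\mathfrak S f=-\beta\,\partial_pS\cdot\partial_pf+\Delta_pf$, $$\tau\partial_tV+(A,V)-\partial_pA\cdot\partial_pV+\|\partial_pA\|^2=0,\qquad \tau\partial_tS+(A,S)+\beta^{-1}\mathfrak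 SA=0,\qquad (S,V)+\beta^{-1}\mathfrak SV=2\beta^{-1}\mathfrak SA .$$ *Cell problem.* This is the system, on $[t_o,t_f]\times\mathbb R^d$, $$2\tau\partial_ta-\|\partial_qa\|^2=0,\qquad \tau\partial_ts-\partial_qa\cdot\partial_qs+\beta^{-1}\Delta_qa=0,$$ with $s=U_o+\frac d\beta\ln 2\pi$ at $t_o$ and $s=U_f+\frac d\beta\ln2\pi$ at $t_f$. Put $\rho=(2\pi\beta)^{d/2}e^{-\beta s}$, the momentum integral of $\beta^d e^{-\beta(\|\tilde p\|^2/2+s)}$; so $\rho=\tilde m_o$ at $t_o$ and $\rho=\tilde m_f$ at $t_f$. **(1) Expansion.** For small $\lambda>0$ let $(m^\lambda,H^\lambda)$ be a Langevin–Kramers transition from $m_o^\lambda$ to $m_f^\lambda$, with $S^\lambda,A^\lambda$ as above, and let $V^\lambda$ be $C^{2,1}$. Assume the value equation and the third (stationarity) equation hold up to errors that vanish as $\lambda\downarrow0$ at fixed $(q,\tilde p,t)$, where $p=\lambda\tilde p$ (the entropy equation holds exactly, being the Fokker–Planck equation). Assume $A^\lambda(q,\lambda\tilde p,t)=\sum_{i=0}^2\lambda^iA_i(q,\tilde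 p,t)+o(\lambda^2)$, and likewise for $V^\lambda$ and for $S^\lambda-\frac d\beta\ln\lambda$, pointwise and together with the derivatives $\partial_t,\partial_q,\partial_{\tilde p},\Delta_{\tilde p}$, with $C^{2,1}$ coefficients, and $A_i,V_i\in L^2(e^{-\beta S_0}dq\,d\tilde p)$ at each time. Assume finally that the momentum profile $S_0(q,\tilde p,t)-S_0(q,0,t)$ does not depend on $t$. Then there are $C^{2,1}$ functions $a(q,t)$, $s(q,t)$ solving the cell problem and a function $c(t)$ of time alone such that $$S_0=\tfrac12\|\tilde p\|^2+s,\qquad A_0=a+c(t),\qquad V_0=2a,\qquad A_1=-\tilde p\cdot\partial_qA_0+A_1|_{\tilde p=0}.$$ So $A_0$ and $V_0$ do not depend on $\tilde p$, $S_0$ is Maxwellian, and $A_0$ (shifted by a function of time, which no equation for $A$ and $S$ sees) and $S_{00}=s$ solve the cell problem. Suppose moreover that the expansion is uniform in energy norm: with $M^\lambda=\lambda^dm^\lambda(q,\lambda\tilde p,t)$, one has $\iint M^\lambda\|\partial_pA^\lambda(q,\lambda\tilde p,t)-\partial_{\tilde p}A_1\|^2\,dx\,dt=O(\lambda^2)$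 and $\iint|M^\lambda-\beta^de^{-\beta S_0}|\,\|\partial_{\tilde p}A_1\|^2\,dx\,dt=O(\lambda)$. Then $$\mathcal E_{LS}\le\mathcal E_{LK}(\lambda)\le\mathcal E(m^\lambda,H^\lambda)\le \beta\int_{t_o}^{t_f}\frac{dt}{\tau}\int\rho\,\|\partial_qa\|^2dq+O(\lambda),$$ and by (2) the leading term on the right equals $\mathcal E_{LS}$. **(2) Monge–Ampère–Kantorovich.** Let $a,s$ be any $C^{2,1}$ solution of the cell problem. Then $(\rho,\,a+s)$ is a Langevin–Smoluchowski transition from $\tilde m_o$ to $\tilde m_f$ attaining the minimum, and $$\beta\int_{t_o}^{t_f}\frac{dt}{\tau}\int\rho\,\|\partial_qa\|^2dq=\mathcal E_{LS}=\frac{\beta\tau}{t_f-t_o}\,\inf_\pi\int\|x-y\|^2d\pi(x,y)<\infty,$$ the infimum being over couplings $\pi$ of $\tilde m_o\,dq$ and $\tilde m_f\,dq$. The map $q\mapsto q-\frac{t-t_o}{\tau}\partial_qa(q,t_o)$ pushes $\tilde m_o\,dq$ forward to $\rho(\cdot,t)\,dq$ for all $t\in[t_o,t_f]$. For $t=t_f$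 it is the gradient of the convex function $\frac12\|q\|^2-\frac{t_f-t_o}\tau a(q,t_o)$ and is optimal for the quadratic cost. Moreover $\mathcal E_{LS}\le\mathcal E_{LK}(\lambda)$ for every $\lambda>0$. **(3) Consistency.** Conversely, for every smooth solution $a,s$ of the cell problem there are $A_2,V_1,V_2$ such that, with $S=\frac12\|p/\lambda\|^2+s$, $A=a-\lambda\,(p/\lambda)\cdot\partial_qa+\lambda^2A_2(q,p/\lambda,t)$ and $V=2a+\lambda V_1(q,p/\lambda,t)+\lambda^2V_2(q,p/\lambda,t)$, the three extremal equations hold up to errors that vanish as $\lambda\downarrow0$ at fixed $(q,p/\lambda,t)$, $t\in[t_o,t_f]$, and $(\beta/\lambda)^de^{-\beta S}$ equals $m^\lambda_o$ at $t_o$ and $m^\lambda_f$ at $t_f$. -/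

import Mathlib

open MeasureTheory Filter Topology Asymptotics
open scoped ENNReal ContDiff

noncomputable section

/-- Configuration (or momentum) space `ℝᵈ` with its Euclidean norm. -/
abbrev Pos (d : ℕ) := EuclideanSpace ℝ (Fin d)

/-- Phase space: a point is `x = (q, p)`. -/
abbrev Phase (d : ℕ) := Pos d × Pos d

/-- The class `C^(2,1)`: twice continuously differentiable in space, once in time, all these
derivatives being jointly continuous. -/
structure IsC21 {X : Type*} [NormedAddCommGroup X] [NormedSpace ℝ X] (f : ℝ → X → ℝ) : Prop where
  space : ∀ t, ContDiff ℝ 2 (f t)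
  time : ∀ x, Differentiable ℝ (fun t => f t x)
  continuous_time_deriv : Continuous (fun z : ℝ × X => deriv (fun s => f s z.2) z.1)
  continuous_fderiv : Continuous (fun z : ℝ × X => fderiv ℝ (f z.1) z.2)
  continuous_fderiv_fderiv : Continuous (fun z : ℝ × X => fderiv ℝ (fderiv ℝ (f z.1)) z.2)

/-- Partial derivative in time. -/
def dt {X : Type*} (f : ℝ → X → ℝ) (t : ℝ) (x : X) : ℝ := deriv (fun s => f s x) t

/-- Divergence of a vector field on `ℝᵈ`. -/
def divergence {d : ℕ} (X : Pos d → Pos d) (q : Pos d) : ℝ :=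
  ∑ i : Fin d, fderiv ℝ X q (EuclideanSpace.single i (1 : ℝ)) i

section PhaseSpaceCalculus

variable {d : ℕ}

/-- `∂_q f`. -/
def gradQ (f : Phase d → ℝ) (x : Phase d) : Pos d := gradient (fun q => f (q, x.2)) x.1

/-- `∂_p f`. -/
def gradP (f : Phase d → ℝ) (x : Phase d) : Pos d := gradient (fun p => f (x.1, p)) x.2

/-- `Δ_p f`, which is `G : ∂_x ⊗ ∂_x f` for the vertical projector `G = 0 ⊕ 1`. -/
def lapP (f : Phase d → ℝ) (x : Phase d) : ℝ := Laplacian.laplacian (fun p => f (x.1, p)) x.2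

/-- `∂_q · X`. -/
def divQ (X : Phase d → Pos d) (x : Phase d) : ℝ := divergence (fun q => X (q, x.2)) x.1

/-- `∂_p · X`. -/
def divP (X : Phase d → Pos d) (x : Phase d) : ℝ := divergence (fun p => X (x.1, p)) x.2

/-- The Poisson bracket `∂_p f · ∂_q g - ∂_q f · ∂_p g`. -/
def poissonBracket (f g : Phase d → ℝ) (x : Phase d) : ℝ :=
  inner ℝ (gradP f x) (gradQ g x) - inner ℝ (gradQ f x) (gradP g x)

/-- The degenerate metric bracket `∂_p f · ∂_p g`. -/
def metricBracket (f g : Phase d → ℝ) (x : Phase d) : ℝ := inner ℝ (gradP f x) (gradP g x)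

/-- The degenerate Witten Laplacian of the weight `exp (-β S)`: `-β ∂_p S · ∂_p f + Δ_p f`. -/
def wittenLaplacian (β : ℝ) (S f : Phase d → ℝ) (x : Phase d) : ℝ :=
  -β * metricBracket S f x + lapP f x

/-! The three extremal equations: each says that the corresponding expression vanishes. -/

/-- Left side of the value (dynamic programming) equation
`τ ∂_t V + (A, V)_J - (A, V)_G + ‖∂_x A‖_G² = 0`. -/
def valueResidual (τ : ℝ) (A V : ℝ → Phase d → ℝ) (t : ℝ) (x : Phase d) : ℝ :=
  τ * dt V t x + poissonBracket (A t) (V t) x - metricBracket (A t) (V t) x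
    + metricBracket (A t) (A t) x

/-- Left side of the entropy (transport) equation `τ ∂_t S + (A, S)_J + β⁻¹ 𝔖 A = 0`. -/
def entropyResidual (β τ : ℝ) (S A : ℝ → Phase d → ℝ) (t : ℝ) (x : Phase d) : ℝ :=
  τ * dt S t x + poissonBracket (A t) (S t) x + β⁻¹ * wittenLaplacian β (S t) (A t) x

/-- Difference of the two sides of the stationarity equation
`(S, V)_J + β⁻¹ 𝔖 V = 2 β⁻¹ 𝔖 A`. -/
def stationarityResidual (β : ℝ) (S A V : ℝ → Phase d → ℝ) (t : ℝ) (x : Phase d) : ℝ :=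
  poissonBracket (S t) (V t) x + β⁻¹ * wittenLaplacian β (S t) (V t) x
    - 2 * β⁻¹ * wittenLaplacian β (S t) (A t) x

end PhaseSpaceCalculus

section LangevinKramers

variable {d : ℕ}

/-- Microscopic entropy in units of energy: `m = β^d exp (-β S)`. -/
def microEntropy (β : ℝ) (m : ℝ → Phase d → ℝ) (t : ℝ) (x : Phase d) : ℝ :=
  -(β⁻¹ * Real.log (m t x / β ^ d))

/-- Non-equilibrium Helmholtz energy density `A = H - S`. -/
def helmholtz (β : ℝ) (m H : ℝ → Phase d → ℝ) (t : ℝ) (x : Phase d) : ℝ :=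
  H t x - microEntropy β m t x

/-- `m` is the evolving phase-space density of the Langevin-Kramers diffusion
`dχ = (J - G) ∂H dt / τ + √(2 / (β τ)) G^(1/2) dω` on `[t₀, t₁]`, the control Hamiltonian `H` is
admissible, and the diffusion steers `mo` into `mf`. -/
structure IsLKTransition (β τ t₀ t₁ : ℝ) (mo mf : Phase d → ℝ) (m H : ℝ → Phase d → ℝ) :
    Prop where
  density_regular : IsC21 m
  hamiltonian_regular : IsC21 H
  pos : ∀ t ∈ Set.Icc t₀ t₁, ∀ x, 0 < m t x
  mass : ∀ t ∈ Set.Icc t₀ t₁, ∫ x, m t x = 1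
  /-- The Fokker-Planck equation. -/
  fokkerPlanck : ∀ t ∈ Set.Icc t₀ t₁, ∀ x,
    τ * dt m t x = -divQ (fun y => m t y • gradP (H t) y) x
      + divP (fun y => m t y • (gradQ (H t) y + gradP (H t) y)) x + β⁻¹ * lapP (m t) x
  initial : m t₀ = mo
  final : m t₁ = mf
  square_integrable : ∀ t ∈ Set.Icc t₀ t₁, Integrable (fun x => H t x ^ 2 * m t x)
  /-- The probability current `m (J - G) ∂A` is integrable over the control horizon
  (no boundary terms at infinity). -/
  currentQ_integrable : Integrable
    (fun z : ℝ × Phase d => m z.1 z.2 * ‖gradP (helmholtz β m H z.1) z.2‖)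
    ((volume.restrict (Set.Icc t₀ t₁)).prod volume)
  currentP_integrable : Integrable
    (fun z : ℝ × Phase d => m z.1 z.2 * ‖gradQ (helmholtz β m H z.1) z.2‖)
    ((volume.restrict (Set.Icc t₀ t₁)).prod volume)

/-- Langevin-Kramers entropy production `β E ∫ ‖∂_x A‖_G² dt / τ`. -/
def lkEntropyProduction (β τ t₀ t₁ : ℝ) (m H : ℝ → Phase d → ℝ) : ℝ≥0∞ :=
  ENNReal.ofReal (β / τ) * ∫⁻ t in Set.Icc t₀ t₁, ∫⁻ x,
    ENNReal.ofReal (m t x * ‖gradP (helmholtz β m H t) x‖ ^ 2)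

/-- Minimal (infimal) Langevin-Kramers entropy production between two states. -/
def lkMinimum (β τ t₀ t₁ : ℝ) (mo mf : Phase d → ℝ) : ℝ≥0∞ :=
  ⨅ (m : ℝ → Phase d → ℝ) (H : ℝ → Phase d → ℝ) (_ : IsLKTransition β τ t₀ t₁ mo mf m H),
    lkEntropyProduction β τ t₀ t₁ m H

end LangevinKramers

section LangevinSmoluchowski

variable {d : ℕ}

/-- Non-equilibrium Helmholtz energy density `H + β⁻¹ log ρ` on configuration space
(up to an additive constant). -/
def lsHelmholtz (β : ℝ) (ρ H : ℝ → Pos d → ℝ) (t : ℝ) (q : Pos d) : ℝ :=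
  H t q + β⁻¹ * Real.log (ρ t q)

/-- `ρ` is the evolving density of the Langevin-Smoluchowski diffusion
`dξ = -∂H dt / τ + √(2 / (β τ)) dω` on `[t₀, t₁]`, steered from `ρo` to `ρf` by the smooth control
potential `H`. -/
structure IsLSTransition (β τ t₀ t₁ : ℝ) (ρo ρf : Pos d → ℝ) (ρ H : ℝ → Pos d → ℝ) : Prop where
  density_regular : IsC21 ρ
  potential_regular : IsC21 H
  pos : ∀ t ∈ Set.Icc t₀ t₁, ∀ q, 0 < ρ t q
  mass : ∀ t ∈ Set.Icc t₀ t₁, ∫ q, ρ t q = 1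
  fokkerPlanck : ∀ t ∈ Set.Icc t₀ t₁, ∀ q,
    τ * dt ρ t q = divergence (fun y => ρ t y • gradient (H t) y) q
      + β⁻¹ * Laplacian.laplacian (ρ t) q
  initial : ρ t₀ = ρo
  final : ρ t₁ = ρf

/-- Langevin-Smoluchowski entropy production. -/
def lsEntropyProduction (β τ t₀ t₁ : ℝ) (ρ H : ℝ → Pos d → ℝ) : ℝ≥0∞ :=
  ENNReal.ofReal (β / τ) * ∫⁻ t in Set.Icc t₀ t₁, ∫⁻ q,
    ENNReal.ofReal (ρ t q * ‖gradient (lsHelmholtz β ρ H t) q‖ ^ 2)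

/-- Minimal (infimal) Langevin-Smoluchowski entropy production between two states. -/
def lsMinimum (β τ t₀ t₁ : ℝ) (ρo ρf : Pos d → ℝ) : ℝ≥0∞ :=
  ⨅ (ρ : ℝ → Pos d → ℝ) (H : ℝ → Pos d → ℝ) (_ : IsLSTransition β τ t₀ t₁ ρo ρf ρ H),
    lsEntropyProduction β τ t₀ t₁ ρ H

/-- Monge-Kantorovich cost for the squared Euclidean distance: infimum over all couplings. -/
def transportCost (μ ν : Measure (Pos d)) : ℝ≥0∞ :=
  ⨅ (π : Measure (Pos d × Pos d)) (_ : π.map Prod.fst = μ ∧ π.map Prod.snd = ν),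
    ∫⁻ z, ENNReal.ofReal (‖z.1 - z.2‖ ^ 2) ∂π

/-- The measure with a given density with respect to Lebesgue measure. -/
def densityMeasure (ρ : Pos d → ℝ) : Measure (Pos d) :=
  volume.withDensity (fun q => ENNReal.ofReal (ρ q))

end LangevinSmoluchowski

section Overdamped

variable {d : ℕ}

/-- Boundary state, Maxwellian in the momentum with scale `lam`:
`(β / (2 π lam))^d exp (-β ‖p‖² / (2 lam²) - β U(q))`. -/
def maxwellianState (β lam : ℝ) (U : Pos d → ℝ) (x : Phase d) : ℝ :=
  (β / (2 * Real.pi * lam)) ^ d * Real.exp (-β * ‖x.2‖ ^ 2 / (2 * lam ^ 2) - β * U x.1)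

/-- Its configuration marginal `(β / (2 π))^(d/2) exp (-β U(q))`. -/
def marginalState (β : ℝ) (U : Pos d → ℝ) (q : Pos d) : ℝ :=
  (β / (2 * Real.pi)) ^ ((d : ℝ) / 2) * Real.exp (-β * U q)

/-- The momentum integral of `β^d exp (-β (‖p‖² / 2 + s(t, q)))`. -/
def cellDensity (β : ℝ) (s : ℝ → Pos d → ℝ) (t : ℝ) (q : Pos d) : ℝ :=
  (2 * Real.pi * β) ^ ((d : ℝ) / 2) * Real.exp (-β * s t q)

/-- The field `Σ lamⁱ cᵢ(t, q, p / lam)`, `i = 0, 1, 2`. -/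
def twoScale (c : Fin 3 → ℝ → Phase d → ℝ) (lam : ℝ) (t : ℝ) (x : Phase d) : ℝ :=
  ∑ i : Fin 3, lam ^ (i : ℕ) * c i t (x.1, lam⁻¹ • x.2)

/-- Remainder, as a function of `x = (q, p̃)`, of the expansion
`F lam (t, q, lam p̃) = Σ lamⁱ cᵢ(t, q, p̃) + …`, `i = 0, 1, 2`. -/
def expansionRemainder (F : ℝ → ℝ → Phase d → ℝ) (c : Fin 3 → ℝ → Phase d → ℝ)
    (lam : ℝ) (t : ℝ) (x : Phase d) : ℝ :=
  F lam t (x.1, lam • x.2) - ∑ i : Fin 3, lam ^ (i : ℕ) * c i t x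

/-- `F lam (t, q, lam p̃) = Σ lamⁱ cᵢ(t, q, p̃) + o(lam²)` as `lam ↓ 0`, pointwise, and the expansion
may be differentiated term by term. -/
structure HasTwoScaleExpansion (t₀ t₁ : ℝ) (F : ℝ → ℝ → Phase d → ℝ)
    (c : Fin 3 → ℝ → Phase d → ℝ) : Prop where
  regular : ∀ i, IsC21 (c i)
  value : ∀ t ∈ Set.Icc t₀ t₁, ∀ x,
    (fun lam => expansionRemainder F c lam t x) =o[𝓝[>] 0] (fun lam : ℝ => lam ^ 2)
  time : ∀ t ∈ Set.Icc t₀ t₁, ∀ x,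
    (fun lam => dt (expansionRemainder F c lam) t x) =o[𝓝[>] 0] (fun lam : ℝ => lam ^ 2)
  gradQ : ∀ t ∈ Set.Icc t₀ t₁, ∀ x,
    (fun lam => gradQ (expansionRemainder F c lam t) x) =o[𝓝[>] 0] (fun lam : ℝ => lam ^ 2)
  gradP : ∀ t ∈ Set.Icc t₀ t₁, ∀ x,
    (fun lam => gradP (expansionRemainder F c lam t) x) =o[𝓝[>] 0] (fun lam : ℝ => lam ^ 2)
  lapP : ∀ t ∈ Set.Icc t₀ t₁, ∀ x,
    (fun lam => lapP (expansionRemainder F c lam t) x) =o[𝓝[>] 0] (fun lam : ℝ => lam ^ 2)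

/-- The cell problem for `a = A₀(t, q)` and `s = S₀₀(t, q)`, with the boundary values of `s` that
correspond to the boundary states with potentials `Uo` and `Uf`. -/
structure IsCellSolution (β τ t₀ t₁ : ℝ) (Uo Uf : Pos d → ℝ) (a s : ℝ → Pos d → ℝ) : Prop where
  value : ∀ t ∈ Set.Icc t₀ t₁, ∀ q, 2 * τ * dt a t q - ‖gradient (a t) q‖ ^ 2 = 0
  entropy : ∀ t ∈ Set.Icc t₀ t₁, ∀ q,
    τ * dt s t q - inner ℝ (gradient (a t) q) (gradient (s t) q)
      + β⁻¹ * Laplacian.laplacian (a t) q = 0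
  initial : ∀ q, s t₀ q = Uo q + d / β * Real.log (2 * Real.pi)
  final : ∀ q, s t₁ q = Uf q + d / β * Real.log (2 * Real.pi)

/-- The family `(m, H, V)`, indexed by the scale parameter `lam ↓ 0`, consists of admissible
transitions between the Maxwellian boundary states, with costates `V`; it solves the extremal
equations up to errors that vanish with `lam` (at fixed `t`, `q`, `p̃ = p / lam`), the entropy
equation being the Fokker-Planck equation; and it has two-scale expansions with coefficients
`S i`, `A i`, `V' i`. The additive constant `(d / β) log lam`, which no equation sees, is split off
the entropy. The coefficients of `A` and `V` are square integrable for the leading density. -/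
structure IsExtremalExpansion (β τ t₀ t₁ : ℝ) (Uo Uf : Pos d → ℝ)
    (m H V : ℝ → ℝ → Phase d → ℝ) (S A V' : Fin 3 → ℝ → Phase d → ℝ) : Prop where
  transition : ∀ᶠ lam in 𝓝[>] (0 : ℝ), IsLKTransition β τ t₀ t₁
    (maxwellianState β lam Uo) (maxwellianState β lam Uf) (m lam) (H lam)
  costate_regular : ∀ᶠ lam in 𝓝[>] (0 : ℝ), IsC21 (V lam)
  value : ∀ t ∈ Set.Icc t₀ t₁, ∀ x : Phase d, Tendsto
    (fun lam => valueResidual τ (helmholtz β (m lam) (H lam)) (V lam) t (x.1, lam • x.2))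
    (𝓝[>] 0) (𝓝 0)
  stationarity : ∀ t ∈ Set.Icc t₀ t₁, ∀ x : Phase d, Tendsto
    (fun lam => stationarityResidual β (microEntropy β (m lam)) (helmholtz β (m lam) (H lam))
      (V lam) t (x.1, lam • x.2))
    (𝓝[>] 0) (𝓝 0)
  expansionS : HasTwoScaleExpansion t₀ t₁
    (fun lam t x => microEntropy β (m lam) t x - d / β * Real.log lam) S
  expansionA : HasTwoScaleExpansion t₀ t₁ (fun lam => helmholtz β (m lam) (H lam)) A
  expansionV : HasTwoScaleExpansion t₀ t₁ V V'
  square_integrableA : ∀ i, ∀ t ∈ Set.Icc t₀ t₁,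
    Integrable (fun x => A i t x ^ 2 * Real.exp (-β * S 0 t x))
  square_integrableV : ∀ i, ∀ t ∈ Set.Icc t₀ t₁,
    Integrable (fun x => V' i t x ^ 2 * Real.exp (-β * S 0 t x))

/-- The expansion is uniform in the norm of the entropy production, to the order needed to expand
that functional: in the variables `(q, p̃)`, with `M = lam^d m(t, q, lam p̃)`,
`∂_p̃ A = lam ∂_p̃ A₁ + O(lam²)` in mean square with respect to `M`, and
`M = β^d exp (-β S₀) + O(lam)` in the weighted mean. -/
structure IsEnergyUniform (β t₀ t₁ : ℝ) (m H : ℝ → ℝ → Phase d → ℝ)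
    (S A : Fin 3 → ℝ → Phase d → ℝ) : Prop where
  momentum_gradient : ∃ C : ℝ, ∀ᶠ lam in 𝓝[>] (0 : ℝ),
    ∫⁻ t in Set.Icc t₀ t₁, ∫⁻ x : Phase d, ENNReal.ofReal (lam ^ d * m lam t (x.1, lam • x.2) *
      ‖gradP (helmholtz β (m lam) (H lam) t) (x.1, lam • x.2) - gradP (A 1 t) x‖ ^ 2)
    ≤ ENNReal.ofReal (C * lam ^ 2)
  density : ∃ C : ℝ, ∀ᶠ lam in 𝓝[>] (0 : ℝ),
    ∫⁻ t in Set.Icc t₀ t₁, ∫⁻ x : Phase d, ENNReal.ofReal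
      (|lam ^ d * m lam t (x.1, lam • x.2) - β ^ d * Real.exp (-β * S 0 t x)| *
        ‖gradP (A 1 t) x‖ ^ 2)
    ≤ ENNReal.ofReal (C * lam)

end Overdamped

end

/-!
# Overdamped limit of optimally controlled Langevin-Kramers transitions

Everything rests on one object, a *potential flow* (`IsPotentialFlow`): a classical solution `ψ` of
the Hamilton-Jacobi equation `∂_t ψ + ‖∂ψ‖² / 2 = 0` with a positive density transported by `∂ψ`.
A solution `(a, s)` of the cell problem is one, with `ψ = -a / τ` and the density `cellDensity β s`
(`IsCellSolution.isPotentialFlow`).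

*Transport.* In a frame moving with velocity `v = ∂ψ(c, q)`, the gradient of `ψ` minus `v` solves a
linear differential equation along the straight line through `q`, and vanishes at time `c`
(`IsHamiltonJacobi.gradient_line`). Hence `∂ψ` is constant along straight characteristics, which
therefore do not cross and cover the whole space at each time; with Liouville's formula for the
Jacobian this gives the push-forward of the densities. The Hopf-Lax inequality
`ψ(t₁, y) - ψ(t₀, x) ≤ ‖x - y‖² / (2 (t₁ - t₀))`, with equality along characteristics, makes
`(ψ(t₀), ψ(t₁))` dual optimizers for the quadratic cost. They are integrable because Brenier's
potentials have affine minorants and an integrable sum on the graph.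

*Lower bounds.* For any continuity equation with velocity `v` on a space over configuration space,
`⟪∂ψ, v⟫ - ‖∂ψ‖² / 2 ≤ ‖v‖² / 2` bounds the action below by the dual value of `ψ`
(`IsPotentialFlow.action_le`). Truncating `ψ` makes it bounded and keeps it a subsolution, so that
integrability of the current suffices to remove cut-offs at infinity. The current velocity of a
Langevin-Smoluchowski transition is `-∂(H + β⁻¹ log ρ) / τ`, and the position component of that of a
Langevin-Kramers transition is `∂_p A / τ`; hence the same number bounds both entropy productions,
and a potential flow attains it in configuration space.

*Expansion.* After multiplication with `lam²` the residuals of the extremal equations have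
expansions to second order whose coefficients must vanish. On each fibre of fixed position they are,
up to subtraction of explicit polynomials in the momentum, equations `𝔖 f = k` with a constant `k`
for the Witten Laplacian `𝔖` of a Gaussian weight. Caccioppoli's inequality with cut-offs
shows that square integrable solutions are constant for `k = 0`
(`gradient_eq_zero_of_witten_eq_zero`), and that no other constant `k` is possible
(`eq_zero_of_witten_eq_const`). The solvability conditions of order two (`solvability_conditions`)
are the entropy equation of the cell problem and, for `φ = V₀ - 2 A₀`, the equation `𝔖 φ = 0` on
configuration space, whence `∂V₀ = 2 ∂A₀`. The value equation of order two is then the first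
equation of the cell problem for `a = V₀ / 2`. Conversely the same coefficients vanish for the
fields built from a smooth solution of the cell problem, with a correction `A₂` quadratic in the
momentum.

*Energy.* Under uniformity in energy norm, Young's inequality with weight `lam` splits the entropy
production into that of the leading Maxwellian density and `∂_p̃ A₁ = -∂a`, whose momentum integral
is the action of the cell problem, and errors of order `lam`.
-/

noncomputable section

/-! ### Functions of class `C^(2,1)` -/

section C21

variable {X : Type*} [NormedAddCommGroup X] [NormedSpace ℝ X] {f g : ℝ → X → ℝ}

theorem IsC21.hasDerivAt_time (hf : IsC21 f) (t : ℝ) (x : X) :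
    HasDerivAt (fun s => f s x) (dt f t x) t := (hf.time x t).hasDerivAt

theorem IsC21.differentiable (hf : IsC21 f) (t : ℝ) : Differentiable ℝ (f t) :=
  (hf.space t).differentiable (by norm_num)

/-- A function of class `C^(2,1)` is jointly strictly differentiable. -/
theorem IsC21.hasStrictFDerivAt (hf : IsC21 f) (t : ℝ) (x : X) :
    HasStrictFDerivAt (fun z : ℝ × X => f z.1 z.2)
      ((ContinuousLinearMap.toSpanSingleton ℝ (dt f t x)).coprod (fderiv ℝ (f t) x)) (t, x) := by
  have h := hasStrictFDerivAt_uncurry_coprod (𝕜 := ℝ) (u := (t, x)) (f := f)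
    (f₁ := fun t x => ContinuousLinearMap.toSpanSingleton ℝ (dt f t x))
    (f₂ := fun t x => fderiv ℝ (f t) x)
    (Eventually.of_forall fun v => (hf.hasDerivAt_time v.1 v.2).hasFDerivAt)
    (Eventually.of_forall fun v => (hf.differentiable v.1 v.2).hasFDerivAt)
    ?_ hf.continuous_fderiv.continuousAt
  · exact h
  · have h1 : Continuous (fun z : ℝ × X => dt f z.1 z.2) := hf.continuous_time_deriv
    exact ((ContinuousLinearMap.toSpanSingletonCLE (𝕜 := ℝ) (E := ℝ)).continuous.comp
      h1).continuousAt

theorem IsC21.continuous (hf : IsC21 f) : Continuous (fun z : ℝ × X => f z.1 z.2) :=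
  continuous_iff_continuousAt.2 fun z => (hf.hasStrictFDerivAt z.1 z.2).hasFDerivAt.continuousAt

theorem IsC21.continuous_dt (hf : IsC21 f) : Continuous (fun z : ℝ × X => dt f z.1 z.2) :=
  hf.continuous_time_deriv

theorem IsC21.hasDerivAt_comp (hf : IsC21 f) {γ : ℝ → X} {γ' : X} {t : ℝ}
    (hγ : HasDerivAt γ γ' t) :
    HasDerivAt (fun s => f s (γ s)) (dt f t (γ t) + fderiv ℝ (f t) (γ t) γ') t := by
  have h := (hf.hasStrictFDerivAt t (γ t)).hasFDerivAt.comp_hasDerivAt t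
    ((hasDerivAt_id t).prodMk hγ)
  simpa [Function.comp_def] using h

theorem isC21_of_joint {X : Type*} [NormedAddCommGroup X] [NormedSpace ℝ X] {f : ℝ → X → ℝ}
    (hf : ContDiff ℝ 3 (fun z : ℝ × X => f z.1 z.2)) : IsC21 f where
  space t := (hf.of_le (by norm_num)).comp (contDiff_const.prodMk contDiff_id)
  time x := (hf.differentiable (by norm_num)).comp
    ((differentiable_id).prodMk (differentiable_const x))
  continuous_time_deriv := by
    have h : ContDiff ℝ 0 (fun z : ℝ × X => fderiv ℝ (fun s => f s z.2) z.1) := by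
      refine ContDiff.fderiv (n := 0) (m := 3) (f := fun (z : ℝ × X) s => f s z.2)
        (g := fun z => z.1) ?_
        contDiff_fst (by norm_num)
      exact hf.comp (contDiff_snd.prodMk (contDiff_snd.comp contDiff_fst))
    exact h.continuous.clm_apply continuous_const
  continuous_fderiv := by
    have h : ContDiff ℝ 0 (fun z : ℝ × X => fderiv ℝ (f z.1) z.2) := by
      refine ContDiff.fderiv (n := 0) (m := 3) (f := fun (z : ℝ × X) => f z.1)
        (g := fun z => z.2) ?_
        contDiff_snd (by norm_num)
      exact hf.comp ((contDiff_fst.comp contDiff_fst).prodMk contDiff_snd)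
    exact h.continuous
  continuous_fderiv_fderiv := by
    have h1 : ContDiff ℝ 1 (fun z : ℝ × X => fderiv ℝ (f z.1) z.2) := by
      refine ContDiff.fderiv (n := 1) (m := 3) (f := fun (z : ℝ × X) => f z.1)
        (g := fun z => z.2) ?_
        contDiff_snd (by norm_num)
      exact hf.comp ((contDiff_fst.comp contDiff_fst).prodMk contDiff_snd)
    have h : ContDiff ℝ 0 (fun z : ℝ × X => fderiv ℝ (fderiv ℝ (f z.1)) z.2) := by
      refine ContDiff.fderiv (n := 0) (m := 1) (f := fun (z : ℝ × X) => fderiv ℝ (f z.1))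
        (g := fun z => z.2) ?_ contDiff_snd (by norm_num)
      exact h1.comp ((contDiff_fst.comp contDiff_fst).prodMk contDiff_snd)
    exact h.continuous

theorem dt_comp (hf : IsC21 f) {Θ : ℝ → ℝ} (hΘ : Differentiable ℝ Θ) (t : ℝ) (x : X) :
    dt (fun t x => Θ (f t x)) t x = deriv Θ (f t x) * dt f t x :=
  (((hΘ (f t x)).hasDerivAt.comp t (hf.hasDerivAt_time t x))).deriv

theorem fderiv_scalar_comp {f : X → ℝ} {x : X} (hf : DifferentiableAt ℝ f x) {Θ : ℝ → ℝ}
    (hΘ : DifferentiableAt ℝ Θ (f x)) :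
    fderiv ℝ (fun x => Θ (f x)) x = deriv Θ (f x) • fderiv ℝ f x :=
  (hΘ.hasDerivAt.comp_hasFDerivAt x hf.hasFDerivAt).fderiv

/-- Composition with a smooth function of one variable preserves the class `C^(2,1)`. -/
theorem IsC21.comp_left (hf : IsC21 f) {Θ : ℝ → ℝ} (hΘ : ContDiff ℝ 2 Θ) :
    IsC21 (fun t x => Θ (f t x)) := by
  have hΘ1 : ContDiff ℝ 1 (deriv Θ) :=
    ((contDiff_succ_iff_deriv (n := 1)).1 (by simpa [one_add_one_eq_two] using hΘ)).2.2
  have hΘd : Differentiable ℝ Θ := hΘ.differentiable (by norm_num)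
  have hΘd1 : Differentiable ℝ (deriv Θ) := hΘ1.differentiable (by norm_num)
  have hfd : ∀ t, fderiv ℝ (fun x => Θ (f t x)) = fun x => deriv Θ (f t x) • fderiv ℝ (f t) x :=
    fun t => funext fun x => fderiv_scalar_comp (hf.differentiable t x) (hΘd _)
  refine ⟨fun t => hΘ.comp (hf.space t), fun x => hΘd.comp (hf.time x), ?_, ?_, ?_⟩
  · have : (fun z : ℝ × X => deriv (fun s => Θ (f s z.2)) z.1)
        = fun z => deriv Θ (f z.1 z.2) * dt f z.1 z.2 := funext fun z => dt_comp hf hΘd z.1 z.2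
    rw [this]
    exact (hΘ1.continuous.comp hf.continuous).mul hf.continuous_dt
  · simp only [hfd]
    exact (hΘ1.continuous.comp hf.continuous).smul hf.continuous_fderiv
  · have h2 : ∀ t x, fderiv ℝ (fun x => deriv Θ (f t x) • fderiv ℝ (f t) x) x
        = deriv Θ (f t x) • fderiv ℝ (fderiv ℝ (f t)) x
          + (deriv (deriv Θ) (f t x) • fderiv ℝ (f t) x).smulRight (fderiv ℝ (f t) x) := by
      intro t x
      have h1 : DifferentiableAt ℝ (fun x => deriv Θ (f t x)) x :=
        (hΘd1 _).comp x (hf.differentiable t x)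
      have h2 : DifferentiableAt ℝ (fderiv ℝ (f t)) x :=
        (((hf.space t).fderiv_right (m := 1) (by norm_num)).differentiable (by norm_num)) x
      rw [fderiv_fun_smul h1 h2, fderiv_scalar_comp (hf.differentiable t x) (hΘd1 _)]
    simp only [hfd, h2]
    have hc2 : Continuous (deriv (deriv Θ)) := hΘ1.continuous_deriv (by norm_num)
    refine ((hΘ1.continuous.comp hf.continuous).smul hf.continuous_fderiv_fderiv).add ?_
    have h3 : Continuous fun z : ℝ × X => deriv (deriv Θ) (f z.1 z.2) • fderiv ℝ (f z.1) z.2 :=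
      (hc2.comp hf.continuous).smul hf.continuous_fderiv
    exact ((ContinuousLinearMap.smulRightL ℝ X (X →L[ℝ] ℝ)).continuous.comp h3).clm_apply
      hf.continuous_fderiv

theorem IsC21.add (hf : IsC21 f) (hg : IsC21 g) : IsC21 (fun t x => f t x + g t x) := by
  have h1 : ∀ t, fderiv ℝ (fun x => f t x + g t x) = fun x => fderiv ℝ (f t) x + fderiv ℝ (g t) x :=
    fun t => funext fun x => fderiv_fun_add (hf.differentiable t x) (hg.differentiable t x)
  have h2 : ∀ t x, fderiv ℝ (fun x => fderiv ℝ (f t) x + fderiv ℝ (g t) x) x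
      = fderiv ℝ (fderiv ℝ (f t)) x + fderiv ℝ (fderiv ℝ (g t)) x := fun t x =>
    fderiv_fun_add
      ((((hf.space t).fderiv_right (m := 1) (by norm_num)).differentiable (by norm_num)) x)
      ((((hg.space t).fderiv_right (m := 1) (by norm_num)).differentiable (by norm_num)) x)
  refine ⟨fun t => (hf.space t).add (hg.space t), fun x => (hf.time x).add (hg.time x), ?_, ?_, ?_⟩
  · have : (fun z : ℝ × X => deriv (fun s => f s z.2 + g s z.2) z.1)
        = fun z => dt f z.1 z.2 + dt g z.1 z.2 :=
      funext fun z => deriv_fun_add (hf.time _ _) (hg.time _ _)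
    rw [this]
    exact hf.continuous_dt.add hg.continuous_dt
  · simp only [h1]; exact hf.continuous_fderiv.add hg.continuous_fderiv
  · simp only [h1, h2]; exact hf.continuous_fderiv_fderiv.add hg.continuous_fderiv_fderiv

theorem IsC21.const_mul (hf : IsC21 f) (c : ℝ) : IsC21 (fun t x => c * f t x) :=
  hf.comp_left (Θ := fun y => c * y) (contDiff_const.mul contDiff_id)

/-- Precomposition with a continuous linear map preserves the class `C^(2,1)`. -/
theorem IsC21.comp_clm {Y : Type*} [NormedAddCommGroup Y] [NormedSpace ℝ Y] (hf : IsC21 f)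
    (L : Y →L[ℝ] X) : IsC21 (fun t y => f t (L y)) := by
  have h1 : ∀ t, fderiv ℝ (fun y => f t (L y)) = fun y => (fderiv ℝ (f t) (L y)).comp L :=
    fun t => funext fun y =>
      ((hf.differentiable t (L y)).hasFDerivAt.comp y L.hasFDerivAt).fderiv
  have h2 : ∀ t y, fderiv ℝ (fun y => (fderiv ℝ (f t) (L y)).comp L) y
      = ((ContinuousLinearMap.compL ℝ Y X ℝ).flip L).comp
          ((fderiv ℝ (fderiv ℝ (f t)) (L y)).comp L) := fun t y => by
    have hd : HasFDerivAt (fun y => fderiv ℝ (f t) (L y))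
        ((fderiv ℝ (fderiv ℝ (f t)) (L y)).comp L) y := by
      have := (((hf.space t).fderiv_right (m := 1) (by norm_num)).differentiable
        (by norm_num)) (L y)
      exact this.hasFDerivAt.comp y L.hasFDerivAt
    exact (((ContinuousLinearMap.compL ℝ Y X ℝ).flip L).hasFDerivAt.comp y hd).fderiv
  have hL : Continuous fun z : ℝ × Y => (z.1, L z.2) :=
    continuous_fst.prodMk (L.continuous.comp continuous_snd)
  refine ⟨fun t => (hf.space t).comp L.contDiff, fun y => hf.time (L y),
    hf.continuous_time_deriv.comp hL, ?_, ?_⟩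
  · simp only [h1]
    exact (hf.continuous_fderiv.comp hL).clm_comp continuous_const
  · simp only [h1, h2]
    exact continuous_const.clm_comp
      ((hf.continuous_fderiv_fderiv.comp hL).clm_comp continuous_const)

end C21

/-! ### Gradients, divergences and Laplacians in coordinates -/

section Coordinates

variable {d : ℕ}

/-- The `i`-th standard basis vector of `ℝᵈ`. -/
abbrev basisVec (i : Fin d) : Pos d := EuclideanSpace.single i (1 : ℝ)

theorem sum_smul_basisVec (v : Pos d) : ∑ i, v i • basisVec i = v := by
  have := (EuclideanSpace.basisFun (Fin d) ℝ).sum_repr v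
  simpa using this

/-- A linear form is determined by its values on the standard basis. -/
theorem clm_eq_sum {F : Type*} [NormedAddCommGroup F] [NormedSpace ℝ F] (L : Pos d →L[ℝ] F)
    (v : Pos d) : L v = ∑ i, v i • L (basisVec i) := by
  conv_lhs => rw [← sum_smul_basisVec v]
  simp [map_sum]

theorem gradient_eq_toDual_symm (f : Pos d → ℝ) :
    gradient f = fun x => (InnerProductSpace.toDual ℝ (Pos d)).symm (fderiv ℝ f x) := rfl

theorem contDiff_gradient {f : Pos d → ℝ} {n m : ℕ∞ω} (hf : ContDiff ℝ n f) (h : m + 1 ≤ n) :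
    ContDiff ℝ m (gradient f) := by
  rw [gradient_eq_toDual_symm]
  exact (InnerProductSpace.toDual ℝ (Pos d)).symm.contDiff.comp (hf.fderiv_right h)

theorem fderiv_gradient {f : Pos d → ℝ} {x : Pos d} (hf : DifferentiableAt ℝ (fderiv ℝ f) x)
    (v : Pos d) :
    fderiv ℝ (gradient f) x v
      = (InnerProductSpace.toDual ℝ (Pos d)).symm (fderiv ℝ (fderiv ℝ f) x v) := by
  rw [gradient_eq_toDual_symm]
  have := ((InnerProductSpace.toDual ℝ (Pos d)).symm.toContinuousLinearEquiv.toContinuousLinearMap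
    |>.restrictScalars ℝ |>.hasFDerivAt (x := fderiv ℝ f x)).comp x hf.hasFDerivAt
  exact congrArg (fun L => L v) this.fderiv

theorem inner_fderiv_gradient {f : Pos d → ℝ} {x : Pos d}
    (hf : DifferentiableAt ℝ (fderiv ℝ f) x) (v w : Pos d) :
    inner ℝ (fderiv ℝ (gradient f) x v) w = fderiv ℝ (fderiv ℝ f) x v w := by
  rw [fderiv_gradient hf]; simp

theorem laplacian_eq_sum (f : Pos d → ℝ) (x : Pos d) :
    Laplacian.laplacian f x = ∑ i, fderiv ℝ (fderiv ℝ f) x (basisVec i) (basisVec i) := by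
  have := congrFun (InnerProductSpace.laplacian_eq_iteratedFDeriv_orthonormalBasis f
    (EuclideanSpace.basisFun (Fin d) ℝ)) x
  simp only [iteratedFDeriv_two_apply, EuclideanSpace.basisFun_apply] at this
  simpa using this

theorem divergence_gradient {f : Pos d → ℝ} {x : Pos d}
    (hf : DifferentiableAt ℝ (fderiv ℝ f) x) :
    divergence (gradient f) x = Laplacian.laplacian f x := by
  rw [laplacian_eq_sum, divergence]
  refine Finset.sum_congr rfl fun i _ => ?_
  rw [← inner_fderiv_gradient hf]; simp [EuclideanSpace.inner_single_right]

theorem divergence_smul {c : Pos d → ℝ} {X : Pos d → Pos d} {x : Pos d}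
    (hc : DifferentiableAt ℝ c x) (hX : DifferentiableAt ℝ X x) :
    divergence (fun y => c y • X y) x = fderiv ℝ c x (X x) + c x * divergence X x := by
  simp only [divergence, fderiv_fun_smul hc hX]
  rw [clm_eq_sum (fderiv ℝ c x) (X x), Finset.mul_sum, ← Finset.sum_add_distrib]
  refine Finset.sum_congr rfl fun i _ => ?_
  simp; ring

theorem divergence_add {X Y : Pos d → Pos d} {x : Pos d}
    (hX : DifferentiableAt ℝ X x) (hY : DifferentiableAt ℝ Y x) :
    divergence (fun y => X y + Y y) x = divergence X x + divergence Y x := by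
  simp only [divergence, fderiv_fun_add hX hY, ← Finset.sum_add_distrib]
  simp

theorem ContDiff.differentiable_fderiv {X : Type*} [NormedAddCommGroup X] [NormedSpace ℝ X]
    {f : X → ℝ} (hf : ContDiff ℝ 2 f) : Differentiable ℝ (fderiv ℝ f) :=
  (hf.fderiv_right (m := 1) (by norm_num)).differentiable (by norm_num)

end Coordinates

/-! ### Compactly supported fields and cut-off functions -/

section Cutoff

variable {X : Type*} [NormedAddCommGroup X] [NormedSpace ℝ X] [FiniteDimensional ℝ X]

/-- Cut-off functions at scale `R`, with gradient of order `1 / R`. -/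
theorem exists_cutoff (X : Type*) [NormedAddCommGroup X] [NormedSpace ℝ X]
    [FiniteDimensional ℝ X] :
    ∃ (K : ℝ) (χ : ℝ → X → ℝ), 0 ≤ K ∧ ∀ R, 0 < R → ContDiff ℝ ∞ (χ R) ∧ HasCompactSupport (χ R) ∧
      (∀ x, 0 ≤ χ R x ∧ χ R x ≤ 1) ∧ (∀ x, ‖x‖ ≤ R → χ R x = 1) ∧
      (∀ x, ‖fderiv ℝ (χ R) x‖ ≤ K / R) := by
  let b : ContDiffBump (0 : X) := ⟨1, 2, by norm_num, by norm_num⟩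
  have hbs : ContDiff ℝ ∞ b := b.contDiff
  have hbc : HasCompactSupport b := b.hasCompactSupport
  obtain ⟨K, hK⟩ := (hbs.continuous_fderiv (by simp)).bounded_above_of_compact_support
    (hbc.fderiv (𝕜 := ℝ))
  refine ⟨K, fun R x => b (R⁻¹ • x), (norm_nonneg _).trans (hK 0), fun R hR => ⟨?_, ?_, ?_, ?_, ?_⟩⟩
  · exact hbs.comp (contDiff_const_smul _)
  · exact hbc.comp_homeomorph (Homeomorph.smulOfNeZero R⁻¹ (inv_ne_zero hR.ne'))
  · exact fun x => ⟨b.nonneg, b.le_one⟩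
  · intro x hx
    refine b.one_of_mem_closedBall ?_
    simp only [Metric.mem_closedBall, dist_zero_right, norm_smul, norm_inv, Real.norm_eq_abs,
      abs_of_pos hR]
    exact (inv_mul_le_iff₀ hR).2 (by simpa [b] using hx)
  · intro x
    have h1 : HasFDerivAt (fun x : X => b (R⁻¹ • x))
        ((fderiv ℝ b (R⁻¹ • x)).comp (R⁻¹ • ContinuousLinearMap.id ℝ X)) x :=
      ((hbs.differentiable (by simp)) _).hasFDerivAt.comp x ((hasFDerivAt_id x).const_smul R⁻¹)
    rw [h1.fderiv]
    simp only [ContinuousLinearMap.comp_smul, ContinuousLinearMap.comp_id, norm_smul, norm_inv,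
      Real.norm_eq_abs, abs_of_pos hR]
    rw [div_eq_inv_mul]
    exact mul_le_mul_of_nonneg_left (hK _) (inv_nonneg.2 hR.le)

variable [MeasurableSpace X] [BorelSpace X] (μ : Measure X) [μ.IsAddHaarMeasure]

/-- Integration by parts for a compactly supported function and an arbitrary differentiable one. -/
theorem integral_mul_fderiv_eq_neg_of_hasCompactSupport {f g : X → ℝ} (hf : ContDiff ℝ 1 f)
    (hfc : HasCompactSupport f) (hg : ContDiff ℝ 1 g) (v : X) :
    ∫ x, f x * fderiv ℝ g x v ∂μ = -∫ x, fderiv ℝ f x v * g x ∂μ := by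
  have hf' : Continuous fun x => fderiv ℝ f x v :=
    (hf.continuous_fderiv (by norm_num)).clm_apply continuous_const
  have hg' : Continuous fun x => fderiv ℝ g x v :=
    (hg.continuous_fderiv (by norm_num)).clm_apply continuous_const
  refine integral_mul_fderiv_eq_neg_fderiv_mul_of_integrable ?_ ?_ ?_
    (fun x _ => (hf.differentiable (by norm_num)) x)
    (fun x _ => (hg.differentiable (by norm_num)) x)
  · exact (hf'.mul hg.continuous).integrable_of_hasCompactSupport
      ((hfc.fderiv_apply (𝕜 := ℝ) v).mul_right)
  · exact (hf.continuous.mul hg').integrable_of_hasCompactSupport hfc.mul_right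
  · exact (hf.continuous.mul hg.continuous).integrable_of_hasCompactSupport hfc.mul_right

/-- Integration by parts for the divergence of a field `Y` along the directions `w i`. -/
theorem integral_mul_sum_fderiv {d : ℕ} {f : X → ℝ} {Y : X → Pos d} (w : Fin d → X)
    (hf : ContDiff ℝ 1 f) (hfc : HasCompactSupport f) (hY : ContDiff ℝ 1 Y) :
    ∫ x, f x * ∑ i, fderiv ℝ Y x (w i) i ∂μ = -∫ x, fderiv ℝ f x (∑ i, Y x i • w i) ∂μ := by
  have hYi : ∀ i, ContDiff ℝ 1 fun x => Y x i := fun i =>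
    (EuclideanSpace.proj (𝕜 := ℝ) i).contDiff.comp hY
  have hYd : ∀ i x, fderiv ℝ Y x (w i) i = fderiv ℝ (fun x => Y x i) x (w i) := by
    intro i x
    have := ((EuclideanSpace.proj i : Pos d →L[ℝ] ℝ).hasFDerivAt (x := Y x)).comp x
      ((hY.differentiable (by norm_num)) x).hasFDerivAt
    exact (congrArg (fun L => L (w i)) this.fderiv).symm
  have hf' : ∀ v, Continuous fun x => fderiv ℝ f x v := fun v =>
    (hf.continuous_fderiv (by norm_num)).clm_apply continuous_const
  simp only [Finset.mul_sum, hYd, map_sum, map_smul, smul_eq_mul]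
  rw [integral_finsetSum, integral_finsetSum, ← Finset.sum_neg_distrib]
  · refine Finset.sum_congr rfl fun i _ => ?_
    rw [integral_mul_fderiv_eq_neg_of_hasCompactSupport μ hf hfc (hYi i)]
    simp only [mul_comm]
  · exact fun i _ => ((hYi i).continuous.mul (hf' _)).integrable_of_hasCompactSupport
      ((hfc.fderiv_apply (𝕜 := ℝ) _).mul_left)
  · exact fun i _ => (hf.continuous.mul (((hYi i).continuous_fderiv (by norm_num)).clm_apply
      continuous_const)).integrable_of_hasCompactSupport hfc.mul_right

end Cutoff

/-- Integration by parts for the divergence. -/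
theorem integral_mul_divergence {d : ℕ} {f : Pos d → ℝ} {Y : Pos d → Pos d} (hf : ContDiff ℝ 1 f)
    (hfc : HasCompactSupport f) (hY : ContDiff ℝ 1 Y) :
    ∫ x, f x * divergence Y x = -∫ x, fderiv ℝ f x (Y x) := by
  have h := integral_mul_sum_fderiv volume (fun i => basisVec i) hf hfc hY
  simpa only [sum_smul_basisVec, divergence] using h

/-! ### A Liouville theorem for Witten Laplacians -/

theorem HasCompactSupport.sq {X : Type*} [TopologicalSpace X] {f : X → ℝ}
    (hf : HasCompactSupport f) : HasCompactSupport fun x => f x ^ 2 :=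
  hf.comp_left (g := fun y => y ^ 2) (by simp)

section Liouville

variable {d : ℕ} {β : ℝ} {S f : Pos d → ℝ}

/-- The Witten Laplacian `-β ∂S · ∂f + Δf` of the weight `exp (-β S)` on `ℝᵈ`. -/
def witten (β : ℝ) (S f : Pos d → ℝ) (x : Pos d) : ℝ :=
  -β * inner ℝ (gradient S x) (gradient f x) + Laplacian.laplacian f x

theorem contDiff_weight (hS : ContDiff ℝ 2 S) : ContDiff ℝ 2 fun x => Real.exp (-β * S x) :=
  (contDiff_const.mul hS).exp

theorem fderiv_weight {S : Pos d → ℝ} {x : Pos d} (hS : DifferentiableAt ℝ S x) :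
    fderiv ℝ (fun x => Real.exp (-β * S x)) x = (-β * Real.exp (-β * S x)) • fderiv ℝ S x := by
  have h := (hS.hasFDerivAt.const_mul (-β)).exp
  rw [h.fderiv, smul_smul, mul_comm]

/-- The Witten Laplacian is the divergence form operator of its weight. -/
theorem integral_mul_witten (hS : ContDiff ℝ 2 S) (hf : ContDiff ℝ 2 f) {φ : Pos d → ℝ}
    (hφ : ContDiff ℝ 1 φ) (hφc : HasCompactSupport φ) :
    ∫ x, φ x * (witten β S f x * Real.exp (-β * S x))
      = -∫ x, fderiv ℝ φ x (gradient f x) * Real.exp (-β * S x) := by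
  have hg : ContDiff ℝ 1 (gradient f) := contDiff_gradient hf (by norm_num)
  have hw : ContDiff ℝ 1 fun x => Real.exp (-β * S x) := (contDiff_weight hS).of_le (by norm_num)
  have h := integral_mul_divergence (Y := fun x => Real.exp (-β * S x) • gradient f x) hφ hφc
    (hw.smul hg)
  have h1 : ∀ x, divergence (fun x => Real.exp (-β * S x) • gradient f x) x
      = witten β S f x * Real.exp (-β * S x) := by
    intro x
    rw [divergence_smul (hw.differentiable (by norm_num) x) (hg.differentiable (by norm_num) x),
      divergence_gradient (hf.differentiable_fderiv x),
      fderiv_weight (hS.differentiable (by norm_num) x), witten, inner_gradient_left]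
    simp; ring
  simp only [h1, map_smul, smul_eq_mul] at h
  rw [h]; simp only [mul_comm]

/-- Caccioppoli's inequality for solutions of `witten β S f = k`: the equation is tested with
`χ² f`. The flag `r` allows for two uses. For `k = 0` the choice `r = 0` leaves only the gradient of
the cut-off, which tends to zero with the scale; for `k ≠ 0` the source costs a multiple (`r = 1`)
of the square integral of `f`. -/
theorem witten_energy_le (hS : ContDiff ℝ 2 S) (hf : ContDiff ℝ 2 f) {k : ℝ}
    (hk : ∀ x, witten β S f x = k) (hkw : Integrable fun x => k ^ 2 * Real.exp (-β * S x))
    (hfw : Integrable fun x => f x ^ 2 * Real.exp (-β * S x)) {χ : Pos d → ℝ} {ε : ℝ}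
    (hχ : ContDiff ℝ ∞ χ) (hχc : HasCompactSupport χ) (hχ01 : ∀ x, 0 ≤ χ x ∧ χ x ≤ 1)
    (hχε : ∀ x, ‖fderiv ℝ χ x‖ ≤ ε) {r : ℝ} (hr : r = 0 ∨ r = 1) (hkr : k = 0 ∨ r = 1) :
    ∫ x, χ x ^ 2 * ‖gradient f x‖ ^ 2 * Real.exp (-β * S x)
      ≤ (4 * ε ^ 2 + 2 * r) * (∫ x, f x ^ 2 * Real.exp (-β * S x))
        + 2 * ∫ x, k ^ 2 * Real.exp (-β * S x) := by
  have hχ1 : ContDiff ℝ 1 χ := hχ.of_le (by exact_mod_cast le_top)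
  have hf1 : ContDiff ℝ 1 f := hf.of_le (by norm_num)
  have hgc : Continuous (gradient f) := (contDiff_gradient hf (m := 1) (by norm_num)).continuous
  have hw : Continuous fun x => Real.exp (-β * S x) := (contDiff_weight hS).continuous
  have hφ : ContDiff ℝ 1 fun x => χ x ^ 2 * f x := (hχ1.pow 2).mul hf1
  have hc2 : HasCompactSupport fun x => χ x ^ 2 := hχc.sq
  have hφc : HasCompactSupport fun x => χ x ^ 2 * f x := hc2.mul_right
  have h := integral_mul_witten (β := β) hS hf hφ hφc
  have hφ' : ∀ x, fderiv ℝ (fun x => χ x ^ 2 * f x) x (gradient f x)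
      = χ x ^ 2 * ‖gradient f x‖ ^ 2 + 2 * χ x * f x * fderiv ℝ χ x (gradient f x) := by
    intro x
    have h1 := (((hχ1.differentiable (by norm_num) x).hasFDerivAt.pow 2).mul
      (hf1.differentiable (by norm_num) x).hasFDerivAt).fderiv
    rw [show (fun x => χ x ^ 2 * f x) = ((fun x => χ x ^ 2) * f) from rfl]
    rw [h1]
    have h2 : fderiv ℝ f x (gradient f x) = ‖gradient f x‖ ^ 2 := by
      rw [← inner_gradient_left, real_inner_self_eq_norm_sq]
    simp [h2]
    ring
  simp only [hk, hφ'] at h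
  have hχ'c : Continuous fun x => fderiv ℝ χ x (gradient f x) :=
    (hχ1.continuous_fderiv (by norm_num)).clm_apply hgc
  have i1 : Integrable fun x => χ x ^ 2 * ‖gradient f x‖ ^ 2 * Real.exp (-β * S x) :=
    ((((hχ.continuous.pow 2).mul (hgc.norm.pow 2))).mul hw).integrable_of_hasCompactSupport
      (hc2.mul_right.mul_right)
  have i2 : Integrable fun x => 2 * χ x * f x * fderiv ℝ χ x (gradient f x)
      * Real.exp (-β * S x) := by
    refine ((((continuous_const.mul hχ.continuous).mul hf1.continuous).mul hχ'c).mul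
      hw).integrable_of_hasCompactSupport ?_
    exact ((hχc.mul_left (f := fun _ => (2 : ℝ))).mul_right.mul_right).mul_right
  have i3 : Integrable fun x => χ x ^ 2 * f x * (k * Real.exp (-β * S x)) :=
    (((hχ.continuous.pow 2).mul hf1.continuous).mul (continuous_const.mul
      hw)).integrable_of_hasCompactSupport hφc.mul_right
  simp only [add_mul] at h
  rw [integral_add i1 i2] at h
  have key : ∫ x, (-(χ x ^ 2 * f x * (k * Real.exp (-β * S x)))
      - 2 * χ x * f x * fderiv ℝ χ x (gradient f x) * Real.exp (-β * S x))
      ≤ ∫ x, (2⁻¹ * (χ x ^ 2 * ‖gradient f x‖ ^ 2 * Real.exp (-β * S x))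
        + ((2 * ε ^ 2 + r) * (f x ^ 2 * Real.exp (-β * S x))
          + k ^ 2 * Real.exp (-β * S x))) := by
    refine integral_mono (i3.neg.sub i2) ((i1.const_mul _).add ((hfw.const_mul _).add hkw)) ?_
    intro x
    have hε : |fderiv ℝ χ x (gradient f x)| ≤ ε * ‖gradient f x‖ :=
      ((fderiv ℝ χ x).le_opNorm _).trans
        (mul_le_mul_of_nonneg_right (hχε x) (norm_nonneg _))
    -- Young's inequality absorbs half of the energy in the left-hand side
    have a1 : -(2 * χ x * f x * fderiv ℝ χ x (gradient f x))
        ≤ 2⁻¹ * (χ x ^ 2 * ‖gradient f x‖ ^ 2) + 2 * ε ^ 2 * f x ^ 2 := by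
      have b1 : -(2 * χ x * f x * fderiv ℝ χ x (gradient f x))
          ≤ 2 * χ x * |f x| * (ε * ‖gradient f x‖) := by
        refine (neg_le_abs _).trans ?_
        rw [abs_mul, abs_mul, abs_mul, abs_two, abs_of_nonneg (hχ01 x).1]
        exact mul_le_mul_of_nonneg_left hε
          (mul_nonneg (mul_nonneg two_pos.le (hχ01 x).1) (abs_nonneg _))
      nlinarith [sq_nonneg (χ x * ‖gradient f x‖ - 2 * ε * |f x|), sq_abs (f x)]
    have a2 : -(χ x ^ 2 * f x * k) ≤ r * f x ^ 2 + k ^ 2 := by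
      rcases hkr with h | h
      · rcases hr with h' | h' <;> simp [h, h', sq_nonneg]
      · subst h
        have h0 := (hχ01 x).1
        have h1 : χ x ^ 2 ≤ 1 := pow_le_one₀ (hχ01 x).1 (hχ01 x).2
        nlinarith [sq_nonneg (χ x ^ 2 * f x + k), mul_nonneg (sub_nonneg.2 h1) (sq_nonneg (f x)),
          sq_nonneg (f x), sq_nonneg k, sq_nonneg (χ x), mul_nonneg (mul_nonneg (sub_nonneg.2 h1)
            (sq_nonneg (χ x))) (sq_nonneg (f x))]
    have hwp := Real.exp_pos (-β * S x)
    have := mul_le_mul_of_nonneg_right (add_le_add a1 a2) hwp.le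
    simp only
    linarith
  have e1 : ∫ x, (-(χ x ^ 2 * f x * (k * Real.exp (-β * S x)))
      - 2 * χ x * f x * fderiv ℝ χ x (gradient f x) * Real.exp (-β * S x))
      = -(∫ x, χ x ^ 2 * f x * (k * Real.exp (-β * S x)))
        - ∫ x, 2 * χ x * f x * fderiv ℝ χ x (gradient f x) * Real.exp (-β * S x) := by
    rw [← integral_neg]; exact integral_sub i3.neg i2
  have e2 : ∫ x, (2⁻¹ * (χ x ^ 2 * ‖gradient f x‖ ^ 2 * Real.exp (-β * S x))
        + ((2 * ε ^ 2 + r) * (f x ^ 2 * Real.exp (-β * S x))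
          + k ^ 2 * Real.exp (-β * S x)))
      = 2⁻¹ * (∫ x, χ x ^ 2 * ‖gradient f x‖ ^ 2 * Real.exp (-β * S x))
        + ((2 * ε ^ 2 + r) * (∫ x, f x ^ 2 * Real.exp (-β * S x))
          + ∫ x, k ^ 2 * Real.exp (-β * S x)) := by
    rw [← integral_const_mul, ← integral_const_mul, ← integral_add (hfw.const_mul _) hkw]
    exact integral_add (i1.const_mul _) ((hfw.const_mul _).add hkw)
  rw [e1, e2] at key
  linarith

/-- Liouville theorem: a square integrable function in the kernel of a Witten Laplacian
has vanishing gradient. The cut-off Caccioppoli inequality leaves nothing of the energy. -/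
theorem gradient_eq_zero_of_witten_eq_zero (hS : ContDiff ℝ 2 S) (hf : ContDiff ℝ 2 f)
    (hk : ∀ x, witten β S f x = 0) (hfw : Integrable fun x => f x ^ 2 * Real.exp (-β * S x))
    (x : Pos d) : gradient f x = 0 := by
  obtain ⟨K, χ, hK, hχ⟩ := exists_cutoff (Pos d)
  have hgc : Continuous (gradient f) := (contDiff_gradient hf (m := 1) (by norm_num)).continuous
  have hw : Continuous fun x => Real.exp (-β * S x) := (contDiff_weight hS).continuous
  have hr : 0 < ‖x‖ + 1 := by positivity
  obtain ⟨h1, h2, h3, h4, h5⟩ := hχ (‖x‖ + 1) hr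
  set g : ℝ → Pos d → ℝ := fun R x => χ R x ^ 2 * ‖gradient f x‖ ^ 2 * Real.exp (-β * S x) with hg
  have hgint : ∀ R, 0 < R → Continuous (g R) ∧ HasCompactSupport (g R) := by
    intro R hR
    obtain ⟨h1, h2, -⟩ := hχ R hR
    refine ⟨((h1.continuous.pow 2).mul (hgc.norm.pow 2)).mul hw, ?_⟩
    have hc2 : HasCompactSupport fun x => χ R x ^ 2 := h2.sq
    exact hc2.mul_right.mul_right
  have hg0 : ∀ R, 0 < R → ∀ x, 0 ≤ g R x := fun R hR x => by positivity
  obtain ⟨ρ, hρ⟩ := h2.isCompact.isBounded.exists_norm_le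
  -- beyond radius `ρ` the cut-off at scale `R` is one on the support of the fixed cut-off
  have hb : ∀ R, max ρ 1 ≤ R → ∫ y, g (‖x‖ + 1) y
      ≤ 4 * (K / R) ^ 2 * ∫ x, f x ^ 2 * Real.exp (-β * S x) := by
    intro R hR
    have hR0 : 0 < R := lt_of_lt_of_le one_pos ((le_max_right _ _).trans hR)
    obtain ⟨k1, k2, k3, k4, k5⟩ := hχ R hR0
    have e := witten_energy_le (k := 0) (r := 0) hS hf hk (by simp) hfw k1 k2 k3 k5
      (Or.inl rfl) (Or.inl rfl)
    simp only [mul_zero, add_zero, ne_eq, OfNat.ofNat_ne_zero, not_false_eq_true, zero_pow,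
      zero_mul, integral_zero] at e
    refine le_trans (integral_mono ((hgint _ hr).1.integrable_of_hasCompactSupport (hgint _ hr).2)
      ((hgint _ hR0).1.integrable_of_hasCompactSupport (hgint _ hR0).2) fun y => ?_) e
    by_cases hy : χ (‖x‖ + 1) y = 0
    · have h0 : g (‖x‖ + 1) y = 0 := by simp [hg, hy]
      rw [h0]; exact hg0 R hR0 y
    · have hyρ : ‖y‖ ≤ R := (hρ y (subset_tsupport _ hy)).trans ((le_max_left _ _).trans hR)
      simp only [hg, k4 y hyρ]
      have : χ (‖x‖ + 1) y ^ 2 ≤ 1 := pow_le_one₀ (h3 y).1 (h3 y).2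
      exact mul_le_mul_of_nonneg_right (mul_le_mul_of_nonneg_right (by simpa using this)
        (by positivity)) (by positivity)
  have hlim : Tendsto (fun R : ℝ => 4 * (K / R) ^ 2 * ∫ x, f x ^ 2 * Real.exp (-β * S x)) atTop
      (𝓝 (4 * 0 ^ 2 * ∫ x, f x ^ 2 * Real.exp (-β * S x))) :=
    (((tendsto_const_nhds.div_atTop tendsto_id).pow 2).const_mul 4).mul_const _
  have hle : ∫ y, g (‖x‖ + 1) y ≤ 0 := by
    refine (ge_of_tendsto hlim ((eventually_ge_atTop _).mono hb)).trans (by simp)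
  by_contra hne
  have hpos := (hgint _ hr).1.integral_pos_of_hasCompactSupport_nonneg_nonzero (μ := volume)
    (hgint _ hr).2 (hg0 _ hr) (x := x) (by
      simp only [hg, h4 x (by linarith)]
      have : 0 < ‖gradient f x‖ := norm_pos_iff.2 hne
      positivity)
  linarith

/-- Solvability condition: if the weight is integrable and `f` square integrable, then the Witten
Laplacian of `f` can only be constant if it vanishes. The equation tested with a cut-off `χ²`
bounds `k` by `1 / R` times the energy of `f`, and that is bounded by Caccioppoli's inequality. -/
theorem eq_zero_of_witten_eq_const (hS : ContDiff ℝ 2 S) (hf : ContDiff ℝ 2 f) {k : ℝ}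
    (hk : ∀ x, witten β S f x = k) (hw1 : Integrable fun x => Real.exp (-β * S x))
    (hfw : Integrable fun x => f x ^ 2 * Real.exp (-β * S x)) : k = 0 := by
  obtain ⟨K, χ, hK, hχ⟩ := exists_cutoff (Pos d)
  have hgc : Continuous (gradient f) := (contDiff_gradient hf (m := 1) (by norm_num)).continuous
  have hw : Continuous fun x => Real.exp (-β * S x) := (contDiff_weight hS).continuous
  obtain ⟨h1, h2, h3, h4, h5⟩ := hχ 1 one_pos
  have hsq : ∀ R, 0 < R → HasCompactSupport fun x => χ R x ^ 2 := fun R hR => (hχ R hR).2.1.sq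
  have hint : ∀ R, 0 < R → Integrable fun x => χ R x ^ 2 * Real.exp (-β * S x) := fun R hR =>
    (((hχ R hR).1.continuous.pow 2).mul hw).integrable_of_hasCompactSupport (hsq R hR).mul_right
  set c := ∫ x, χ 1 x ^ 2 * Real.exp (-β * S x) with hc
  have hcpos : 0 < c :=
    (((h1.continuous.pow 2).mul hw)).integral_pos_of_hasCompactSupport_nonneg_nonzero (μ := volume)
      (hsq 1 one_pos).mul_right (fun x => by positivity) (x := 0) (by
        have : χ 1 0 = 1 := h4 0 (by simp)
        simp only [this]; positivity)
  obtain ⟨ρ, hρ⟩ := h2.isCompact.isBounded.exists_norm_le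
  set B := (4 * K ^ 2 + 2 * 1) * (∫ x, f x ^ 2 * Real.exp (-β * S x))
        + 2 * ∫ x, k ^ 2 * Real.exp (-β * S x) with hB
  have hb : ∀ R, max ρ 1 ≤ R → |k| * c ≤ (K / R) * (B + ∫ x, Real.exp (-β * S x)) := by
    intro R hR
    have hR1 : 1 ≤ R := (le_max_right _ _).trans hR
    have hR0 : 0 < R := lt_of_lt_of_le one_pos hR1
    obtain ⟨k1, k2, k3, k4, k5⟩ := hχ R hR0
    have hKR : K / R ≤ K := div_le_self hK hR1
    have e := witten_energy_le (r := 1) hS hf hk (hw1.const_mul _) hfw k1 k2 k3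
      (fun x => (k5 x).trans hKR) (Or.inr rfl) (Or.inr rfl)
    have k1' : ContDiff ℝ 1 (χ R) := k1.of_le (by exact_mod_cast le_top)
    have h := integral_mul_witten (β := β) hS hf (k1'.pow 2) (hsq R hR0)
    have hφ' : ∀ x, fderiv ℝ (fun x => χ R x ^ 2) x (gradient f x)
        = 2 * χ R x * fderiv ℝ (χ R) x (gradient f x) := by
      intro x
      have h1 := ((k1'.differentiable (by norm_num) x).hasFDerivAt.pow 2).fderiv
      rw [h1]
      simp
    simp only [hk, hφ'] at h
    have h' : k * ∫ x, χ R x ^ 2 * Real.exp (-β * S x)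
        = -∫ x, 2 * χ R x * fderiv ℝ (χ R) x (gradient f x) * Real.exp (-β * S x) := by
      rw [← h, ← integral_const_mul]; congr 1; ext x; ring
    have hci : c ≤ ∫ x, χ R x ^ 2 * Real.exp (-β * S x) := by
      refine integral_mono (hint 1 one_pos) (hint R hR0) fun y => ?_
      by_cases hy : χ 1 y = 0
      · simp only [hy]; simp; positivity
      · have hyρ : ‖y‖ ≤ R := (hρ y (subset_tsupport _ hy)).trans ((le_max_left _ _).trans hR)
        simp only [k4 y hyρ]
        have : χ 1 y ^ 2 ≤ 1 := pow_le_one₀ (h3 y).1 (h3 y).2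
        exact mul_le_mul_of_nonneg_right (by simpa using this) (by positivity)
    have i1 : Integrable fun x => χ R x ^ 2 * ‖gradient f x‖ ^ 2 * Real.exp (-β * S x) :=
      ((((k1.continuous.pow 2).mul (hgc.norm.pow 2))).mul hw).integrable_of_hasCompactSupport
        ((hsq R hR0).mul_right.mul_right)
    calc |k| * c ≤ |k| * ∫ x, χ R x ^ 2 * Real.exp (-β * S x) := by gcongr
      _ = |∫ x, 2 * χ R x * fderiv ℝ (χ R) x (gradient f x) * Real.exp (-β * S x)| := by
          rw [← abs_neg (∫ x, 2 * χ R x * fderiv ℝ (χ R) x (gradient f x) * Real.exp (-β * S x)),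
            ← h', abs_mul, abs_of_nonneg (hcpos.le.trans hci)]
      _ ≤ ∫ x, (K / R) * (χ R x ^ 2 * ‖gradient f x‖ ^ 2 * Real.exp (-β * S x)
            + Real.exp (-β * S x)) := by
          rw [← Real.norm_eq_abs]
          refine norm_integral_le_of_norm_le (μ := volume) (g := fun x => (K / R) *
            (χ R x ^ 2 * ‖gradient f x‖ ^ 2 * Real.exp (-β * S x) + Real.exp (-β * S x)))
            ((i1.add hw1).const_mul _) (Eventually.of_forall fun x => ?_)
          have hε : |fderiv ℝ (χ R) x (gradient f x)| ≤ K / R * ‖gradient f x‖ :=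
            ((fderiv ℝ (χ R) x).le_opNorm _).trans
              (mul_le_mul_of_nonneg_right (k5 x) (norm_nonneg _))
          rw [Real.norm_eq_abs, abs_mul, abs_mul, abs_mul, abs_two, abs_of_nonneg (k3 x).1,
            abs_of_pos (Real.exp_pos _)]
          have hKR0 : 0 ≤ K / R := by positivity
          calc 2 * χ R x * |fderiv ℝ (χ R) x (gradient f x)| * Real.exp (-β * S x)
              ≤ 2 * χ R x * (K / R * ‖gradient f x‖) * Real.exp (-β * S x) := by
                have := (k3 x).1
                gcongr
            _ = K / R * ((2 * (χ R x * ‖gradient f x‖)) * Real.exp (-β * S x)) := by ring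
            _ ≤ K / R * ((χ R x ^ 2 * ‖gradient f x‖ ^ 2 + 1) * Real.exp (-β * S x)) := by
                gcongr
                nlinarith [sq_nonneg (χ R x * ‖gradient f x‖ - 1)]
            _ = _ := by ring
      _ = (K / R) * ((∫ x, χ R x ^ 2 * ‖gradient f x‖ ^ 2 * Real.exp (-β * S x))
            + ∫ x, Real.exp (-β * S x)) := by
          rw [integral_const_mul, integral_add i1 hw1]
      _ ≤ (K / R) * (B + ∫ x, Real.exp (-β * S x)) := by gcongr
  have hlim : Tendsto (fun R : ℝ => (K / R) * (B + ∫ x, Real.exp (-β * S x))) atTop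
      (𝓝 (0 * (B + ∫ x, Real.exp (-β * S x)))) :=
    (tendsto_const_nhds.div_atTop tendsto_id).mul_const _
  have hle : |k| * c ≤ 0 := by
    simpa using ge_of_tendsto hlim ((eventually_ge_atTop _).mono hb)
  by_contra hne
  have : 0 < |k| * c := mul_pos (abs_pos.2 hne) hcpos
  linarith

end Liouville

/-! ### Characteristics of the Hamilton-Jacobi equation -/

section Mixed

variable {X : Type*} [NormedAddCommGroup X] [NormedSpace ℝ X] [FiniteDimensional ℝ X]

/-- Interchange of a time and a space derivative: if `∂_t f = g` on `[a, b]` and `g` is `C¹` in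
space, then `∂_x f` is the time integral of `∂_x g`. -/
theorem fderiv_eq_add_integral {f g : ℝ → X → ℝ} {g' : ℝ → X → X →L[ℝ] ℝ} {a b : ℝ}
    (hf : ∀ t, Differentiable ℝ (f t))
    (hfg : ∀ t ∈ Set.Icc a b, ∀ x, HasDerivAt (fun s => f s x) (g t x) t)
    (hg : ∀ t x, HasFDerivAt (g t) (g' t x) x) (hgc : Continuous fun z : ℝ × X => g z.1 z.2)
    (hgc' : Continuous fun z : ℝ × X => g' z.1 z.2) {t : ℝ} (ht : t ∈ Set.Icc a b) (x : X) :
    fderiv ℝ (f t) x = fderiv ℝ (f a) x + ∫ s in a..t, g' s x := by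
  have hsub : Set.uIcc a t ⊆ Set.Icc a b := by
    rw [Set.uIcc_of_le ht.1]; exact Set.Icc_subset_Icc_right ht.2
  have hgx : ∀ x, Continuous fun s => g s x := fun x =>
    hgc.comp (continuous_id.prodMk continuous_const)
  have hgx' : ∀ x, Continuous fun s => g' s x := fun x =>
    hgc'.comp (continuous_id.prodMk continuous_const)
  have h1 : ∀ y, f t y = f a y + ∫ s in a..t, g s y := by
    intro y
    rw [intervalIntegral.integral_eq_sub_of_hasDerivAt (f := fun s => f s y)
      (fun s hs => hfg s (hsub hs) y) ((hgx y).intervalIntegrable _ _)]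
    ring
  obtain ⟨C, hC⟩ := ((isCompact_uIcc (a := a) (b := t)).prod
    (isCompact_closedBall x 1)).exists_bound_of_continuousOn hgc'.continuousOn
  have h2 : HasFDerivAt (fun y => ∫ s in a..t, g s y) (∫ s in a..t, g' s x) x := by
    refine intervalIntegral.hasFDerivAt_integral_of_dominated_of_fderiv_le (𝕜 := ℝ)
      (F := fun y s => g s y) (F' := fun y s => g' s y) (bound := fun _ => C)
      (Metric.ball_mem_nhds x one_pos) (Eventually.of_forall fun y =>
        (hgx y).aestronglyMeasurable) ((hgx x).intervalIntegrable _ _)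
      (hgx' x).aestronglyMeasurable (Eventually.of_forall fun s hs y hy => ?_)
      intervalIntegrable_const (Eventually.of_forall fun s _ y _ => hg s y)
    exact hC (s, y) ⟨Set.uIoc_subset_uIcc hs, Metric.ball_subset_closedBall hy⟩
  rw [show f t = fun y => f a y + ∫ s in a..t, g s y from funext h1]
  exact ((hf a x).hasFDerivAt.add h2).fderiv

end Mixed

/-- A classical solution of the Hamilton-Jacobi equation `∂_t ψ + ‖∂ψ‖² / 2 = 0` on `[t₀, t₁]`. -/
structure IsHamiltonJacobi {d : ℕ} (t₀ t₁ : ℝ) (ψ : ℝ → Pos d → ℝ) : Prop where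
  regular : IsC21 ψ
  eq : ∀ t ∈ Set.Icc t₀ t₁, ∀ x, dt ψ t x = -(‖gradient (ψ t) x‖ ^ 2 / 2)

section HamiltonJacobi

variable {d : ℕ} {t₀ t₁ : ℝ} {ψ ρ : ℝ → Pos d → ℝ}

theorem IsC21.continuous_gradient (hψ : IsC21 ψ) :
    Continuous fun z : ℝ × Pos d => gradient (ψ z.1) z.2 :=
  (InnerProductSpace.toDual ℝ (Pos d)).symm.continuous.comp hψ.continuous_fderiv

theorem IsC21.contDiff_gradient (hψ : IsC21 ψ) (t : ℝ) : ContDiff ℝ 1 (gradient (ψ t)) :=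
  _root_.contDiff_gradient (hψ.space t) (by norm_num)

theorem IsC21.differentiable_gradient (hψ : IsC21 ψ) (t : ℝ) :
    Differentiable ℝ (gradient (ψ t)) := (hψ.contDiff_gradient t).differentiable (by norm_num)

theorem IsC21.continuous_fderiv_gradient (hψ : IsC21 ψ) :
    Continuous fun z : ℝ × Pos d => fderiv ℝ (gradient (ψ z.1)) z.2 := by
  let L : (Pos d →L[ℝ] ℝ) →L[ℝ] Pos d :=
    (InnerProductSpace.toDual ℝ (Pos d)).symm.toContinuousLinearEquiv.toContinuousLinearMap
  have h : ∀ z : ℝ × Pos d, fderiv ℝ (gradient (ψ z.1)) z.2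
      = L.comp (fderiv ℝ (fderiv ℝ (ψ z.1)) z.2) := by
    intro z
    ext1 v
    rw [fderiv_gradient ((hψ.space z.1).differentiable_fderiv z.2)]
    rfl
  simp only [h]
  exact continuous_const.clm_comp hψ.continuous_fderiv_fderiv

/-- The gradient of a classical solution is constant along the straight line on which it points.
Seen from the frame moving with the velocity `v` of the line, the potential satisfies
`∂_t u = ‖v‖² / 2 - ‖∂u - v‖² / 2`, so that `∂u - v` solves a linear equation along the line; it
vanishes at time `c`, and therefore always. -/
theorem IsHamiltonJacobi.gradient_line (hψ : IsHamiltonJacobi t₀ t₁ ψ) {c t : ℝ}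
    (hc : c ∈ Set.Icc t₀ t₁) (ht : t ∈ Set.Icc t₀ t₁) (q : Pos d) :
    gradient (ψ t) (q + (t - c) • gradient (ψ c) q) = gradient (ψ c) q := by
  set v := gradient (ψ c) q with hv
  have hψ1 := hψ.regular
  let z : ℝ → Pos d → Pos d := fun t y => y + (t - c) • v
  have hz : Continuous fun w : ℝ × Pos d => (w.1, z w.1 w.2) := by
    have : Continuous fun w : ℝ × Pos d => z w.1 w.2 := by fun_prop
    exact continuous_fst.prodMk this
  have hzd : ∀ t y, HasFDerivAt (z t) (ContinuousLinearMap.id ℝ (Pos d)) y := fun t y =>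
    (hasFDerivAt_id y).add_const _
  let u : ℝ → Pos d → ℝ := fun t y => ψ t (z t y)
  let g : ℝ → Pos d → ℝ := fun t y => ‖v‖ ^ 2 / 2 - ‖gradient (ψ t) (z t y) - v‖ ^ 2 / 2
  let ℓ : Pos d →L[ℝ] ℝ := innerSL ℝ v
  let Z : ℝ → Pos d → Pos d →L[ℝ] ℝ := fun t y => fderiv ℝ (ψ t) (z t y) - ℓ
  let D : ℝ → Pos d → Pos d →L[ℝ] Pos d := fun t y => fderiv ℝ (gradient (ψ t)) (z t y)
  have hu : ∀ t y, HasFDerivAt (u t) (fderiv ℝ (ψ t) (z t y)) y := fun t y =>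
    (hψ1.differentiable t (z t y)).hasFDerivAt.comp y (hzd t y)
  have hug : ∀ t ∈ Set.Icc t₀ t₁, ∀ y, HasDerivAt (fun s => u s y) (g t y) t := by
    intro t ht y
    have h1 : HasDerivAt (fun s => z s y) v t :=
      ((((hasDerivAt_id t).sub_const c).smul_const v).const_add y).congr_deriv (one_smul _ _)
    have h2 := hψ1.hasDerivAt_comp h1
    rw [hψ.eq t ht, ← inner_gradient_left] at h2
    convert! h2 using 1
    simp only [g]
    rw [norm_sub_sq_real]; ring
  have hg : ∀ t y, HasFDerivAt (g t) (-((Z t y).comp (D t y))) y := by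
    intro t y
    have h1 : HasFDerivAt (fun y => gradient (ψ t) (z t y) - v) (D t y) y :=
      ((hψ1.differentiable_gradient t (z t y)).hasFDerivAt.comp y (hzd t y)).sub_const v
    have h2 := (h1.norm_sq.mul_const 2⁻¹).const_sub (‖v‖ ^ 2 / 2)
    refine h2.congr_fderiv ?_
    ext w
    simp only [Z, D, ℓ, neg_apply, ContinuousLinearMap.comp_apply,
      sub_apply, innerSL_apply_apply, smul_apply]
    rw [inner_sub_left, inner_gradient_left]
    simp
  have hZc : Continuous fun w : ℝ × Pos d => Z w.1 w.2 :=
    (hψ1.continuous_fderiv.comp hz).sub continuous_const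
  have hDc : Continuous fun w : ℝ × Pos d => D w.1 w.2 := hψ1.continuous_fderiv_gradient.comp hz
  have hgc : Continuous fun w : ℝ × Pos d => g w.1 w.2 := by
    have := hψ1.continuous_gradient.comp hz
    exact continuous_const.sub (((this.sub continuous_const).norm.pow 2).div_const 2)
  have hgc' : Continuous fun w : ℝ × Pos d => -((Z w.1 w.2).comp (D w.1 w.2)) :=
    (hZc.clm_comp hDc).neg
  -- `R` is a globally differentiable function that agrees with `∂u - v` on the time interval
  let R : ℝ → Pos d →L[ℝ] ℝ := fun t => Z t₀ q + ∫ s in t₀..t, -((Z s q).comp (D s q))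
  have hRZ : ∀ t ∈ Set.Icc t₀ t₁, R t = Z t q := by
    intro t ht
    have := fderiv_eq_add_integral (fun t y => (hu t y).differentiableAt) hug hg hgc hgc' ht q
    rw [(hu t q).fderiv, (hu t₀ q).fderiv] at this
    simp only [R, Z, this]; abel
  have hpath : Continuous fun s : ℝ => (s, q) := continuous_id.prodMk continuous_const
  have hRd : ∀ t ∈ Set.Icc t₀ t₁, HasDerivAt R (-((R t).comp (D t q))) t := by
    intro t ht
    rw [hRZ t ht]
    exact (intervalIntegral.integral_hasDerivAt_right
      ((hgc'.comp hpath).intervalIntegrable _ _)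
      ((hgc'.comp hpath).stronglyMeasurableAtFilter _ _) (hgc'.comp hpath).continuousAt).const_add _
  obtain ⟨C, hC⟩ := (isCompact_Icc (a := t₀) (b := t₁)).exists_bound_of_continuousOn
    (hDc.comp hpath).continuousOn
  let F : ℝ → (Pos d →L[ℝ] ℝ) → (Pos d →L[ℝ] ℝ) := fun t m => -(m.comp (D t q))
  have hF : ∀ t ∈ Set.Icc t₀ t₁, LipschitzOnWith (Real.toNNReal C) (F t) Set.univ := by
    intro t ht
    refine LipschitzOnWith.of_dist_le_mul fun m _ m' _ => ?_
    rw [dist_eq_norm, dist_eq_norm]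
    have : F t m - F t m' = -((m - m').comp (D t q)) := by
      simp only [F]; rw [ContinuousLinearMap.sub_comp]; abel
    rw [this, norm_neg, mul_comm]
    refine (ContinuousLinearMap.opNorm_comp_le _ _).trans ?_
    exact mul_le_mul_of_nonneg_left ((hC t ht).trans (Real.le_coe_toNNReal C)) (norm_nonneg _)
  have hF0 : ∀ t, F t 0 = 0 := fun t => by simp [F]
  have hRc : R c = 0 := by
    rw [hRZ c hc]
    ext w
    simp [Z, ℓ, z, hv]
  have hRcont : ContinuousOn R (Set.Icc t₀ t₁) := fun s hs =>
    (hRd s hs).continuousAt.continuousWithinAt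
  have hR0 : R t = 0 := by
    rcases le_total t c with h | h
    · have hsub : Set.Icc t c ⊆ Set.Icc t₀ t₁ := Set.Icc_subset_Icc ht.1 hc.2
      refine ODE_solution_unique_of_mem_Icc_left (v := F) (K := Real.toNNReal C)
        (s := fun _ => Set.univ) (f := R) (g := fun _ => 0) (a := t) (b := c)
        (fun s hs => hF s (hsub (Set.Ioc_subset_Icc_self hs))) (hRcont.mono hsub)
        (fun s hs => (hRd s (hsub (Set.Ioc_subset_Icc_self hs))).hasDerivWithinAt)
        (fun _ _ => trivial) continuousOn_const (fun s _ => ?_) (fun _ _ => trivial) hRc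
        (Set.left_mem_Icc.2 h)
      simpa [hF0] using hasDerivWithinAt_const s _ (0 : Pos d →L[ℝ] ℝ)
    · have hsub : Set.Icc c t ⊆ Set.Icc t₀ t₁ := Set.Icc_subset_Icc hc.1 ht.2
      refine ODE_solution_unique_of_mem_Icc_right (v := F) (K := Real.toNNReal C)
        (s := fun _ => Set.univ) (f := R) (g := fun _ => 0) (a := c) (b := t)
        (fun s hs => hF s (hsub (Set.Ico_subset_Icc_self hs))) (hRcont.mono hsub)
        (fun s hs => (hRd s (hsub (Set.Ico_subset_Icc_self hs))).hasDerivWithinAt)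
        (fun _ _ => trivial) continuousOn_const (fun s _ => ?_) (fun _ _ => trivial) hRc
        (Set.right_mem_Icc.2 h)
      simpa [hF0] using hasDerivWithinAt_const s _ (0 : Pos d →L[ℝ] ℝ)
  rw [hRZ t ht] at hR0
  refine ext_inner_right ℝ fun w => ?_
  rw [inner_gradient_left]
  have := congrArg (fun L => L w) hR0
  simpa [Z, ℓ, z, sub_eq_zero] using this

/-- The characteristic flow: `q` is carried along a straight line with the velocity `∂ψ(t₀, q)`. -/
def characteristic (t₀ : ℝ) (ψ : ℝ → Pos d → ℝ) (t : ℝ) (q : Pos d) : Pos d :=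
  q + (t - t₀) • gradient (ψ t₀) q

theorem IsHamiltonJacobi.gradient_characteristic (hψ : IsHamiltonJacobi t₀ t₁ ψ) {t : ℝ}
    (ht : t ∈ Set.Icc t₀ t₁) (q : Pos d) :
    gradient (ψ t) (characteristic t₀ ψ t q) = gradient (ψ t₀) q :=
  hψ.gradient_line (Set.left_mem_Icc.2 (ht.1.trans ht.2)) ht q

theorem IsHamiltonJacobi.injective_characteristic (hψ : IsHamiltonJacobi t₀ t₁ ψ) {t : ℝ}
    (ht : t ∈ Set.Icc t₀ t₁) : Function.Injective (characteristic t₀ ψ t) := by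
  refine Function.LeftInverse.injective (g := fun y => y - (t - t₀) • gradient (ψ t) y) fun q => ?_
  simp only [hψ.gradient_characteristic ht q]
  simp [characteristic]

theorem IsHamiltonJacobi.surjective_characteristic (hψ : IsHamiltonJacobi t₀ t₁ ψ) {t : ℝ}
    (ht : t ∈ Set.Icc t₀ t₁) : Function.Surjective (characteristic t₀ ψ t) := by
  -- the inverse follows the line of the gradient at time `t` back to `t₀`
  refine Function.RightInverse.surjective (g := fun y => y + (t₀ - t) • gradient (ψ t) y)
    fun q => ?_
  have h := hψ.gradient_line ht (Set.left_mem_Icc.2 (ht.1.trans ht.2)) q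
  simp only [characteristic, h]
  module

theorem IsC21.hasFDerivAt_characteristic (hψ : IsC21 ψ) (t : ℝ) (q : Pos d) :
    HasFDerivAt (characteristic t₀ ψ t)
      (ContinuousLinearMap.id ℝ (Pos d) + (t - t₀) • fderiv ℝ (gradient (ψ t₀)) q) q :=
  (hasFDerivAt_id q).add ((hψ.differentiable_gradient t₀ q).hasFDerivAt.fun_const_smul _)

theorem hasDerivAt_det_one_add_smul {n : ℕ} (A : Matrix (Fin n) (Fin n) ℝ) :
    HasDerivAt (fun h : ℝ => (1 + h • A).det) A.trace 0 := by
  rw [funext fun h : ℝ => Matrix.det_one_add_smul h A]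
  have h1 : HasDerivAt (fun h : ℝ => 1 + A.trace * h) A.trace 0 := by
    simpa using ((hasDerivAt_id (0 : ℝ)).const_mul A.trace).const_add 1
  have h2 := ((Polynomial.hasDerivAt (Matrix.det (1 + (Polynomial.X : Polynomial ℝ) •
    A.map Polynomial.C)).divX.divX (0 : ℝ))).mul (hasDerivAt_pow 2 (0 : ℝ))
  exact (h1.add h2).congr_deriv (by simp)

theorem det_id_add_smul (D : Pos d →L[ℝ] Pos d) (h : ℝ) :
    (ContinuousLinearMap.id ℝ (Pos d) + h • D).det
      = (1 + h • LinearMap.toMatrix (EuclideanSpace.basisFun (Fin d) ℝ).toBasis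
        (EuclideanSpace.basisFun (Fin d) ℝ).toBasis (D : Pos d →ₗ[ℝ] Pos d)).det := by
  rw [ContinuousLinearMap.det, ← LinearMap.det_toMatrix (EuclideanSpace.basisFun (Fin d) ℝ).toBasis]
  congr 1
  rw [ContinuousLinearMap.toLinearMap_add, ContinuousLinearMap.toLinearMap_smul, map_add, map_smul,
    ContinuousLinearMap.coe_id, LinearMap.toMatrix_id]

/-- The trace of the Hessian, as an endomorphism, is the Laplacian. -/
theorem trace_fderiv_gradient {f : Pos d → ℝ} {x : Pos d} (hf : DifferentiableAt ℝ (fderiv ℝ f) x) :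
    (LinearMap.toMatrix (EuclideanSpace.basisFun (Fin d) ℝ).toBasis
        (EuclideanSpace.basisFun (Fin d) ℝ).toBasis
        (fderiv ℝ (gradient f) x : Pos d →ₗ[ℝ] Pos d)).trace = Laplacian.laplacian f x := by
  rw [← divergence_gradient hf, divergence, Matrix.trace]
  refine Finset.sum_congr rfl fun i _ => ?_
  simp [LinearMap.toMatrix_apply]

/-- A density transported by a potential flow: `∂_t ρ + ∂ · (ρ ∂ψ) = 0` on `[t₀, t₁]`. -/
def IsTransported (t₀ t₁ : ℝ) (ψ ρ : ℝ → Pos d → ℝ) : Prop :=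
  ∀ t ∈ Set.Icc t₀ t₁, ∀ x,
    dt ρ t x = -(fderiv ℝ (ρ t) x (gradient (ψ t) x) + ρ t x * Laplacian.laplacian (ψ t) x)

/-- Liouville's formula: the density times the Jacobian is constant along characteristics. The
Hessian `D` of the potential at time `t` and the derivative `M` of the flow satisfy `D M = B`, with
`B` the initial Hessian, so that `∂_t det M = tr D det M`. -/
theorem IsHamiltonJacobi.density_mul_det (hψ : IsHamiltonJacobi t₀ t₁ ψ) (hρ : IsC21 ρ)
    (hρψ : IsTransported t₀ t₁ ψ ρ) {t : ℝ} (ht : t ∈ Set.Icc t₀ t₁) (q : Pos d) :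
    ρ t (characteristic t₀ ψ t q)
      * (ContinuousLinearMap.id ℝ (Pos d) + (t - t₀) • fderiv ℝ (gradient (ψ t₀)) q).det
      = ρ t₀ q := by
  set B := fderiv ℝ (gradient (ψ t₀)) q with hB
  let M : ℝ → Pos d →L[ℝ] Pos d := fun t => ContinuousLinearMap.id ℝ (Pos d) + (t - t₀) • B
  let D : ℝ → Pos d →L[ℝ] Pos d := fun t => fderiv ℝ (gradient (ψ t)) (characteristic t₀ ψ t q)
  have hDM : ∀ t ∈ Set.Icc t₀ t₁, (D t).comp (M t) = B := by
    intro t ht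
    have h1 := ((hψ.regular.differentiable_gradient t (characteristic t₀ ψ t q)).hasFDerivAt.comp q
      (hψ.regular.hasFDerivAt_characteristic (t₀ := t₀) t q)).fderiv
    rw [← h1, hB]
    congr 1
    exact funext fun y => hψ.gradient_characteristic ht y
  have hdet : ∀ t ∈ Set.Icc t₀ t₁, HasDerivAt (fun s => (M s).det)
      (Laplacian.laplacian (ψ t) (characteristic t₀ ψ t q) * (M t).det) t := by
    intro t ht
    have h1 : ∀ s, M s = (ContinuousLinearMap.id ℝ (Pos d) + (s - t) • D t).comp (M t) := by
      intro s
      rw [ContinuousLinearMap.add_comp, ContinuousLinearMap.smul_comp, hDM t ht,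
        ContinuousLinearMap.id_comp]
      simp only [M]; module
    have h2 : ∀ s, (M s).det
        = (ContinuousLinearMap.id ℝ (Pos d) + (s - t) • D t).det * (M t).det := by
      intro s
      conv_lhs => rw [h1 s]
      exact LinearMap.det_comp _ _
    have h3 : HasDerivAt (fun s => s - t) 1 t := (hasDerivAt_id t).sub_const t
    have h4 := hasDerivAt_det_one_add_smul
      (LinearMap.toMatrix (EuclideanSpace.basisFun (Fin d) ℝ).toBasis
        (EuclideanSpace.basisFun (Fin d) ℝ).toBasis (D t : Pos d →ₗ[ℝ] Pos d))
    rw [trace_fderiv_gradient ((hψ.regular.space t).differentiable_fderiv _)] at h4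
    have h5 := (HasDerivAt.comp (h := fun s => s - t) t (by simpa using h4) h3).mul_const (M t).det
    rw [mul_one] at h5
    refine h5.congr_of_eventuallyEq (Eventually.of_forall fun s => ?_)
    simp only [h2 s, det_id_add_smul, Function.comp]
  have hγ : ∀ t, HasDerivAt (fun s => characteristic t₀ ψ s q) (gradient (ψ t₀) q) t := fun t =>
    ((((hasDerivAt_id t).sub_const t₀).smul_const (gradient (ψ t₀) q)).const_add q).congr_deriv
      (one_smul _ _)
  have hder : ∀ t ∈ Set.Icc t₀ t₁,
      HasDerivAt (fun s => ρ s (characteristic t₀ ψ s q) * (M s).det) 0 t := by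
    intro t ht
    refine ((hρ.hasDerivAt_comp (hγ t)).mul (hdet t ht)).congr_deriv ?_
    rw [hρψ t ht, hψ.gradient_characteristic ht q]
    ring
  have hconst := constant_of_has_deriv_right_zero
    (fun s hs => (hder s hs).continuousAt.continuousWithinAt)
    (fun s hs => (hder s (Set.Ico_subset_Icc_self hs)).hasDerivWithinAt) t ht
  refine hconst.trans ?_
  have hM0 : M t₀ = ContinuousLinearMap.id ℝ (Pos d) := by
    refine ContinuousLinearMap.ext fun w => ?_
    change w + (t₀ - t₀) • B w = w
    rw [sub_self, zero_smul, add_zero]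
  simp only [hM0]
  simp [characteristic, ContinuousLinearMap.det]

/-- Change of variables along the characteristic flow; its Jacobian is positive because it is a
quotient of densities. -/
theorem IsHamiltonJacobi.lintegral_comp_characteristic (hψ : IsHamiltonJacobi t₀ t₁ ψ)
    (hρ : IsC21 ρ) (hρψ : IsTransported t₀ t₁ ψ ρ) {t : ℝ} (ht : t ∈ Set.Icc t₀ t₁)
    (hpos : ∀ x, 0 < ρ t x) (hpos₀ : ∀ x, 0 < ρ t₀ x) (F : Pos d → ℝ≥0∞) :
    ∫⁻ x, ENNReal.ofReal (ρ t x) * F x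
      = ∫⁻ q, ENNReal.ofReal (ρ t₀ q) * F (characteristic t₀ ψ t q) := by
  have h := lintegral_image_eq_lintegral_abs_det_fderiv_mul volume MeasurableSet.univ
    (fun q _ => (hψ.regular.hasFDerivAt_characteristic (t₀ := t₀) t q).hasFDerivWithinAt)
    (hψ.injective_characteristic ht).injOn (fun x => ENNReal.ofReal (ρ t x) * F x)
  rw [Set.image_univ, (hψ.surjective_characteristic ht).range_eq, setLIntegral_univ,
    setLIntegral_univ] at h
  rw [h]
  refine lintegral_congr fun q => ?_
  have h1 := hψ.density_mul_det hρ hρψ ht q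
  have hdet : 0 < (ContinuousLinearMap.id ℝ (Pos d)
      + (t - t₀) • fderiv ℝ (gradient (ψ t₀)) q).det := by
    by_contra hneg
    have := mul_nonpos_of_nonneg_of_nonpos (hpos (characteristic t₀ ψ t q)).le (not_lt.1 hneg)
    linarith [hpos₀ q]
  rw [abs_of_pos hdet, ← mul_assoc, ← ENNReal.ofReal_mul hdet.le, mul_comm _ (ρ t _), h1]

theorem IsHamiltonJacobi.continuous_characteristic (hψ : IsHamiltonJacobi t₀ t₁ ψ) (t : ℝ) :
    Continuous (characteristic t₀ ψ t) :=
  continuous_iff_continuousAt.2 fun q =>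
    (hψ.regular.hasFDerivAt_characteristic (t₀ := t₀) t q).continuousAt

/-- The characteristic flow pushes the initial density forward to the density at time `t`. -/
theorem IsHamiltonJacobi.map_characteristic (hψ : IsHamiltonJacobi t₀ t₁ ψ)
    (hρ : IsC21 ρ) (hρψ : IsTransported t₀ t₁ ψ ρ) {t : ℝ} (ht : t ∈ Set.Icc t₀ t₁)
    (hpos : ∀ x, 0 < ρ t x) (hpos₀ : ∀ x, 0 < ρ t₀ x) :
    (densityMeasure (ρ t₀)).map (characteristic t₀ ψ t) = densityMeasure (ρ t) := by
  ext s hs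
  have hm := (hψ.continuous_characteristic t).measurable
  have h := hψ.lintegral_comp_characteristic hρ hρψ ht hpos hpos₀ (s.indicator 1)
  rw [Measure.map_apply hm hs, densityMeasure, densityMeasure, withDensity_apply _ hs,
    withDensity_apply _ (hm hs), ← lintegral_indicator hs, ← lintegral_indicator (hm hs)]
  refine Eq.trans (lintegral_congr fun q => ?_) (h.symm.trans (lintegral_congr fun q => ?_))
  · by_cases hq : characteristic t₀ ψ t q ∈ s
    · rw [Set.indicator_of_mem (by exact hq), Set.indicator_of_mem hq, Pi.one_apply, mul_one]
    · rw [Set.indicator_of_notMem (by exact hq), Set.indicator_of_notMem hq, mul_zero]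
  · by_cases hq : q ∈ s
    · rw [Set.indicator_of_mem hq, Set.indicator_of_mem hq, Pi.one_apply, mul_one]
    · rw [Set.indicator_of_notMem hq, Set.indicator_of_notMem hq, mul_zero]

end HamiltonJacobi

/-! ### Optimality of the characteristic flow -/

section Kantorovich

variable {d : ℕ}

theorem integrable_of_le_of_le {α : Type*} [MeasurableSpace α] {μ : Measure α} {f g h : α → ℝ}
    (hf : AEStronglyMeasurable f μ) (hg : Integrable g μ) (hh : Integrable h μ)
    (hgf : ∀ x, g x ≤ f x) (hfh : ∀ x, f x ≤ h x) : Integrable f μ :=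
  (hg.norm.add hh.norm).mono' hf (Eventually.of_forall fun x => by
    have h1 := neg_abs_le (g x)
    have h2 := le_abs_self (h x)
    simp only [Pi.add_apply, Real.norm_eq_abs]
    exact abs_le.2 ⟨by linarith [hgf x, abs_nonneg (h x)], by linarith [hfh x, abs_nonneg (g x)]⟩)

theorem integrable_inner_of_sq {α : Type*} [MeasurableSpace α] {μ : Measure α} {f g : α → Pos d}
    (hf : AEStronglyMeasurable f μ) (hg : AEStronglyMeasurable g μ)
    (hf2 : Integrable (fun x => ‖f x‖ ^ 2) μ) (hg2 : Integrable (fun x => ‖g x‖ ^ 2) μ) :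
    Integrable (fun x => inner ℝ (f x) (g x)) μ :=
  (hf2.add hg2).mono' (hf.inner hg) (Eventually.of_forall fun x => by
    have := abs_real_inner_le_norm (f x) (g x)
    simp only [Pi.add_apply, Real.norm_eq_abs]
    nlinarith [sq_nonneg (‖f x‖ - ‖g x‖), sq_nonneg (‖f x‖), sq_nonneg (‖g x‖)])

/-- Two potentials with `⟪x, y⟫ ≤ φ x + φ' y`, with equality on the graph of `T`, are integrable
for `μ` and its image under `T`: each has an affine minorant, and their sum is integrable. -/
theorem integrable_potentials {μ : Measure (Pos d)} [IsProbabilityMeasure μ] {T : Pos d → Pos d}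
    (hT : Continuous T) {φ φ' : Pos d → ℝ} (hφ : Continuous φ) (hφ' : Continuous φ')
    (hle : ∀ x y, inner ℝ x y ≤ φ x + φ' y) (heq : ∀ x, φ x + φ' (T x) = inner ℝ x (T x))
    (hμ : Integrable (fun x => ‖x‖ ^ 2) μ) (hν : Integrable (fun x => ‖T x‖ ^ 2) μ) :
    Integrable φ μ ∧ Integrable (fun x => φ' (T x)) μ := by
  have hid : AEStronglyMeasurable (fun x : Pos d => x) μ := continuous_id.aestronglyMeasurable
  have hTm : AEStronglyMeasurable T μ := hT.aestronglyMeasurable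
  have i1 : Integrable (fun x => inner ℝ x (T x)) μ := integrable_inner_of_sq hid hTm hμ hν
  have i2 : Integrable (fun x => inner ℝ x (T 0) - φ' (T 0)) μ :=
    (integrable_inner_of_sq hid (g := fun _ => T 0) aestronglyMeasurable_const hμ
      (integrable_const _)).sub (integrable_const _)
  have i3 : Integrable (fun x => inner ℝ (0 : Pos d) (T x) - φ 0) μ :=
    (integrable_inner_of_sq (f := fun _ => (0 : Pos d)) aestronglyMeasurable_const hTm
      (by simp) hν).sub (integrable_const _)
  constructor
  · refine integrable_of_le_of_le hφ.aestronglyMeasurable i2 (i1.sub i3) (fun x => ?_) fun x => ?_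
    · linarith [hle x (T 0)]
    · simp only [Pi.sub_apply]; linarith [hle 0 (T x), heq x]
  · refine integrable_of_le_of_le (hφ'.comp hT).aestronglyMeasurable i3 (i1.sub i2) (fun x => ?_)
      fun x => ?_
    · linarith [hle 0 (T x)]
    · simp only [Pi.sub_apply]; linarith [hle x (T 0), heq x]

end Kantorovich

section OptimalTransport

variable {d : ℕ} {t₀ t₁ : ℝ} {ψ ρ : ℝ → Pos d → ℝ}

theorem IsHamiltonJacobi.hasDerivAt_line (hψ : IsHamiltonJacobi t₀ t₁ ψ) (x w : Pos d) {t : ℝ}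
    (ht : t ∈ Set.Icc t₀ t₁) :
    HasDerivAt (fun s => ψ s (x + (s - t₀) • w))
      (-(‖gradient (ψ t) (x + (t - t₀) • w)‖ ^ 2 / 2)
        + inner ℝ (gradient (ψ t) (x + (t - t₀) • w)) w) t := by
  have h1 : HasDerivAt (fun s => x + (s - t₀) • w) w t :=
    ((((hasDerivAt_id t).sub_const t₀).smul_const w).const_add x).congr_deriv (one_smul _ _)
  have h2 := hψ.regular.hasDerivAt_comp h1
  rwa [hψ.eq t ht, ← inner_gradient_left] at h2

/-- The dual constraint: potentials at the two end points differ by at most the quadratic cost. -/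
theorem IsHamiltonJacobi.sub_le (hψ : IsHamiltonJacobi t₀ t₁ ψ) (h : t₀ < t₁) (x y : Pos d) :
    ψ t₁ y - ψ t₀ x ≤ ‖y - x‖ ^ 2 / (2 * (t₁ - t₀)) := by
  have h0 : 0 < t₁ - t₀ := sub_pos.2 h
  set w := (t₁ - t₀)⁻¹ • (y - x) with hw
  have hend : x + (t₁ - t₀) • w = y := by
    rw [hw, smul_smul, mul_inv_cancel₀ h0.ne', one_smul]; abel
  have key := (convex_Icc t₀ t₁).image_sub_le_mul_sub_of_deriv_le
    (fun s hs => (hψ.hasDerivAt_line x w hs).continuousAt.continuousWithinAt)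
    (fun s hs => (hψ.hasDerivAt_line x w
      (interior_subset hs)).differentiableAt.differentiableWithinAt) (C := ‖w‖ ^ 2 / 2)
    (fun s hs => by
      rw [(hψ.hasDerivAt_line x w (interior_subset hs)).deriv]
      nlinarith [norm_sub_sq_real (gradient (ψ s) (x + (s - t₀) • w)) w,
        sq_nonneg ‖gradient (ψ s) (x + (s - t₀) • w) - w‖])
    t₀ (Set.left_mem_Icc.2 h.le) t₁ (Set.right_mem_Icc.2 h.le) h.le
  simp only [hend, sub_self, zero_smul, add_zero] at key
  refine key.trans_eq ?_
  rw [hw, norm_smul, Real.norm_eq_abs, abs_of_pos (inv_pos.2 h0)]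
  field_simp

/-- The dual constraint is saturated along characteristics. -/
theorem IsHamiltonJacobi.sub_eq (hψ : IsHamiltonJacobi t₀ t₁ ψ) (h : t₀ < t₁) (q : Pos d) :
    ψ t₁ (characteristic t₀ ψ t₁ q) - ψ t₀ q = (t₁ - t₀) / 2 * ‖gradient (ψ t₀) q‖ ^ 2 := by
  set v := gradient (ψ t₀) q with hv
  have hd : ∀ s ∈ Set.Icc t₀ t₁, HasDerivAt
      (fun s => ψ s (q + (s - t₀) • v) - (s - t₀) / 2 * ‖v‖ ^ 2) 0 s := by
    intro s hs
    have h1 := hψ.hasDerivAt_line q v hs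
    have h2 := hψ.gradient_characteristic hs q
    rw [characteristic, ← hv] at h2
    rw [h2, real_inner_self_eq_norm_sq] at h1
    have h3 := (((hasDerivAt_id s).sub_const t₀).div_const 2).mul_const (‖v‖ ^ 2)
    refine (h1.sub h3).congr_deriv ?_
    ring
  have key := constant_of_has_deriv_right_zero
    (fun s hs => (hd s hs).continuousAt.continuousWithinAt)
    (fun s hs => (hd s (Set.Ico_subset_Icc_self hs)).hasDerivWithinAt) t₁ (Set.right_mem_Icc.2 h.le)
  simp only [sub_self, zero_smul, add_zero, zero_div, zero_mul, sub_zero] at key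
  simp only [characteristic, ← hv]
  linarith

/-- The dual constraint in terms of Brenier potentials. -/
theorem IsHamiltonJacobi.inner_le (hψ : IsHamiltonJacobi t₀ t₁ ψ) (h : t₀ < t₁) (x y : Pos d) :
    inner ℝ x y ≤ (‖x‖ ^ 2 / 2 + (t₁ - t₀) * ψ t₀ x) + (‖y‖ ^ 2 / 2 - (t₁ - t₀) * ψ t₁ y) := by
  have h0 : 0 < t₁ - t₀ := sub_pos.2 h
  have h1 := hψ.sub_le h x y
  rw [le_div_iff₀ (by positivity), norm_sub_sq_real, real_inner_comm] at h1
  linarith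

theorem IsHamiltonJacobi.inner_eq (hψ : IsHamiltonJacobi t₀ t₁ ψ) (h : t₀ < t₁) (x : Pos d) :
    (‖x‖ ^ 2 / 2 + (t₁ - t₀) * ψ t₀ x) + (‖characteristic t₀ ψ t₁ x‖ ^ 2 / 2
      - (t₁ - t₀) * ψ t₁ (characteristic t₀ ψ t₁ x)) = inner ℝ x (characteristic t₀ ψ t₁ x) := by
  have h1 := hψ.sub_eq h x
  have h2 : ψ t₁ (characteristic t₀ ψ t₁ x)
      = ψ t₀ x + (t₁ - t₀) / 2 * ‖gradient (ψ t₀) x‖ ^ 2 := by linarith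
  rw [h2, characteristic, norm_add_sq_real, inner_add_right, real_inner_self_eq_norm_sq,
    inner_smul_right, norm_smul, mul_pow, Real.norm_eq_abs, sq_abs]
  ring

/-- The Brenier potential is convex: it has a subgradient at every point. -/
theorem IsHamiltonJacobi.convexOn (hψ : IsHamiltonJacobi t₀ t₁ ψ) (h : t₀ < t₁) :
    ConvexOn ℝ Set.univ fun x => ‖x‖ ^ 2 / 2 + (t₁ - t₀) * ψ t₀ x := by
  refine ⟨convex_univ, fun x _ y _ a b ha hb hab => ?_⟩
  set z := a • x + b • y with hz
  set T := characteristic t₀ ψ t₁ z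
  have h1 := hψ.inner_le h x T
  have h2 := hψ.inner_le h y T
  have h3 := hψ.inner_eq h z
  have h4 : inner ℝ z T = a * inner ℝ x T + b * inner ℝ y T := by
    rw [hz, inner_add_left, inner_smul_left, inner_smul_left]; simp
  have h5 := mul_le_mul_of_nonneg_left h1 ha
  have h6 := mul_le_mul_of_nonneg_left h2 hb
  obtain rfl : b = 1 - a := by linarith
  simp only [smul_eq_mul]
  nlinarith

theorem measurable_density {ρ : Pos d → ℝ} (hρ : Continuous ρ) :
    Measurable fun q => ENNReal.ofReal (ρ q) := hρ.measurable.ennreal_ofReal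

theorem isProbabilityMeasure_densityMeasure {ρ : Pos d → ℝ} (hpos : ∀ x, 0 < ρ x)
    (hmass : ∫ x, ρ x = 1) : IsProbabilityMeasure (densityMeasure ρ) := by
  have hint : Integrable ρ := by
    by_contra h
    rw [integral_undef h] at hmass
    exact zero_ne_one hmass
  refine ⟨?_⟩
  rw [densityMeasure, withDensity_apply _ MeasurableSet.univ, setLIntegral_univ,
    ← ofReal_integral_eq_lintegral_ofReal hint (Eventually.of_forall fun x => (hpos x).le), hmass,
    ENNReal.ofReal_one]

theorem integrable_densityMeasure_iff {ρ : Pos d → ℝ} (hρ : Continuous ρ) (hpos : ∀ x, 0 < ρ x)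
    {g : Pos d → ℝ} :
    Integrable g (densityMeasure ρ) ↔ Integrable fun x => g x * ρ x := by
  rw [densityMeasure, integrable_withDensity_iff (measurable_density hρ)
    (Eventually.of_forall fun x => ENNReal.ofReal_lt_top)]
  simp only [ENNReal.toReal_ofReal (hpos _).le]

theorem integral_densityMeasure {ρ : Pos d → ℝ} (hρ : Continuous ρ) (hpos : ∀ x, 0 < ρ x)
    (g : Pos d → ℝ) : ∫ x, g x ∂(densityMeasure ρ) = ∫ x, g x * ρ x := by
  rw [densityMeasure, integral_withDensity_eq_integral_toReal_smul (measurable_density hρ)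
    (Eventually.of_forall fun x => ENNReal.ofReal_lt_top)]
  simp only [ENNReal.toReal_ofReal (hpos _).le, smul_eq_mul, mul_comm]

/-- A classical solution of the Hamilton-Jacobi equation together with a positive density that it
transports between states of finite second moment. -/
structure IsPotentialFlow (t₀ t₁ : ℝ) (ψ ρ : ℝ → Pos d → ℝ) : Prop where
  lt : t₀ < t₁
  potential : IsHamiltonJacobi t₀ t₁ ψ
  density_regular : IsC21 ρ
  transported : IsTransported t₀ t₁ ψ ρ
  pos : ∀ t ∈ Set.Icc t₀ t₁, ∀ x, 0 < ρ t x
  mass : ∫ x, ρ t₀ x = 1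
  moment_initial : Integrable fun x => ‖x‖ ^ 2 * ρ t₀ x
  moment_final : Integrable fun x => ‖x‖ ^ 2 * ρ t₁ x

namespace IsPotentialFlow

variable (hf : IsPotentialFlow t₀ t₁ ψ ρ)
include hf

theorem left_mem : t₀ ∈ Set.Icc t₀ t₁ := Set.left_mem_Icc.2 hf.lt.le

theorem right_mem : t₁ ∈ Set.Icc t₀ t₁ := Set.right_mem_Icc.2 hf.lt.le

theorem continuous_density (t : ℝ) : Continuous (ρ t) :=
  hf.density_regular.continuous.comp (continuous_const.prodMk continuous_id)

theorem continuous_potential (t : ℝ) : Continuous (ψ t) :=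
  hf.potential.regular.continuous.comp (continuous_const.prodMk continuous_id)

theorem isProbabilityMeasure : IsProbabilityMeasure (densityMeasure (ρ t₀)) :=
  isProbabilityMeasure_densityMeasure (hf.pos _ hf.left_mem) hf.mass

theorem map_characteristic {t : ℝ} (ht : t ∈ Set.Icc t₀ t₁) :
    (densityMeasure (ρ t₀)).map (characteristic t₀ ψ t) = densityMeasure (ρ t) :=
  hf.potential.map_characteristic hf.density_regular hf.transported ht (hf.pos t ht)
    (hf.pos _ hf.left_mem)

theorem mass_eq {t : ℝ} (ht : t ∈ Set.Icc t₀ t₁) : ∫ x, ρ t x = 1 := by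
  have := hf.isProbabilityMeasure
  have h1 := Measure.isProbabilityMeasure_map (μ := densityMeasure (ρ t₀))
    (hf.potential.continuous_characteristic t).measurable.aemeasurable
  rw [hf.map_characteristic ht] at h1
  have h2 := integral_densityMeasure (hf.continuous_density t) (hf.pos t ht) (fun _ => 1)
  simpa using h2.symm

theorem integrable_sq_norm : Integrable (fun x => ‖x‖ ^ 2) (densityMeasure (ρ t₀)) :=
  (integrable_densityMeasure_iff (hf.continuous_density _) (hf.pos _ hf.left_mem)).2
    hf.moment_initial

theorem integrable_sq_norm_final : Integrable (fun x => ‖x‖ ^ 2) (densityMeasure (ρ t₁)) :=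
  (integrable_densityMeasure_iff (hf.continuous_density _) (hf.pos _ hf.right_mem)).2
    hf.moment_final

theorem integrable_comp_characteristic {g : Pos d → ℝ} (hg : Continuous g) :
    Integrable (fun x => g (characteristic t₀ ψ t₁ x)) (densityMeasure (ρ t₀))
      ↔ Integrable g (densityMeasure (ρ t₁)) := by
  rw [← hf.map_characteristic hf.right_mem, integrable_map_measure hg.aestronglyMeasurable
    (hf.potential.continuous_characteristic _).measurable.aemeasurable]
  rfl

theorem integrable_potential : Integrable (ψ t₀) (densityMeasure (ρ t₀)) ∧
    Integrable (ψ t₁) (densityMeasure (ρ t₁)) := by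
  have hp := hf.isProbabilityMeasure
  have h0 : t₁ - t₀ ≠ 0 := (sub_pos.2 hf.lt).ne'
  have hcn : Continuous fun x : Pos d => ‖x‖ ^ 2 := continuous_norm.pow 2
  obtain ⟨h1, h2⟩ := integrable_potentials (μ := densityMeasure (ρ t₀))
    (hf.potential.continuous_characteristic t₁)
    (φ := fun x => ‖x‖ ^ 2 / 2 + (t₁ - t₀) * ψ t₀ x)
    (φ' := fun y => ‖y‖ ^ 2 / 2 - (t₁ - t₀) * ψ t₁ y)
    ((hcn.div_const 2).add (continuous_const.mul (hf.continuous_potential _)))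
    ((hcn.div_const 2).sub (continuous_const.mul (hf.continuous_potential _)))
    (hf.potential.inner_le hf.lt) (hf.potential.inner_eq hf.lt) hf.integrable_sq_norm
    ((hf.integrable_comp_characteristic hcn).2 hf.integrable_sq_norm_final)
  rw [hf.integrable_comp_characteristic (g := fun y => ‖y‖ ^ 2 / 2 - (t₁ - t₀) * ψ t₁ y)
    ((hcn.div_const 2).sub (continuous_const.mul (hf.continuous_potential _)))] at h2
  constructor
  · refine ((h1.sub (hf.integrable_sq_norm.div_const 2)).const_mul (t₁ - t₀)⁻¹).congr
      (Eventually.of_forall fun x => ?_)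
    simp only [Pi.sub_apply]; field_simp; ring
  · refine (((hf.integrable_sq_norm_final.div_const 2).sub h2).const_mul (t₁ - t₀)⁻¹).congr
      (Eventually.of_forall fun x => ?_)
    simp only [Pi.sub_apply]; field_simp; ring

theorem integrable_sq_gradient :
    Integrable (fun q => ‖gradient (ψ t₀) q‖ ^ 2) (densityMeasure (ρ t₀)) := by
  have h0 : t₁ - t₀ ≠ 0 := (sub_pos.2 hf.lt).ne'
  refine ((((hf.integrable_comp_characteristic (hf.continuous_potential t₁)).2
    hf.integrable_potential.2).sub hf.integrable_potential.1).const_mul (2 / (t₁ - t₀))).congr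
    (Eventually.of_forall fun q => ?_)
  simp only [Pi.sub_apply]
  rw [hf.potential.sub_eq hf.lt q]
  field_simp

/-- The dual value of the potentials is the kinetic action of the flow. -/
theorem integral_potential_sub :
    ∫ x, ψ t₁ x ∂(densityMeasure (ρ t₁)) - ∫ x, ψ t₀ x ∂(densityMeasure (ρ t₀))
      = (t₁ - t₀) / 2 * ∫ q, ‖gradient (ψ t₀) q‖ ^ 2 ∂(densityMeasure (ρ t₀)) := by
  have h1 : ∫ x, ψ t₁ x ∂(densityMeasure (ρ t₁))
      = ∫ q, ψ t₁ (characteristic t₀ ψ t₁ q) ∂(densityMeasure (ρ t₀)) := by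
    rw [← hf.map_characteristic hf.right_mem, integral_map
      (hf.potential.continuous_characteristic _).measurable.aemeasurable
      (hf.continuous_potential _).aestronglyMeasurable]
  rw [h1, ← integral_sub ((hf.integrable_comp_characteristic (hf.continuous_potential t₁)).2
    hf.integrable_potential.2) hf.integrable_potential.1, ← integral_const_mul]
  simp only [hf.potential.sub_eq hf.lt]

/-- The displacement of the flow realizes the Monge-Kantorovich cost. -/
theorem transportCost_eq :
    transportCost (densityMeasure (ρ t₀)) (densityMeasure (ρ t₁))
      = ENNReal.ofReal ((t₁ - t₀) ^ 2 * ∫ q, ‖gradient (ψ t₀) q‖ ^ 2 ∂(densityMeasure (ρ t₀))) := by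
  have hp := hf.isProbabilityMeasure
  have h0 : 0 < t₁ - t₀ := sub_pos.2 hf.lt
  have hT := hf.potential.continuous_characteristic t₁
  refine le_antisymm ?_ ?_
  · refine (iInf₂_le ((densityMeasure (ρ t₀)).map fun q => (q, characteristic t₀ ψ t₁ q))
      ⟨?fst, ?snd⟩).trans_eq ?cost
    case fst => rw [Measure.map_map measurable_fst (by fun_prop)]; exact Measure.map_id
    case snd =>
      rw [Measure.map_map measurable_snd (by fun_prop)]; exact hf.map_characteristic hf.right_mem
    case cost =>
      rw [lintegral_map (by fun_prop) (by fun_prop), ← integral_const_mul,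
        ofReal_integral_eq_lintegral_ofReal (hf.integrable_sq_gradient.const_mul _)
          (Eventually.of_forall fun q => by positivity)]
      refine lintegral_congr fun q => ?_
      simp only [characteristic]
      rw [← norm_neg, show -(q - (q + (t₁ - t₀) • gradient (ψ t₀) q))
        = (t₁ - t₀) • gradient (ψ t₀) q by abel, norm_smul, mul_pow, Real.norm_eq_abs, sq_abs]
  · refine le_iInf₂ fun π hπ => ?_
    have hπp : IsProbabilityMeasure π := by
      refine ⟨?_⟩
      have := hp.measure_univ
      rwa [← hπ.1, Measure.map_apply measurable_fst MeasurableSet.univ] at this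
    have i1 : ∀ {g : Pos d → ℝ}, Continuous g → Integrable g (densityMeasure (ρ t₀)) →
        Integrable (fun z : Pos d × Pos d => g z.1) π := fun hg h => by
      rw [← hπ.1] at h
      exact (integrable_map_measure hg.aestronglyMeasurable measurable_fst.aemeasurable).1 h
    have i2 : ∀ {g : Pos d → ℝ}, Continuous g → Integrable g (densityMeasure (ρ t₁)) →
        Integrable (fun z : Pos d × Pos d => g z.2) π := fun hg h => by
      rw [← hπ.2] at h
      exact (integrable_map_measure hg.aestronglyMeasurable measurable_snd.aemeasurable).1 h
    have hcn : Continuous fun x : Pos d => ‖x‖ ^ 2 := continuous_norm.pow 2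
    have j1 := i1 hcn hf.integrable_sq_norm
    have j2 := i2 hcn hf.integrable_sq_norm_final
    have j3 : Integrable (fun z : Pos d × Pos d => ‖z.1 - z.2‖ ^ 2) π := by
      refine ((j1.const_mul 2).add (j2.const_mul 2)).mono'
        (by fun_prop) (Eventually.of_forall fun z => ?_)
      simp only [Pi.add_apply, Real.norm_eq_abs, abs_pow, abs_norm]
      have h1 := norm_sub_le z.1 z.2
      have h2 := norm_nonneg (z.1 - z.2)
      nlinarith [sq_nonneg (‖z.1‖ - ‖z.2‖)]
    have k1 := i1 (hf.continuous_potential t₀) hf.integrable_potential.1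
    have k2 := i2 (hf.continuous_potential t₁) hf.integrable_potential.2
    rw [← ofReal_integral_eq_lintegral_ofReal j3 (Eventually.of_forall fun z => by positivity)]
    refine ENNReal.ofReal_le_ofReal ?_
    calc (t₁ - t₀) ^ 2 * ∫ q, ‖gradient (ψ t₀) q‖ ^ 2 ∂(densityMeasure (ρ t₀))
        = 2 * (t₁ - t₀) * (∫ x, ψ t₁ x ∂(densityMeasure (ρ t₁))
            - ∫ x, ψ t₀ x ∂(densityMeasure (ρ t₀))) := by rw [hf.integral_potential_sub]; ring
      _ = ∫ z, 2 * (t₁ - t₀) * (ψ t₁ z.2 - ψ t₀ z.1) ∂π := by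
          rw [integral_const_mul, integral_sub k2 k1, ← hπ.1, ← hπ.2,
            integral_map measurable_fst.aemeasurable
              (hf.continuous_potential _).aestronglyMeasurable,
            integral_map measurable_snd.aemeasurable
              (hf.continuous_potential _).aestronglyMeasurable]
      _ ≤ ∫ z, ‖z.1 - z.2‖ ^ 2 ∂π := by
          refine integral_mono ((k2.sub k1).const_mul _) j3 fun z => ?_
          have := hf.potential.sub_le hf.lt z.1 z.2
          rw [le_div_iff₀ (by positivity), norm_sub_rev] at this
          simp only; linarith

/-- The action of the flow at each time is the initial one. -/
theorem lintegral_sq_gradient {t : ℝ} (ht : t ∈ Set.Icc t₀ t₁) :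
    ∫⁻ x, ENNReal.ofReal (ρ t x * ‖gradient (ψ t) x‖ ^ 2)
      = ENNReal.ofReal (∫ q, ‖gradient (ψ t₀) q‖ ^ 2 ∂(densityMeasure (ρ t₀))) := by
  have h := hf.potential.lintegral_comp_characteristic hf.density_regular hf.transported ht
    (hf.pos t ht) (hf.pos _ hf.left_mem) (fun x => ENNReal.ofReal (‖gradient (ψ t) x‖ ^ 2))
  simp only [hf.potential.gradient_characteristic ht, ← ENNReal.ofReal_mul (hf.pos t ht _).le,
    ← ENNReal.ofReal_mul (hf.pos t₀ hf.left_mem _).le] at h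
  rw [h, integral_densityMeasure (hf.continuous_density _) (hf.pos _ hf.left_mem),
    ofReal_integral_eq_lintegral_ofReal ((integrable_densityMeasure_iff (hf.continuous_density _)
      (hf.pos _ hf.left_mem)).1 hf.integrable_sq_gradient)
      (Eventually.of_forall fun x => mul_nonneg (by positivity) (hf.pos _ hf.left_mem x).le)]
  simp only [mul_comm]

end IsPotentialFlow

end OptimalTransport

/-! ### The dual bound for the action of a continuity equation -/

section ContinuityEquation

variable {X : Type*} [NormedAddCommGroup X] [NormedSpace ℝ X] [FiniteDimensional ℝ X]
  [MeasureSpace X] [BorelSpace X] [(volume : Measure X).IsAddHaarMeasure]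

/-- Space-time Lebesgue measure over the time interval `[t₀, t₁]`. -/
abbrev spaceTime (X : Type*) [MeasureSpace X] (t₀ t₁ : ℝ) : Measure (ℝ × X) :=
  (volume.restrict (Set.Icc t₀ t₁)).prod volume

theorem spaceTime_eq (X : Type*) [NormedAddCommGroup X] [NormedSpace ℝ X] [FiniteDimensional ℝ X]
    [MeasureSpace X] [BorelSpace X] [(volume : Measure X).IsAddHaarMeasure] (t₀ t₁ : ℝ) :
    spaceTime X t₀ t₁ = (volume : Measure (ℝ × X)).restrict (Set.Icc t₀ t₁ ×ˢ Set.univ) := by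
  rw [Measure.volume_eq_prod, ← Measure.prod_restrict, Measure.restrict_univ]

theorem aestronglyMeasurable_spaceTime {t₀ t₁ : ℝ} {f : ℝ × X → ℝ}
    (hf : ContinuousOn f (Set.Icc t₀ t₁ ×ˢ Set.univ)) :
    AEStronglyMeasurable f (spaceTime X t₀ t₁) := by
  rw [spaceTime_eq]
  exact hf.aestronglyMeasurable (measurableSet_Icc.prod MeasurableSet.univ)

theorem ae_spaceTime {t₀ t₁ : ℝ} {p : ℝ × X → Prop}
    (h : ∀ t ∈ Set.Icc t₀ t₁, ∀ x, p (t, x)) : ∀ᵐ z ∂(spaceTime X t₀ t₁), p z := by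
  rw [spaceTime_eq]
  exact ae_restrict_of_forall_mem (measurableSet_Icc.prod MeasurableSet.univ)
    fun z hz => h z.1 hz.1 z.2

/-- A continuous function that vanishes outside a compact set of space is integrable over a bounded
space-time region. -/
theorem integrable_spaceTime_of_support {t₀ t₁ : ℝ} {f : ℝ × X → ℝ} {K : Set X} (hK : IsCompact K)
    (hf : ContinuousOn f (Set.Icc t₀ t₁ ×ˢ Set.univ)) (h0 : ∀ t x, x ∉ K → f (t, x) = 0) :
    Integrable f (spaceTime X t₀ t₁) := by
  have h1 : IntegrableOn f (Set.Icc t₀ t₁ ×ˢ K) (volume : Measure (ℝ × X)) :=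
    (hf.mono (Set.prod_mono_right (Set.subset_univ _))).integrableOn_compact (isCompact_Icc.prod hK)
  rw [spaceTime_eq]
  refine h1.of_forall_sdiff_eq_zero (measurableSet_Icc.prod MeasurableSet.univ) ?_
  rintro ⟨t, x⟩ ⟨hz, hn⟩
  exact h0 t x fun hx => hn ⟨hz.1, hx⟩

/-- The continuity equation `∂_t m + ∂ · (m v) = 0` on `[t₀, t₁]`, tested with compactly supported
functions of space. -/
def IsContinuityEq (t₀ t₁ : ℝ) (m : ℝ → X → ℝ) (v : ℝ → X → X) : Prop :=
  ∀ t ∈ Set.Icc t₀ t₁, ∀ φ : X → ℝ, ContDiff ℝ 1 φ → HasCompactSupport φ →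
    ∫ x, φ x * dt m t x = ∫ x, m t x * fderiv ℝ φ x (v t x)

/-- The growth of the mean of a bounded function `u` along a continuity equation, when the material
derivative of `u` is at most `e`. The cut-off at infinity costs the mean of `‖v‖` divided by the
radius, because `u` is bounded. -/
theorem IsContinuityEq.integral_sub_le {t₀ t₁ : ℝ} (ht : t₀ ≤ t₁) {m u : ℝ → X → ℝ} {v : ℝ → X → X}
    {e : ℝ → X → ℝ} {N : ℝ} (hmv : IsContinuityEq t₀ t₁ m v) (hm : IsC21 m) (hu : IsC21 u)
    (hpos : ∀ t ∈ Set.Icc t₀ t₁, ∀ x, 0 ≤ m t x)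
    (hv : ContinuousOn (fun z : ℝ × X => v z.1 z.2) (Set.Icc t₀ t₁ ×ˢ Set.univ))
    (hcur : Integrable (fun z : ℝ × X => m z.1 z.2 * ‖v z.1 z.2‖) (spaceTime X t₀ t₁))
    (hN : ∀ t x, |u t x| ≤ N) (he0 : ∀ t x, 0 ≤ e t x)
    (hsub : ∀ t ∈ Set.Icc t₀ t₁, ∀ x, dt u t x + fderiv ℝ (u t) x (v t x) ≤ e t x)
    (he : Integrable (fun z : ℝ × X => m z.1 z.2 * e z.1 z.2) (spaceTime X t₀ t₁))
    (hm0 : Integrable (m t₀)) (hm1 : Integrable (m t₁)) :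
    (∫ x, u t₁ x * m t₁ x) - ∫ x, u t₀ x * m t₀ x
      ≤ ∫ z, m z.1 z.2 * e z.1 z.2 ∂(spaceTime X t₀ t₁) := by
  obtain ⟨K, χ, hK, hχ⟩ := exists_cutoff X
  have hN0 : 0 ≤ N := (abs_nonneg _).trans (hN t₀ 0)
  have hux : ∀ t, Continuous (u t) := fun t => (hu.differentiable t).continuous
  have hmx : ∀ t, Continuous (m t) := fun t => (hm.differentiable t).continuous
  -- the bound with the cut-off at radius `R`
  have hR : ∀ R, 0 < R → (∫ x, χ R x * (u t₁ x * m t₁ x)) - ∫ x, χ R x * (u t₀ x * m t₀ x)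
      ≤ (∫ z, m z.1 z.2 * e z.1 z.2 ∂(spaceTime X t₀ t₁))
        + N * (K / R) * ∫ z, m z.1 z.2 * ‖v z.1 z.2‖ ∂(spaceTime X t₀ t₁) := by
    intro R hR
    obtain ⟨k1, k2, k3, k4, k5⟩ := hχ R hR
    have k1' : ContDiff ℝ 1 (χ R) := k1.of_le (by exact_mod_cast le_top)
    have hu1 : ∀ t, ContDiff ℝ 1 (u t) := fun t => (hu.space t).of_le (by norm_num)
    have hKc : IsCompact (tsupport (χ R)) := k2
    have hχ0 : ∀ x, x ∉ tsupport (χ R) → χ R x = 0 := fun x hx =>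
      image_eq_zero_of_notMem_tsupport hx
    have hχ0' : ∀ x, x ∉ tsupport (χ R) → fderiv ℝ (χ R) x = 0 := fun x hx =>
      image_eq_zero_of_notMem_tsupport fun h => hx (tsupport_fderiv_subset ℝ h)
    -- `Gt` is the time derivative of the cut-off integrand, and `Q` what the continuity equation,
    -- tested with `χ u`, makes of its space integral
    let Gt : ℝ × X → ℝ := fun z =>
      χ R z.2 * (dt u z.1 z.2 * m z.1 z.2 + u z.1 z.2 * dt m z.1 z.2)
    let Q : ℝ × X → ℝ := fun z => m z.1 z.2 * (χ R z.2 * (dt u z.1 z.2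
      + fderiv ℝ (u z.1) z.2 (v z.1 z.2)) + u z.1 z.2 * fderiv ℝ (χ R) z.2 (v z.1 z.2))
    have hGtc : Continuous Gt := (k1.continuous.comp continuous_snd).mul
      ((hu.continuous_dt.mul hm.continuous).add (hu.continuous.mul hm.continuous_dt))
    have hGti : Integrable Gt (spaceTime X t₀ t₁) :=
      integrable_spaceTime_of_support hKc hGtc.continuousOn fun t x hx => by simp [Gt, hχ0 x hx]
    have hQc : ContinuousOn Q (Set.Icc t₀ t₁ ×ˢ Set.univ) := by
      refine hm.continuous.continuousOn.mul (((k1.continuous.comp continuous_snd).continuousOn.mul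
        (hu.continuous_dt.continuousOn.add (hu.continuous_fderiv.continuousOn.clm_apply hv))).add
        (hu.continuous.continuousOn.mul (ContinuousOn.clm_apply ?_ hv)))
      exact ((k1'.continuous_fderiv (by norm_num)).comp continuous_snd).continuousOn
    have hQi : Integrable Q (spaceTime X t₀ t₁) :=
      integrable_spaceTime_of_support hKc hQc fun t x hx => by simp [Q, hχ0 x hx, hχ0' x hx]
    have hG : ∀ t x, HasDerivAt (fun s => χ R x * (u s x * m s x)) (Gt (t, x)) t := fun t x =>
      ((hu.hasDerivAt_time t x).mul (hm.hasDerivAt_time t x)).const_mul _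
    have hFTC : ∀ x, χ R x * (u t₁ x * m t₁ x) - χ R x * (u t₀ x * m t₀ x)
        = ∫ t in Set.Icc t₀ t₁, Gt (t, x) := by
      intro x
      rw [integral_Icc_eq_integral_Ioc, ← intervalIntegral.integral_of_le ht,
        intervalIntegral.integral_eq_sub_of_hasDerivAt (fun t _ => hG t x)
          ((hGtc.comp (continuous_id.prodMk continuous_const)).intervalIntegrable _ _)]
    have hχum : ∀ t, Integrable fun x => χ R x * (u t x * m t x) := fun t =>
      (k1.continuous.mul ((hux t).mul (hmx t))).integrable_of_hasCompactSupport k2.mul_right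
    have hGQ : ∀ t ∈ Set.Icc t₀ t₁, ∫ x, Gt (t, x) = ∫ x, Q (t, x) := by
      intro t htt
      have h1 := hmv t htt (fun x => χ R x * u t x) (k1'.mul (hu1 t)) k2.mul_right
      have hdu : Continuous fun x => dt u t x :=
        hu.continuous_dt.comp (continuous_const.prodMk continuous_id)
      have hdm : Continuous fun x => dt m t x :=
        hm.continuous_dt.comp (continuous_const.prodMk continuous_id)
      have hvt : Continuous (v t) := by
        rw [← continuousOn_univ]
        exact hv.comp (continuous_const.prodMk continuous_id).continuousOn
          fun x _ => ⟨htt, trivial⟩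
      have i1 : Integrable fun x => χ R x * (dt u t x * m t x) :=
        (k1.continuous.mul (hdu.mul (hmx t))).integrable_of_hasCompactSupport k2.mul_right
      have i2 : Integrable fun x => χ R x * u t x * dt m t x :=
        ((k1.continuous.mul (hux t)).mul hdm).integrable_of_hasCompactSupport k2.mul_right.mul_right
      have i3 : Integrable fun x => m t x * fderiv ℝ (fun x => χ R x * u t x) x (v t x) := by
        refine ((hmx t).mul ((((k1'.mul (hu1 t)).continuous_fderiv
          (by norm_num))).clm_apply hvt)).integrable_of_hasCompactSupport ?_
        have : HasCompactSupport (fderiv ℝ fun x => χ R x * u t x) :=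
          HasCompactSupport.fderiv (𝕜 := ℝ) k2.mul_right
        refine this.mono fun x hx => ?_
        contrapose! hx
        rw [Function.notMem_support] at hx ⊢
        simp [hx]
      have e1 : ∫ x, Gt (t, x) = (∫ x, χ R x * (dt u t x * m t x))
          + ∫ x, χ R x * u t x * dt m t x := by
        rw [← integral_add i1 i2]
        exact integral_congr_ae (Eventually.of_forall fun x => by simp only [Gt]; ring)
      rw [e1, h1, ← integral_add i1 i3]
      refine integral_congr_ae (Eventually.of_forall fun x => ?_)
      have h2 := ((k1'.differentiable (by norm_num) x).hasFDerivAt.mul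
        ((hu1 t).differentiable (by norm_num) x).hasFDerivAt).fderiv
      change fderiv ℝ (fun x => χ R x * u t x) x = _ at h2
      simp only [h2, Q, add_apply, smul_apply, smul_eq_mul]
      ring
    calc (∫ x, χ R x * (u t₁ x * m t₁ x)) - ∫ x, χ R x * (u t₀ x * m t₀ x)
        = ∫ x, ∫ t in Set.Icc t₀ t₁, Gt (t, x) := by
          rw [← integral_sub (hχum t₁) (hχum t₀)]; simp only [hFTC]
      _ = ∫ t in Set.Icc t₀ t₁, ∫ x, Gt (t, x) := (integral_integral_swap hGti).symm
      _ = ∫ t in Set.Icc t₀ t₁, ∫ x, Q (t, x) :=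
          setIntegral_congr_fun measurableSet_Icc fun t htt => hGQ t htt
      _ = ∫ z, Q z ∂(spaceTime X t₀ t₁) := (integral_prod _ hQi).symm
      _ ≤ ∫ z, (m z.1 z.2 * e z.1 z.2 + N * (K / R) * (m z.1 z.2 * ‖v z.1 z.2‖))
            ∂(spaceTime X t₀ t₁) := by
          refine integral_mono_ae hQi (he.add (hcur.const_mul _)) (ae_spaceTime fun t htt x => ?_)
          have h1 : |fderiv ℝ (χ R) x (v t x)| ≤ K / R * ‖v t x‖ :=
            ((fderiv ℝ (χ R) x).le_opNorm _).trans
              (mul_le_mul_of_nonneg_right (k5 x) (norm_nonneg _))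
          have h2 : u t x * fderiv ℝ (χ R) x (v t x) ≤ N * (K / R * ‖v t x‖) :=
            (le_abs_self _).trans ((abs_mul _ _).trans_le
              (mul_le_mul (hN t x) h1 (abs_nonneg _) hN0))
          have h3 : χ R x * (dt u t x + fderiv ℝ (u t) x (v t x)) ≤ e t x :=
            (mul_le_mul_of_nonneg_left (hsub t htt x) (k3 x).1).trans
              (mul_le_of_le_one_left (he0 t x) (k3 x).2)
          have h4 := mul_le_mul_of_nonneg_left (add_le_add h3 h2) (hpos t htt x)
          simp only [Q]
          linarith
      _ = _ := by rw [integral_add he (hcur.const_mul _), integral_const_mul]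
  -- the limit of large radius
  have hlim : ∀ t, Integrable (m t) → Tendsto (fun R => ∫ x, χ R x * (u t x * m t x)) atTop
      (𝓝 (∫ x, u t x * m t x)) := by
    intro t hmt
    refine tendsto_integral_filter_of_dominated_convergence (fun x => N * |m t x|) ?_ ?_
      (hmt.abs.const_mul N) (Eventually.of_forall fun x => ?_)
    · filter_upwards [eventually_gt_atTop 0] with R hR
      exact ((hχ R hR).1.continuous.mul ((hux t).mul (hmx t))).aestronglyMeasurable
    · filter_upwards [eventually_gt_atTop 0] with R hR
      refine Eventually.of_forall fun x => ?_
      have h3 := (hχ R hR).2.2.1 x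
      rw [Real.norm_eq_abs, abs_mul, abs_mul, abs_of_nonneg h3.1]
      exact (mul_le_of_le_one_left (by positivity) h3.2).trans
        (mul_le_mul_of_nonneg_right (hN t x) (abs_nonneg _))
    · refine tendsto_const_nhds.congr' ?_
      filter_upwards [eventually_gt_atTop 0, eventually_ge_atTop ‖x‖] with R hR hx
      rw [(hχ R hR).2.2.2.1 x hx, one_mul]
  have hlimR : Tendsto (fun R : ℝ => (∫ z, m z.1 z.2 * e z.1 z.2 ∂(spaceTime X t₀ t₁))
        + N * (K / R) * ∫ z, m z.1 z.2 * ‖v z.1 z.2‖ ∂(spaceTime X t₀ t₁)) atTop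
      (𝓝 ((∫ z, m z.1 z.2 * e z.1 z.2 ∂(spaceTime X t₀ t₁))
        + N * 0 * ∫ z, m z.1 z.2 * ‖v z.1 z.2‖ ∂(spaceTime X t₀ t₁))) :=
    (((tendsto_const_nhds.div_atTop tendsto_id).const_mul N).mul_const _).const_add _
  have := le_of_tendsto_of_tendsto ((hlim t₁ hm1).sub (hlim t₀ hm0)) hlimR
    ((eventually_gt_atTop 0).mono hR)
  simpa using this

end ContinuityEquation

/-! ### Truncated potentials -/

section Truncation

/-- A bounded, smooth, increasing truncation of the identity with slope at most one. -/
def truncation (N y : ℝ) : ℝ := N * Real.arctan (N⁻¹ * y)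

theorem contDiff_truncation (N : ℝ) : ContDiff ℝ 2 (truncation N) :=
  contDiff_const.mul (Real.contDiff_arctan.comp (contDiff_const.mul contDiff_id))

theorem hasDerivAt_truncation {N : ℝ} (hN : 0 < N) (y : ℝ) :
    HasDerivAt (truncation N) (1 / (1 + (N⁻¹ * y) ^ 2)) y := by
  have h := (((hasDerivAt_id y).const_mul N⁻¹).arctan).const_mul N
  refine h.congr_deriv ?_
  simp only [id]; field_simp

theorem deriv_truncation_mem {N : ℝ} (hN : 0 < N) (y : ℝ) :
    0 ≤ deriv (truncation N) y ∧ deriv (truncation N) y ≤ 1 := by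
  rw [(hasDerivAt_truncation hN y).deriv]
  exact ⟨by positivity, (div_le_one (by positivity)).2 (by nlinarith [sq_nonneg (N⁻¹ * y)])⟩

theorem abs_truncation_le {N : ℝ} (hN : 0 < N) (y : ℝ) : |truncation N y| ≤ N * (Real.pi / 2) := by
  rw [truncation, abs_mul, abs_of_pos hN]
  exact mul_le_mul_of_nonneg_left
    (abs_le.2 ⟨(Real.neg_pi_div_two_lt_arctan _).le, (Real.arctan_lt_pi_div_two _).le⟩) hN.le

theorem abs_truncation_le_abs {N : ℝ} (hN : 0 < N) (y : ℝ) : |truncation N y| ≤ |y| := by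
  have h := (convex_univ (𝕜 := ℝ) (E := ℝ)).norm_image_sub_le_of_norm_deriv_le
    (f := truncation N) (C := 1)
    (fun x _ => (hasDerivAt_truncation hN x).differentiableAt) (fun x _ => by
      have := deriv_truncation_mem hN x
      rw [Real.norm_eq_abs, abs_of_nonneg this.1]; exact this.2) (Set.mem_univ 0) (Set.mem_univ y)
  simpa [truncation] using h

theorem tendsto_truncation (y : ℝ) : Tendsto (fun N => truncation N y) atTop (𝓝 y) := by
  have h0 : HasDerivAt (fun x => Real.arctan (x * y)) y 0 := by
    have := ((hasDerivAt_id (0 : ℝ)).mul_const y).arctan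
    simpa using this
  have h1 := h0.tendsto_slope_zero_right
  have h2 := h1.comp tendsto_inv_atTop_nhdsGT_zero
  refine h2.congr fun N => ?_
  simp [truncation]

end Truncation

section DualBound

variable {d : ℕ} {t₀ t₁ : ℝ} {ψ ρ : ℝ → Pos d → ℝ}
variable {X : Type*} [NormedAddCommGroup X] [NormedSpace ℝ X] [FiniteDimensional ℝ X]
  [MeasureSpace X] [BorelSpace X] [(volume : Measure X).IsAddHaarMeasure]

/-- Any continuity equation on a space `X` over configuration space, with the same marginals on
configuration space at the end points as a potential flow, has at least the action of that flow.
The truncated potentials of the flow are bounded subsolutions of the Hamilton-Jacobi equation. -/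
theorem IsPotentialFlow.action_le (hf : IsPotentialFlow t₀ t₁ ψ ρ) (P : X →L[ℝ] Pos d)
    {m : ℝ → X → ℝ} {v : ℝ → X → X} (hmv : IsContinuityEq t₀ t₁ m v) (hm : IsC21 m)
    (hpos : ∀ t ∈ Set.Icc t₀ t₁, ∀ x, 0 ≤ m t x)
    (hv : ContinuousOn (fun z : ℝ × X => v z.1 z.2) (Set.Icc t₀ t₁ ×ˢ Set.univ))
    (hcur : Integrable (fun z : ℝ × X => m z.1 z.2 * ‖v z.1 z.2‖) (spaceTime X t₀ t₁))
    (hm0 : Integrable (m t₀)) (hm1 : Integrable (m t₁))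
    (hmarg0 : ∀ g : Pos d → ℝ, Continuous g → (∃ C, ∀ q, |g q| ≤ C) →
      ∫ x, g (P x) * m t₀ x = ∫ q, g q * ρ t₀ q)
    (hmarg1 : ∀ g : Pos d → ℝ, Continuous g → (∃ C, ∀ q, |g q| ≤ C) →
      ∫ x, g (P x) * m t₁ x = ∫ q, g q * ρ t₁ q) :
    ENNReal.ofReal ((t₁ - t₀) * ∫ q, ‖gradient (ψ t₀) q‖ ^ 2 ∂(densityMeasure (ρ t₀)))
      ≤ ∫⁻ t in Set.Icc t₀ t₁, ∫⁻ x, ENNReal.ofReal (m t x * ‖P (v t x)‖ ^ 2) := by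
  set f : ℝ × X → ℝ := fun z => m z.1 z.2 * ‖P (v z.1 z.2)‖ ^ 2 with hfdef
  have hfc : ContinuousOn f (Set.Icc t₀ t₁ ×ˢ Set.univ) :=
    hm.continuous.continuousOn.mul ((P.continuous.comp_continuousOn hv).norm.pow 2)
  have hfm := aestronglyMeasurable_spaceTime hfc
  have hfub : ∫⁻ t in Set.Icc t₀ t₁, ∫⁻ x, ENNReal.ofReal (m t x * ‖P (v t x)‖ ^ 2)
      = ∫⁻ z, ENNReal.ofReal (f z) ∂(spaceTime X t₀ t₁) :=
    (lintegral_prod _ hfm.aemeasurable.ennreal_ofReal).symm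
  have hf0 : ∀ᵐ z ∂(spaceTime X t₀ t₁), 0 ≤ f z :=
    ae_spaceTime fun t ht x => mul_nonneg (hpos t ht x) (sq_nonneg _)
  rw [hfub]
  -- an infinite action leaves nothing to prove
  by_cases htop : ∫⁻ z, ENNReal.ofReal (f z) ∂(spaceTime X t₀ t₁) = ⊤
  · rw [htop]; exact le_top
  have hfi : Integrable f (spaceTime X t₀ t₁) :=
    (lintegral_ofReal_ne_top_iff_integrable hfm hf0).1 htop
  rw [← ofReal_integral_eq_lintegral_ofReal hfi hf0]
  refine ENNReal.ofReal_le_ofReal ?_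
  have hΨ : IsC21 fun t x => ψ t (P x) := hf.potential.regular.comp_clm P
  -- `⟪∂ψ, P v⟫ - ‖∂ψ‖² / 2 ≤ ‖P v‖² / 2`, and the slope of the truncation is between zero and one
  have key : ∀ N, 0 < N → (∫ q, truncation N (ψ t₁ q) * ρ t₁ q)
      - ∫ q, truncation N (ψ t₀ q) * ρ t₀ q ≤ 2⁻¹ * ∫ z, f z ∂(spaceTime X t₀ t₁) := by
    intro N hN
    have hb : ∀ t, ∃ C, ∀ q, |truncation N (ψ t q)| ≤ C := fun t =>
      ⟨_, fun q => abs_truncation_le hN _⟩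
    have hc : ∀ t, Continuous fun q => truncation N (ψ t q) := fun t =>
      (contDiff_truncation N).continuous.comp (hf.continuous_potential t)
    rw [← hmarg1 _ (hc t₁) (hb t₁), ← hmarg0 _ (hc t₀) (hb t₀)]
    have h := hmv.integral_sub_le (e := fun t x => 2⁻¹ * ‖P (v t x)‖ ^ 2) hf.lt.le hm
      (hΨ.comp_left (contDiff_truncation N)) hpos hv hcur
      (fun t x => abs_truncation_le hN _) (fun t x => by positivity) (fun t ht x => ?_)
      ((hfi.const_mul 2⁻¹).congr (Eventually.of_forall fun z => by simp only [hfdef]; ring)) hm0 hm1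
    · refine h.trans_eq ?_
      rw [← integral_const_mul]
      refine integral_congr_ae (Eventually.of_forall fun z => ?_)
      simp only [hfdef]; ring
    · have hd := (contDiff_truncation N).differentiable (by norm_num)
      rw [dt_comp hΨ hd, fderiv_scalar_comp (hΨ.differentiable t x) (hd _)]
      have h1 : fderiv ℝ (fun x => ψ t (P x)) x = (fderiv ℝ (ψ t) (P x)).comp P :=
        ((hf.potential.regular.differentiable t (P x)).hasFDerivAt.comp x P.hasFDerivAt).fderiv
      have h2 : dt (fun t x => ψ t (P x)) t x = -(‖gradient (ψ t) (P x)‖ ^ 2 / 2) :=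
        hf.potential.eq t ht (P x)
      rw [h1, h2, smul_apply, ContinuousLinearMap.comp_apply, ← inner_gradient_left, smul_eq_mul,
        ← mul_add]
      obtain ⟨d0, d1⟩ := deriv_truncation_mem hN (ψ t (P x))
      have h3 : -(‖gradient (ψ t) (P x)‖ ^ 2 / 2) + inner ℝ (gradient (ψ t) (P x)) (P (v t x))
          ≤ 2⁻¹ * ‖P (v t x)‖ ^ 2 := by
        nlinarith [norm_sub_sq_real (gradient (ψ t) (P x)) (P (v t x)),
          sq_nonneg ‖gradient (ψ t) (P x) - P (v t x)‖]
      exact (mul_le_mul_of_nonneg_left h3 d0).trans (mul_le_of_le_one_left (by positivity) d1)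
  have hlim : ∀ t, Integrable (fun q => ψ t q * ρ t q) →
      Tendsto (fun N => ∫ q, truncation N (ψ t q) * ρ t q) atTop (𝓝 (∫ q, ψ t q * ρ t q)) := by
    intro t hi
    refine tendsto_integral_filter_of_dominated_convergence (fun q => |ψ t q * ρ t q|) ?_ ?_
      hi.abs (Eventually.of_forall fun q => (tendsto_truncation _).mul_const _)
    · exact Eventually.of_forall fun N => (((contDiff_truncation N).continuous.comp
        (hf.continuous_potential t)).mul (hf.continuous_density t)).aestronglyMeasurable
    · filter_upwards [eventually_gt_atTop 0] with N hN
      refine Eventually.of_forall fun q => ?_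
      rw [Real.norm_eq_abs, abs_mul, abs_mul]
      exact mul_le_mul_of_nonneg_right (abs_truncation_le_abs hN _) (abs_nonneg _)
  have i0 := (integrable_densityMeasure_iff (hf.continuous_density _) (hf.pos _ hf.left_mem)).1
    hf.integrable_potential.1
  have i1 := (integrable_densityMeasure_iff (hf.continuous_density _) (hf.pos _ hf.right_mem)).1
    hf.integrable_potential.2
  have hle := le_of_tendsto ((hlim t₁ i1).sub (hlim t₀ i0)) ((eventually_gt_atTop 0).mono key)
  rw [← integral_densityMeasure (hf.continuous_density _) (hf.pos _ hf.left_mem),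
    ← integral_densityMeasure (hf.continuous_density _) (hf.pos _ hf.right_mem),
    hf.integral_potential_sub] at hle
  linarith

end DualBound

/-! ### Calculus on phase space -/

section PhaseCalculus

variable {d : ℕ} {f g : Phase d → ℝ} {x : Phase d}

theorem hasFDerivAt_slice_left {F : Type*} [NormedAddCommGroup F] [NormedSpace ℝ F]
    {f : Phase d → F} {x : Phase d} (hf : DifferentiableAt ℝ f x) :
    HasFDerivAt (fun q => f (q, x.2)) ((fderiv ℝ f x).comp (.inl ℝ (Pos d) (Pos d))) x.1 :=
  HasFDerivAt.comp (g := f) x.1 hf.hasFDerivAt (hasFDerivAt_prodMk_left x.1 x.2)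

theorem hasFDerivAt_slice_right {F : Type*} [NormedAddCommGroup F] [NormedSpace ℝ F]
    {f : Phase d → F} {x : Phase d} (hf : DifferentiableAt ℝ f x) :
    HasFDerivAt (fun p => f (x.1, p)) ((fderiv ℝ f x).comp (.inr ℝ (Pos d) (Pos d))) x.2 :=
  HasFDerivAt.comp (g := f) x.2 hf.hasFDerivAt (hasFDerivAt_prodMk_right x.1 x.2)

theorem inner_gradQ (hf : DifferentiableAt ℝ f x) (w : Pos d) :
    inner ℝ (gradQ f x) w = fderiv ℝ f x (w, 0) := by
  rw [gradQ, inner_gradient_left, (hasFDerivAt_slice_left hf).fderiv]; rfl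

theorem inner_gradP (hf : DifferentiableAt ℝ f x) (w : Pos d) :
    inner ℝ (gradP f x) w = fderiv ℝ f x (0, w) := by
  rw [gradP, inner_gradient_left, (hasFDerivAt_slice_right hf).fderiv]; rfl

/-- The linear map that takes a differential on phase space to its position gradient. -/
def dualQ (d : ℕ) : (Phase d →L[ℝ] ℝ) →L[ℝ] Pos d :=
  (InnerProductSpace.toDual ℝ (Pos d)).symm.toContinuousLinearEquiv.toContinuousLinearMap.comp
    ((ContinuousLinearMap.compL ℝ (Pos d) (Phase d) ℝ).flip (.inl ℝ (Pos d) (Pos d)))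

/-- The linear map that takes a differential on phase space to its momentum gradient. -/
def dualP (d : ℕ) : (Phase d →L[ℝ] ℝ) →L[ℝ] Pos d :=
  (InnerProductSpace.toDual ℝ (Pos d)).symm.toContinuousLinearEquiv.toContinuousLinearMap.comp
    ((ContinuousLinearMap.compL ℝ (Pos d) (Phase d) ℝ).flip (.inr ℝ (Pos d) (Pos d)))

theorem inner_dualQ (L : Phase d →L[ℝ] ℝ) (w : Pos d) : inner ℝ (dualQ d L) w = L (w, 0) := by
  change inner ℝ ((InnerProductSpace.toDual ℝ (Pos d)).symm
    (L.comp (.inl ℝ (Pos d) (Pos d)))) w = _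
  simp

theorem inner_dualP (L : Phase d →L[ℝ] ℝ) (w : Pos d) : inner ℝ (dualP d L) w = L (0, w) := by
  change inner ℝ ((InnerProductSpace.toDual ℝ (Pos d)).symm
    (L.comp (.inr ℝ (Pos d) (Pos d)))) w = _
  simp

theorem gradQ_eq (hf : DifferentiableAt ℝ f x) : gradQ f x = dualQ d (fderiv ℝ f x) :=
  ext_inner_right ℝ fun w => by rw [inner_gradQ hf, inner_dualQ]

theorem gradP_eq (hf : DifferentiableAt ℝ f x) : gradP f x = dualP d (fderiv ℝ f x) :=
  ext_inner_right ℝ fun w => by rw [inner_gradP hf, inner_dualP]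

theorem contDiff_gradQ (hf : ContDiff ℝ 2 f) : ContDiff ℝ 1 (gradQ f) := by
  rw [show gradQ f = fun x => dualQ d (fderiv ℝ f x) from
    funext fun x => gradQ_eq (hf.differentiable (by norm_num) x)]
  exact (dualQ d).contDiff.comp (hf.fderiv_right (by norm_num))

theorem contDiff_gradP (hf : ContDiff ℝ 2 f) : ContDiff ℝ 1 (gradP f) := by
  rw [show gradP f = fun x => dualP d (fderiv ℝ f x) from
    funext fun x => gradP_eq (hf.differentiable (by norm_num) x)]
  exact (dualP d).contDiff.comp (hf.fderiv_right (by norm_num))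

theorem inner_fderiv_gradQ (hf : ContDiff ℝ 2 f) (x v : Phase d) (w : Pos d) :
    inner ℝ (fderiv ℝ (gradQ f) x v) w = fderiv ℝ (fderiv ℝ f) x v (w, 0) := by
  have h : fderiv ℝ (fun x => dualQ d (fderiv ℝ f x)) x
      = (dualQ d).comp (fderiv ℝ (fderiv ℝ f) x) :=
    ((dualQ d).hasFDerivAt.comp x (hf.fderiv_right (m := 1) (by norm_num) |>.differentiable
      (by norm_num) x).hasFDerivAt).fderiv
  rw [show gradQ f = fun x => dualQ d (fderiv ℝ f x) from
    funext fun x => gradQ_eq (hf.differentiable (by norm_num) x), h]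
  exact inner_dualQ _ _

theorem inner_fderiv_gradP (hf : ContDiff ℝ 2 f) (x v : Phase d) (w : Pos d) :
    inner ℝ (fderiv ℝ (gradP f) x v) w = fderiv ℝ (fderiv ℝ f) x v (0, w) := by
  have h : fderiv ℝ (fun x => dualP d (fderiv ℝ f x)) x
      = (dualP d).comp (fderiv ℝ (fderiv ℝ f) x) :=
    ((dualP d).hasFDerivAt.comp x (hf.fderiv_right (m := 1) (by norm_num) |>.differentiable
      (by norm_num) x).hasFDerivAt).fderiv
  rw [show gradP f = fun x => dualP d (fderiv ℝ f x) from
    funext fun x => gradP_eq (hf.differentiable (by norm_num) x), h]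
  exact inner_dualP _ _

theorem divQ_eq_sum {Y : Phase d → Pos d} (hY : DifferentiableAt ℝ Y x) :
    divQ Y x = ∑ i, fderiv ℝ Y x (basisVec i, 0) i := by
  rw [divQ, divergence, (hasFDerivAt_slice_left hY).fderiv]; rfl

theorem divP_eq_sum {Y : Phase d → Pos d} (hY : DifferentiableAt ℝ Y x) :
    divP Y x = ∑ i, fderiv ℝ Y x (0, basisVec i) i := by
  rw [divP, divergence, (hasFDerivAt_slice_right hY).fderiv]; rfl

theorem apply_eq_inner (v : Pos d) (i : Fin d) : v i = inner ℝ v (basisVec i) := by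
  simp [EuclideanSpace.inner_single_right]

/-- The mixed divergences of the two gradients agree. -/
theorem divQ_gradP (hf : ContDiff ℝ 2 f) (x : Phase d) : divQ (gradP f) x = divP (gradQ f) x := by
  rw [divQ_eq_sum ((contDiff_gradP hf).differentiable (by norm_num) x),
    divP_eq_sum ((contDiff_gradQ hf).differentiable (by norm_num) x)]
  refine Finset.sum_congr rfl fun i _ => ?_
  rw [apply_eq_inner, apply_eq_inner, inner_fderiv_gradP hf, inner_fderiv_gradQ hf]
  exact (hf.contDiffAt.isSymmSndFDerivAt (by simp)) _ _

theorem contDiff_slice_left (hf : ContDiff ℝ 2 f) (p : Pos d) :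
    ContDiff ℝ 2 fun q => f (q, p) := hf.comp (contDiff_prodMk_left p)

theorem contDiff_slice_right (hf : ContDiff ℝ 2 f) (q : Pos d) :
    ContDiff ℝ 2 fun p => f (q, p) := hf.comp (contDiff_prodMk_right q)

theorem divP_gradP (hf : ContDiff ℝ 2 f) (x : Phase d) : divP (gradP f) x = lapP f x :=
  divergence_gradient ((contDiff_slice_right hf x.1).differentiable_fderiv x.2)

theorem divQ_smul {Y : Phase d → Pos d} (hg : DifferentiableAt ℝ g x)
    (hY : DifferentiableAt ℝ Y x) :
    divQ (fun y => g y • Y y) x = inner ℝ (gradQ g x) (Y x) + g x * divQ Y x := by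
  rw [gradQ, inner_gradient_left]
  exact divergence_smul (c := fun q => g (q, x.2)) (X := fun q => Y (q, x.2))
    (hasFDerivAt_slice_left hg).differentiableAt (hasFDerivAt_slice_left hY).differentiableAt

theorem divP_smul {Y : Phase d → Pos d} (hg : DifferentiableAt ℝ g x)
    (hY : DifferentiableAt ℝ Y x) :
    divP (fun y => g y • Y y) x = inner ℝ (gradP g x) (Y x) + g x * divP Y x := by
  rw [gradP, inner_gradient_left]
  exact divergence_smul (c := fun p => g (x.1, p)) (X := fun p => Y (x.1, p))
    (hasFDerivAt_slice_right hg).differentiableAt (hasFDerivAt_slice_right hY).differentiableAt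

theorem divP_add {Y Z : Phase d → Pos d} (hY : DifferentiableAt ℝ Y x)
    (hZ : DifferentiableAt ℝ Z x) :
    divP (fun y => Y y + Z y) x = divP Y x + divP Z x :=
  divergence_add (X := fun p => Y (x.1, p)) (Y := fun p => Z (x.1, p))
    (hasFDerivAt_slice_right hY).differentiableAt (hasFDerivAt_slice_right hZ).differentiableAt

theorem gradQ_add (hf : DifferentiableAt ℝ f x) (hg : DifferentiableAt ℝ g x) :
    gradQ (fun y => f y + g y) x = gradQ f x + gradQ g x := by
  rw [gradQ_eq hf, gradQ_eq hg, gradQ_eq (hf.fun_add hg), fderiv_fun_add hf hg, map_add]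

theorem gradP_add (hf : DifferentiableAt ℝ f x) (hg : DifferentiableAt ℝ g x) :
    gradP (fun y => f y + g y) x = gradP f x + gradP g x := by
  rw [gradP_eq hf, gradP_eq hg, gradP_eq (hf.fun_add hg), fderiv_fun_add hf hg, map_add]

theorem gradQ_sub (hf : DifferentiableAt ℝ f x) (hg : DifferentiableAt ℝ g x) :
    gradQ (fun y => f y - g y) x = gradQ f x - gradQ g x := by
  rw [gradQ_eq hf, gradQ_eq hg, gradQ_eq (hf.fun_sub hg), fderiv_fun_sub hf hg, map_sub]

theorem gradP_sub (hf : DifferentiableAt ℝ f x) (hg : DifferentiableAt ℝ g x) :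
    gradP (fun y => f y - g y) x = gradP f x - gradP g x := by
  rw [gradP_eq hf, gradP_eq hg, gradP_eq (hf.fun_sub hg), fderiv_fun_sub hf hg, map_sub]

theorem lapP_add (hf : ContDiff ℝ 2 f) (hg : ContDiff ℝ 2 g) (x : Phase d) :
    lapP (fun y => f y + g y) x = lapP f x + lapP g x :=
  ContDiffAt.laplacian_add (contDiff_slice_right hf x.1).contDiffAt
    (contDiff_slice_right hg x.1).contDiffAt

theorem lapP_sub (hf : ContDiff ℝ 2 f) (hg : ContDiff ℝ 2 g) (x : Phase d) :
    lapP (fun y => f y - g y) x = lapP f x - lapP g x :=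
  ContDiffAt.laplacian_sub (contDiff_slice_right hf x.1).contDiffAt
    (contDiff_slice_right hg x.1).contDiffAt

theorem sum_smul_prod_left (v : Pos d) :
    ∑ i, v i • ((basisVec i, 0) : Phase d) = (v, 0) := by
  refine Prod.ext ?_ ?_ <;> simp [Prod.fst_sum, Prod.snd_sum, sum_smul_basisVec]

theorem sum_smul_prod_right (v : Pos d) :
    ∑ i, v i • ((0, basisVec i) : Phase d) = (0, v) := by
  refine Prod.ext ?_ ?_ <;> simp [Prod.fst_sum, Prod.snd_sum, sum_smul_basisVec]

instance : (volume : Measure (Phase d)).IsAddHaarMeasure := by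
  rw [Measure.volume_eq_prod]; infer_instance

theorem integral_mul_divQ {φ : Phase d → ℝ} {Y : Phase d → Pos d} (hφ : ContDiff ℝ 1 φ)
    (hφc : HasCompactSupport φ) (hY : ContDiff ℝ 1 Y) :
    ∫ x, φ x * divQ Y x = -∫ x, fderiv ℝ φ x (Y x, 0) := by
  have h := integral_mul_sum_fderiv volume (fun i => ((basisVec i, 0) : Phase d)) hφ hφc hY
  simpa only [sum_smul_prod_left, ← divQ_eq_sum (hY.differentiable (by norm_num) _)] using h

theorem integral_mul_divP {φ : Phase d → ℝ} {Y : Phase d → Pos d} (hφ : ContDiff ℝ 1 φ)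
    (hφc : HasCompactSupport φ) (hY : ContDiff ℝ 1 Y) :
    ∫ x, φ x * divP Y x = -∫ x, fderiv ℝ φ x (0, Y x) := by
  have h := integral_mul_sum_fderiv volume (fun i => ((0, basisVec i) : Phase d)) hφ hφc hY
  simpa only [sum_smul_prod_right, ← divP_eq_sum (hY.differentiable (by norm_num) _)] using h

end PhaseCalculus

/-! ### The Fokker-Planck equation of a Langevin-Kramers transition -/

section Kramers

variable {d : ℕ} {β τ t₀ t₁ : ℝ} {mo mf : Phase d → ℝ} {m H : ℝ → Phase d → ℝ}

theorem hasFDerivAt_microEntropy {t : ℝ} {x : Phase d} (hβ : 0 < β) (hm : 0 < m t x)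
    (hd : DifferentiableAt ℝ (m t) x) :
    HasFDerivAt (microEntropy β m t) (-((β * m t x)⁻¹ • fderiv ℝ (m t) x)) x := by
  have h := (((hd.hasFDerivAt.mul_const (β ^ d)⁻¹).log (by positivity)).const_mul β⁻¹).neg
  refine HasFDerivAt.congr_fderiv (f := microEntropy β m t) h ?_
  rw [smul_smul, smul_smul]
  congr 2
  field_simp

theorem contDiff_microEntropy {t : ℝ} (hβ : 0 < β) (hm : ∀ x, 0 < m t x)
    (hd : ContDiff ℝ 2 (m t)) : ContDiff ℝ 2 (microEntropy β m t) :=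
  (contDiff_const.mul ((hd.div_const _).log fun x => (div_pos (hm x) (by positivity)).ne')).neg

theorem hasDerivAt_microEntropy {t : ℝ} {x : Phase d} (hβ : 0 < β) (hm : 0 < m t x)
    (hd : IsC21 m) :
    HasDerivAt (fun s => microEntropy β m s x) (-((β * m t x)⁻¹ * dt m t x)) t := by
  have h := (((((hd.hasDerivAt_time t x).div_const (β ^ d))).log (by positivity)).const_mul
    β⁻¹).neg
  refine HasDerivAt.congr_deriv (f := fun s => microEntropy β m s x) h ?_
  field_simp

theorem gradQ_density (hβ : 0 < β) {t : ℝ} {x : Phase d} (hm : 0 < m t x)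
    (hd : DifferentiableAt ℝ (m t) x) :
    gradQ (m t) x = -(β * m t x) • gradQ (microEntropy β m t) x := by
  have h := hasFDerivAt_microEntropy hβ hm hd
  rw [gradQ_eq hd, gradQ_eq h.differentiableAt, h.fderiv, ← map_smul, neg_smul_neg, smul_smul,
    mul_inv_cancel₀ (by positivity), one_smul]

theorem gradP_density (hβ : 0 < β) {t : ℝ} {x : Phase d} (hm : 0 < m t x)
    (hd : DifferentiableAt ℝ (m t) x) :
    gradP (m t) x = -(β * m t x) • gradP (microEntropy β m t) x := by
  have h := hasFDerivAt_microEntropy hβ hm hd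
  rw [gradP_eq hd, gradP_eq h.differentiableAt, h.fderiv, ← map_smul, neg_smul_neg, smul_smul,
    mul_inv_cancel₀ (by positivity), one_smul]

namespace IsLKTransition

variable (h : IsLKTransition β τ t₀ t₁ mo mf m H)
include h

theorem contDiff_entropy (hβ : 0 < β) {t : ℝ} (ht : t ∈ Set.Icc t₀ t₁) :
    ContDiff ℝ 2 (microEntropy β m t) :=
  contDiff_microEntropy hβ (h.pos t ht) (h.density_regular.space t)

theorem contDiff_helmholtz (hβ : 0 < β) {t : ℝ} (ht : t ∈ Set.Icc t₀ t₁) :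
    ContDiff ℝ 2 (helmholtz β m H t) :=
  (h.hamiltonian_regular.space t).sub (h.contDiff_entropy hβ ht)

/-- The Fokker-Planck equation as a continuity equation whose current is `m (J - G) ∂A`: the
entropic part of the Hamiltonian current is divergence free, and the entropic part of the friction
cancels the noise. -/
theorem continuity (hβ : 0 < β) {t : ℝ} (ht : t ∈ Set.Icc t₀ t₁) (x : Phase d) :
    τ * dt m t x = -inner ℝ (gradQ (m t) x) (gradP (helmholtz β m H t) x)
      + inner ℝ (gradP (m t) x) (gradQ (helmholtz β m H t) x + gradP (helmholtz β m H t) x)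
      + m t x * lapP (helmholtz β m H t) x := by
  have hm := h.density_regular.space t
  have hH := h.hamiltonian_regular.space t
  have hS := h.contDiff_entropy hβ ht
  have hA := h.contDiff_helmholtz hβ ht
  have dm := hm.differentiable (by norm_num) x
  have dH := hH.differentiable (by norm_num) x
  have dS := hS.differentiable (by norm_num) x
  have dA := hA.differentiable (by norm_num) x
  have dHP := (contDiff_gradP hH).differentiable (by norm_num) x
  have dHQ := (contDiff_gradQ hH).differentiable (by norm_num) x
  have dSP := (contDiff_gradP hS).differentiable (by norm_num) x
  have e1 : H t = fun y => helmholtz β m H t y + microEntropy β m t y := by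
    funext y; simp [helmholtz]
  have hP : gradP (H t) x = gradP (helmholtz β m H t) x + gradP (microEntropy β m t) x := by
    rw [e1]; exact gradP_add dA dS
  have hQ : gradQ (H t) x = gradQ (helmholtz β m H t) x + gradQ (microEntropy β m t) x := by
    rw [e1]; exact gradQ_add dA dS
  have hL : lapP (H t) x = lapP (helmholtz β m H t) x + lapP (microEntropy β m t) x := by
    rw [e1]; exact lapP_add hA hS x
  have hlm : lapP (m t) x = -β * (inner ℝ (gradP (m t) x) (gradP (microEntropy β m t) x)
      + m t x * lapP (microEntropy β m t) x) := by
    have e2 : gradP (m t) = fun y => (-β * m t y) • gradP (microEntropy β m t) y := by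
      funext y
      rw [gradP_density hβ (h.pos t ht y) (hm.differentiable (by norm_num) y), neg_mul]
    rw [← divP_gradP hm, e2, divP_smul (dm.const_mul _) dSP, divP_gradP hS, ← e2]
    have e3 : gradP (fun y => -β * m t y) x = -β • gradP (m t) x := by
      rw [gradP_eq (dm.const_mul _), gradP_eq dm, fderiv_const_mul dm, map_smul]
    rw [e3, inner_smul_left]
    simp; ring
  rw [h.fokkerPlanck t ht x, divQ_smul dm dHP,
    divP_smul (Y := fun y => gradQ (H t) y + gradP (H t) y) dm (dHQ.fun_add dHP),
    divP_add dHQ dHP,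
    divP_gradP hH, divQ_gradP hH, hlm, hP, hQ, hL]
  have hβ' : β⁻¹ * β = 1 := inv_mul_cancel₀ hβ.ne'
  have c1 := gradQ_density hβ (h.pos t ht x) dm
  have c2 := gradP_density hβ (h.pos t ht x) dm
  have c3 : inner ℝ (gradQ (m t) x) (gradP (microEntropy β m t) x)
      = inner ℝ (gradP (m t) x) (gradQ (microEntropy β m t) x) := by
    rw [c1, c2, inner_smul_left, inner_smul_left, real_inner_comm]
  simp only [inner_add_right]
  linear_combination -c3 - (inner ℝ (gradP (m t) x) (gradP (microEntropy β m t) x)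
      + m t x * lapP (microEntropy β m t) x) * hβ'

/-- The entropy equation is the Fokker-Planck equation. -/
theorem entropyResidual_eq_zero (hβ : 0 < β) {t : ℝ} (ht : t ∈ Set.Icc t₀ t₁) (x : Phase d) :
    entropyResidual β τ (microEntropy β m) (helmholtz β m H) t x = 0 := by
  have dm := (h.density_regular.space t).differentiable (by norm_num) x
  have hm := h.pos t ht x
  have h1 := h.continuity hβ ht x
  rw [gradQ_density hβ hm dm, gradP_density hβ hm dm] at h1
  have h2 : dt (microEntropy β m) t x = -((β * m t x)⁻¹ * dt m t x) :=
    (hasDerivAt_microEntropy hβ hm h.density_regular).deriv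
  have h3 : dt m t x = -(β * m t x) * dt (microEntropy β m) t x := by
    rw [h2]; field_simp
  rw [h3] at h1
  simp only [inner_smul_left, inner_add_right, conj_trivial] at h1
  simp only [entropyResidual, poissonBracket, wittenLaplacian, metricBracket]
  rw [real_inner_comm (gradQ (microEntropy β m t) x), real_inner_comm (gradP (microEntropy β m t) x)
    (gradQ (helmholtz β m H t) x)]
  have hβm : β * m t x ≠ 0 := by positivity
  apply mul_left_cancel₀ hβm
  have hβ' : β * β⁻¹ = 1 := mul_inv_cancel₀ hβ.ne'
  linear_combination (-1 : ℝ) * h1 + (m t x * lapP (helmholtz β m H t) x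
    - m t x * β * inner ℝ (gradP (microEntropy β m t) x) (gradP (helmholtz β m H t) x)) * hβ'

end IsLKTransition

end Kramers

/-! ### Lower bounds for the entropy production -/

section Marginals

variable {d : ℕ}

/-- The momentum integral of a Maxwellian state is its configuration marginal. -/
theorem integral_maxwellianState {β lam : ℝ} (hβ : 0 < β) (hlam : 0 < lam) (U g : Pos d → ℝ) :
    ∫ x : Phase d, g x.1 * maxwellianState β lam U x = ∫ q, g q * marginalState β U q := by
  have h1 : ∀ x : Phase d, g x.1 * maxwellianState β lam U x
      = (g x.1 * Real.exp (-β * U x.1))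
        * ((β / (2 * Real.pi * lam)) ^ d * Real.exp (-(β / (2 * lam ^ 2)) * ‖x.2‖ ^ 2)) := by
    intro x
    rw [maxwellianState, show -β * ‖x.2‖ ^ 2 / (2 * lam ^ 2) - β * U x.1
      = -(β / (2 * lam ^ 2)) * ‖x.2‖ ^ 2 + -β * U x.1 by ring, Real.exp_add]
    ring
  have hb : 0 < β / (2 * lam ^ 2) := by positivity
  have h2 : ∫ p : Pos d, (β / (2 * Real.pi * lam)) ^ d * Real.exp (-(β / (2 * lam ^ 2)) * ‖p‖ ^ 2)
      = (β / (2 * Real.pi)) ^ ((d : ℝ) / 2) := by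
    have hx : 0 ≤ β / (2 * Real.pi * lam) := by positivity
    rw [integral_const_mul, GaussianFourier.integral_rexp_neg_mul_sq_norm hb,
      finrank_euclideanSpace_fin, ← Real.rpow_natCast, show (d : ℝ) = 2 * (d / 2) by ring,
      Real.rpow_mul hx, show 2 * ((d : ℝ) / 2) / 2 = d / 2 by ring,
      ← Real.mul_rpow (by positivity) (by positivity)]
    congr 1
    rw [Real.rpow_two]
    field_simp
  simp only [h1]
  rw [Measure.volume_eq_prod, integral_prod_mul (fun q : Pos d => g q * Real.exp (-β * U q))
    (fun p : Pos d => (β / (2 * Real.pi * lam)) ^ d * Real.exp (-(β / (2 * lam ^ 2)) * ‖p‖ ^ 2)),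
    h2, ← integral_mul_const]
  refine integral_congr_ae (Eventually.of_forall fun q => ?_)
  simp only [marginalState]
  ring

/-- A nonnegative constant can be taken out of an iterated integral without measurability. -/
theorem lintegral_lintegral_const_mul {X : Type*} [MeasurableSpace X] {μ : Measure X}
    {ν : Measure ℝ} {c : ℝ} (hc : 0 ≤ c) (f : ℝ → X → ℝ) :
    ∫⁻ t, ∫⁻ x, ENNReal.ofReal (c * f t x) ∂μ ∂ν
      = ENNReal.ofReal c * ∫⁻ t, ∫⁻ x, ENNReal.ofReal (f t x) ∂μ ∂ν := by
  rw [← lintegral_const_mul' _ _ ENNReal.ofReal_ne_top]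
  refine lintegral_congr fun t => ?_
  rw [← lintegral_const_mul' _ _ ENNReal.ofReal_ne_top]
  exact lintegral_congr fun x => ENNReal.ofReal_mul hc

theorem gradient_add {f g : Pos d → ℝ} {x : Pos d} (hf : DifferentiableAt ℝ f x)
    (hg : DifferentiableAt ℝ g x) :
    gradient (fun y => f y + g y) x = gradient f x + gradient g x := by
  simp only [gradient, fderiv_fun_add hf hg, map_add]

theorem gradient_const_mul {f : Pos d → ℝ} {x : Pos d} (hf : DifferentiableAt ℝ f x) (c : ℝ) :
    gradient (fun y => c * f y) x = c • gradient f x := by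
  simp only [gradient, fderiv_const_mul hf, map_smul]

end Marginals

section KramersBound

variable {d : ℕ} {β τ t₀ t₁ : ℝ} {mo mf : Phase d → ℝ} {m H : ℝ → Phase d → ℝ}

/-- The current velocity `(J - G) ∂A / τ` of a Langevin-Kramers transition. -/
def kramersVelocity (β τ : ℝ) (m H : ℝ → Phase d → ℝ) (t : ℝ) (x : Phase d) : Phase d :=
  τ⁻¹ • (gradP (helmholtz β m H t) x,
    -(gradQ (helmholtz β m H t) x + gradP (helmholtz β m H t) x))

theorem IsC21.continuous_gradQ {f : ℝ → Phase d → ℝ} (hf : IsC21 f) :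
    Continuous fun z : ℝ × Phase d => gradQ (f z.1) z.2 := by
  simp only [gradQ_eq (hf.differentiable _ _)]
  exact (dualQ d).continuous.comp hf.continuous_fderiv

theorem IsC21.continuous_gradP {f : ℝ → Phase d → ℝ} (hf : IsC21 f) :
    Continuous fun z : ℝ × Phase d => gradP (f z.1) z.2 := by
  simp only [gradP_eq (hf.differentiable _ _)]
  exact (dualP d).continuous.comp hf.continuous_fderiv

theorem continuous_divQ {Y : Phase d → Pos d} (hY : ContDiff ℝ 1 Y) : Continuous (divQ Y) := by
  have h := hY.continuous_fderiv (by norm_num)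
  rw [show divQ Y = fun x => ∑ i, fderiv ℝ Y x (basisVec i, 0) i from
    funext fun x => divQ_eq_sum (hY.differentiable (by norm_num) x)]
  fun_prop

theorem continuous_divP {Y : Phase d → Pos d} (hY : ContDiff ℝ 1 Y) : Continuous (divP Y) := by
  have h := hY.continuous_fderiv (by norm_num)
  rw [show divP Y = fun x => ∑ i, fderiv ℝ Y x (0, basisVec i) i from
    funext fun x => divP_eq_sum (hY.differentiable (by norm_num) x)]
  fun_prop

namespace IsLKTransition

variable (h : IsLKTransition β τ t₀ t₁ mo mf m H)
include h

/-- The Fokker-Planck equation as a continuity equation: the diffusion is absorbed in the passage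
from `H` to `A`. -/
theorem isContinuityEq (hβ : 0 < β) (hτ : 0 < τ) :
    IsContinuityEq t₀ t₁ m (kramersVelocity β τ m H) := by
  intro t ht φ hφ hφc
  have hm := h.density_regular.space t
  have hA := h.contDiff_helmholtz hβ ht
  have cP := contDiff_gradP hA
  have cQ := contDiff_gradQ hA
  have cm : ContDiff ℝ 1 (m t) := hm.of_le (by norm_num)
  set Y : Phase d → Pos d := fun x => m t x • gradP (helmholtz β m H t) x with hY
  set Z : Phase d → Pos d := fun x =>
    m t x • (gradQ (helmholtz β m H t) x + gradP (helmholtz β m H t) x) with hZ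
  have cY : ContDiff ℝ 1 Y := cm.smul cP
  have cZ : ContDiff ℝ 1 Z := cm.smul (cQ.add cP)
  have e : ∀ x, dt m t x = τ⁻¹ * (-divQ Y x + divP Z x) := by
    intro x
    have dm := cm.differentiable (by norm_num) x
    have dP := cP.differentiable (by norm_num) x
    have dQ := cQ.differentiable (by norm_num) x
    rw [hY, hZ, divQ_smul dm dP,
      divP_smul (Y := fun y => gradQ (helmholtz β m H t) y + gradP (helmholtz β m H t) y) dm
        (dQ.fun_add dP), divP_add dQ dP, divP_gradP hA, divQ_gradP hA,
      eq_inv_mul_iff_mul_eq₀ hτ.ne', h.continuity hβ ht x]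
    ring
  have hφ' := hφ.continuous_fderiv (by norm_num)
  have hint : ∀ W : Phase d → ℝ, Continuous W → Integrable (fun x => φ x * W x) := fun W hW =>
    (hφ.continuous.mul hW).integrable_of_hasCompactSupport hφc.mul_right
  have hint' : ∀ W : Phase d → Phase d, Continuous W →
      Integrable (fun x => fderiv ℝ φ x (W x)) := fun W hW =>
    (hφ'.clm_apply hW).integrable_of_hasCompactSupport
      ((hφc.fderiv ℝ).mono fun x hx => by
        contrapose! hx; simp only [Function.mem_support, not_not] at hx ⊢; simp [hx])
  have e1 := integral_mul_divQ hφ hφc cY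
  have e2 := integral_mul_divP hφ hφc cZ
  calc ∫ x, φ x * dt m t x
      = ∫ x, τ⁻¹ * (φ x * divP Z x - φ x * divQ Y x) := by
        refine integral_congr_ae (Eventually.of_forall fun x => ?_)
        simp only [e]; ring
    _ = τ⁻¹ * (∫ x, fderiv ℝ φ x (Y x, 0) - fderiv ℝ φ x (0, Z x)) := by
        rw [integral_const_mul, integral_sub (hint _ (continuous_divP cZ))
          (hint _ (continuous_divQ cY)), e1, e2, integral_sub
          (hint' _ (cY.continuous.prodMk continuous_const))
          (hint' _ (continuous_const.prodMk cZ.continuous))]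
        ring
    _ = ∫ x, m t x * fderiv ℝ φ x (kramersVelocity β τ m H t x) := by
        rw [← integral_const_mul]
        refine integral_congr_ae (Eventually.of_forall fun x => ?_)
        simp only [kramersVelocity, hY, hZ]
        rw [← map_sub, ← smul_eq_mul, ← smul_eq_mul, ← map_smul, ← map_smul]
        congr 1
        simp only [Prod.mk_sub_mk, sub_zero, zero_sub, Prod.smul_mk, smul_neg]
        rw [smul_comm (m t x), smul_comm (m t x)]

theorem continuousOn_gradients (hβ : 0 < β) :
    ContinuousOn (fun z : ℝ × Phase d => gradQ (helmholtz β m H z.1) z.2)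
        (Set.Icc t₀ t₁ ×ˢ Set.univ) ∧
      ContinuousOn (fun z : ℝ × Phase d => gradP (helmholtz β m H z.1) z.2)
        (Set.Icc t₀ t₁ ×ˢ Set.univ) := by
  have hc : ContinuousOn (fun z : ℝ × Phase d => (β * m z.1 z.2)⁻¹) (Set.Icc t₀ t₁ ×ˢ Set.univ) :=
    (continuous_const.mul h.density_regular.continuous).continuousOn.inv₀ fun z hz =>
      (mul_pos hβ (h.pos z.1 hz.1 z.2)).ne'
  constructor
  · refine (h.hamiltonian_regular.continuous_gradQ.continuousOn.add
      (hc.smul h.density_regular.continuous_gradQ.continuousOn)).congr fun z hz => ?_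
    have hm := h.pos z.1 hz.1 z.2
    have dm := h.density_regular.differentiable z.1 z.2
    have dS := (h.contDiff_entropy hβ hz.1).differentiable (by norm_num) z.2
    have e : gradQ (helmholtz β m H z.1) z.2 = _ :=
      gradQ_sub (h.hamiltonian_regular.differentiable z.1 z.2) dS
    simp only [Pi.add_apply, Pi.smul_apply']
    rw [e, gradQ_density hβ hm dm, smul_smul, mul_neg, inv_mul_cancel₀ (by positivity),
      neg_one_smul, sub_eq_add_neg]
  · refine (h.hamiltonian_regular.continuous_gradP.continuousOn.add
      (hc.smul h.density_regular.continuous_gradP.continuousOn)).congr fun z hz => ?_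
    have hm := h.pos z.1 hz.1 z.2
    have dm := h.density_regular.differentiable z.1 z.2
    have dS := (h.contDiff_entropy hβ hz.1).differentiable (by norm_num) z.2
    have e : gradP (helmholtz β m H z.1) z.2 = _ :=
      gradP_sub (h.hamiltonian_regular.differentiable z.1 z.2) dS
    simp only [Pi.add_apply, Pi.smul_apply']
    rw [e, gradP_density hβ hm dm, smul_smul, mul_neg, inv_mul_cancel₀ (by positivity),
      neg_one_smul, sub_eq_add_neg]

end IsLKTransition

/-- A potential flow between the configuration marginals bounds the Langevin-Kramers entropy
production from below: only the position component of the current velocity is penalized. -/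
theorem IsPotentialFlow.le_lkEntropyProduction {ψ ρ : ℝ → Pos d → ℝ}
    (hf : IsPotentialFlow t₀ t₁ ψ ρ) (hβ : 0 < β) (hτ : 0 < τ) {lam : ℝ} (hlam : 0 < lam)
    {Uo Uf : Pos d → ℝ} (h0 : ρ t₀ = marginalState β Uo) (h1 : ρ t₁ = marginalState β Uf)
    (h : IsLKTransition β τ t₀ t₁ (maxwellianState β lam Uo) (maxwellianState β lam Uf) m H) :
    ENNReal.ofReal (β * τ * ((t₁ - t₀) * ∫ q, ‖gradient (ψ t₀) q‖ ^ 2 ∂(densityMeasure (ρ t₀))))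
      ≤ lkEntropyProduction β τ t₀ t₁ m H := by
  obtain ⟨cQ, cP⟩ := h.continuousOn_gradients hβ
  have hv : ContinuousOn (fun z : ℝ × Phase d => kramersVelocity β τ m H z.1 z.2)
      (Set.Icc t₀ t₁ ×ˢ Set.univ) := (cP.prodMk (cQ.add cP).neg).const_smul τ⁻¹
  have hcur : Integrable (fun z : ℝ × Phase d => m z.1 z.2 * ‖kramersVelocity β τ m H z.1 z.2‖)
      (spaceTime (Phase d) t₀ t₁) := by
    refine ((h.currentP_integrable.add h.currentQ_integrable).const_mul τ⁻¹).mono'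
      (aestronglyMeasurable_spaceTime
        (h.density_regular.continuous.continuousOn.mul hv.norm)) (ae_spaceTime fun t ht x => ?_)
    have hm := (h.pos t ht x).le
    simp only [kramersVelocity, Pi.add_apply, norm_smul, norm_mul, norm_norm, norm_inv,
      Real.norm_of_nonneg hm, Real.norm_of_nonneg hτ.le]
    have hn : ‖(gradP (helmholtz β m H t) x,
        -(gradQ (helmholtz β m H t) x + gradP (helmholtz β m H t) x))‖
        ≤ ‖gradQ (helmholtz β m H t) x‖ + ‖gradP (helmholtz β m H t) x‖ := by
      refine max_le (le_add_of_nonneg_left (norm_nonneg _)) ?_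
      rw [norm_neg]
      exact norm_add_le _ _
    calc m t x * (τ⁻¹ * ‖(gradP (helmholtz β m H t) x,
          -(gradQ (helmholtz β m H t) x + gradP (helmholtz β m H t) x))‖)
        ≤ m t x * (τ⁻¹ * (‖gradQ (helmholtz β m H t) x‖ + ‖gradP (helmholtz β m H t) x‖)) := by
          gcongr
      _ = τ⁻¹ * (m t x * ‖gradQ (helmholtz β m H t) x‖
          + m t x * ‖gradP (helmholtz β m H t) x‖) := by ring
  have l := hf.left_mem
  have r := hf.right_mem
  have key := hf.action_le (ContinuousLinearMap.fst ℝ (Pos d) (Pos d)) (h.isContinuityEq hβ hτ)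
    h.density_regular (fun t ht x => (h.pos t ht x).le) hv hcur
    (integrable_of_integral_eq_one (h.mass _ l)) (integrable_of_integral_eq_one (h.mass _ r))
    (fun g _ _ => by
      rw [h.initial, h0]; exact integral_maxwellianState hβ hlam Uo g)
    (fun g _ _ => by
      rw [h.final, h1]; exact integral_maxwellianState hβ hlam Uf g)
  have e : ∀ t (x : Phase d), m t x * ‖ContinuousLinearMap.fst ℝ (Pos d) (Pos d)
      (kramersVelocity β τ m H t x)‖ ^ 2
      = (τ⁻¹) ^ 2 * (m t x * ‖gradP (helmholtz β m H t) x‖ ^ 2) := by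
    intro t x
    simp only [kramersVelocity, ContinuousLinearMap.coe_fst', Prod.smul_fst, norm_smul, mul_pow,
      Real.norm_eq_abs, sq_abs]
    ring
  simp only [e] at key
  rw [lintegral_lintegral_const_mul (sq_nonneg _)] at key
  rw [lkEntropyProduction, ENNReal.ofReal_mul (by positivity)]
  refine (mul_le_mul' le_rfl key).trans_eq ?_
  rw [← mul_assoc, ← ENNReal.ofReal_mul (by positivity)]
  congr 2
  field_simp

end KramersBound

section SmoluchowskiBound

variable {d : ℕ} {β τ t₀ t₁ : ℝ} {ρo ρf : Pos d → ℝ} {ρ H : ℝ → Pos d → ℝ}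

namespace IsLSTransition

variable (h : IsLSTransition β τ t₀ t₁ ρo ρf ρ H)
include h

theorem gradient_lsHelmholtz {t : ℝ} (ht : t ∈ Set.Icc t₀ t₁) (q : Pos d) :
    gradient (lsHelmholtz β ρ H t) q
      = gradient (H t) q + (β⁻¹ * (ρ t q)⁻¹) • gradient (ρ t) q := by
  have hm := (h.pos t ht q).ne'
  have dρ := h.density_regular.differentiable t q
  have e := (dρ.hasFDerivAt.log hm).const_mul β⁻¹
  have e2 := gradient_add (h.potential_regular.differentiable t q) e.differentiableAt
  change gradient (fun y => H t y + β⁻¹ * Real.log (ρ t y)) q = _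
  rw [e2]
  congr 1
  rw [gradient, e.fderiv, smul_smul, map_smul]
  rfl

theorem continuousOn_gradient :
    ContinuousOn (fun z : ℝ × Pos d => gradient (lsHelmholtz β ρ H z.1) z.2)
      (Set.Icc t₀ t₁ ×ˢ Set.univ) := by
  refine (h.potential_regular.continuous_gradient.continuousOn.add
    ((continuousOn_const.mul (h.density_regular.continuous.continuousOn.inv₀ fun z hz =>
      (h.pos z.1 hz.1 z.2).ne')).smul h.density_regular.continuous_gradient.continuousOn)).congr
    fun z hz => h.gradient_lsHelmholtz hz.1 z.2

/-- The Fokker-Planck equation as a continuity equation with velocity `-∂(H + β⁻¹ log ρ) / τ`. -/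
theorem isContinuityEq (hτ : 0 < τ) :
    IsContinuityEq t₀ t₁ ρ (fun t q => -(τ⁻¹ • gradient (lsHelmholtz β ρ H t) q)) := by
  intro t ht φ hφ hφc
  have hρ := h.density_regular.space t
  have gH := h.potential_regular.contDiff_gradient t
  have gρ := h.density_regular.contDiff_gradient t
  have cρ : ContDiff ℝ 1 (ρ t) := hρ.of_le (by norm_num)
  set Y : Pos d → Pos d := fun y => ρ t y • gradient (H t) y + β⁻¹ • gradient (ρ t) y with hY
  have c1 : ContDiff ℝ 1 fun y => ρ t y • gradient (H t) y := cρ.smul gH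
  have c2 : ContDiff ℝ 1 fun y => β⁻¹ • gradient (ρ t) y := gρ.const_smul _
  have cY : ContDiff ℝ 1 Y := c1.add c2
  have e : ∀ x, dt ρ t x = τ⁻¹ * divergence Y x := by
    intro x
    have e0 : divergence (fun y => β⁻¹ • gradient (ρ t) y) x
        = β⁻¹ * Laplacian.laplacian (ρ t) x := by
      rw [divergence_smul (c := fun _ => β⁻¹) (differentiableAt_const _)
        (gρ.differentiable (by norm_num) x), divergence_gradient (hρ.differentiable_fderiv x)]
      simp
    rw [hY, divergence_add (c1.differentiable (by norm_num) x)
      (c2.differentiable (by norm_num) x), e0, eq_inv_mul_iff_mul_eq₀ hτ.ne', h.fokkerPlanck t ht x]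
  have e1 := integral_mul_divergence hφ hφc cY
  calc ∫ x, φ x * dt ρ t x = τ⁻¹ * ∫ x, φ x * divergence Y x := by
        rw [← integral_const_mul]
        refine integral_congr_ae (Eventually.of_forall fun x => ?_)
        simp only [e]; ring
    _ = _ := by
        rw [e1, mul_neg, ← neg_mul, ← integral_const_mul]
        refine integral_congr_ae (Eventually.of_forall fun x => ?_)
        have hx := (h.pos t ht x).ne'
        simp only [h.gradient_lsHelmholtz ht, hY, map_add, map_smul, map_neg, smul_eq_mul]
        field_simp

end IsLSTransition

/-- A potential flow between the same end points bounds the Langevin-Smoluchowski entropy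
production from below. -/
theorem IsPotentialFlow.le_lsEntropyProduction {ψ ρ' : ℝ → Pos d → ℝ}
    (hf : IsPotentialFlow t₀ t₁ ψ ρ') (hβ : 0 < β) (hτ : 0 < τ)
    (h : IsLSTransition β τ t₀ t₁ (ρ' t₀) (ρ' t₁) ρ H) :
    ENNReal.ofReal (β * τ * ((t₁ - t₀) * ∫ q, ‖gradient (ψ t₀) q‖ ^ 2 ∂(densityMeasure (ρ' t₀))))
      ≤ lsEntropyProduction β τ t₀ t₁ ρ H := by
  have cG := h.continuousOn_gradient
  have cρ := h.density_regular.continuous.continuousOn (s := Set.Icc t₀ t₁ ×ˢ Set.univ)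
  set v : ℝ → Pos d → Pos d := fun t q => -(τ⁻¹ • gradient (lsHelmholtz β ρ H t) q) with hvdef
  have hv : ContinuousOn (fun z : ℝ × Pos d => v z.1 z.2) (Set.Icc t₀ t₁ ×ˢ Set.univ) :=
    (cG.const_smul τ⁻¹).neg
  have e : ∀ t (x : Pos d), ρ t x * ‖v t x‖ ^ 2
      = (τ⁻¹) ^ 2 * (ρ t x * ‖gradient (lsHelmholtz β ρ H t) x‖ ^ 2) := by
    intro t x
    simp only [hvdef, norm_neg, norm_smul, mul_pow, Real.norm_eq_abs, sq_abs]
    ring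
  have hE : lsEntropyProduction β τ t₀ t₁ ρ H
      = ENNReal.ofReal (β * τ)
        * ∫⁻ t in Set.Icc t₀ t₁, ∫⁻ q, ENNReal.ofReal (ρ t q * ‖v t q‖ ^ 2) := by
    simp only [e]
    rw [lintegral_lintegral_const_mul (sq_nonneg _), lsEntropyProduction, ← mul_assoc,
      ← ENNReal.ofReal_mul (by positivity)]
    congr 2
    field_simp
  rw [hE, ENNReal.ofReal_mul (by positivity)]
  gcongr
  set I := ∫⁻ t in Set.Icc t₀ t₁, ∫⁻ q, ENNReal.ofReal (ρ t q * ‖v t q‖ ^ 2) with hI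
  by_cases htop : I = ⊤
  · rw [htop]; exact le_top
  have hfub : I = ∫⁻ z, ENNReal.ofReal (ρ z.1 z.2 * ‖v z.1 z.2‖ ^ 2) ∂(spaceTime (Pos d) t₀ t₁) :=
    (lintegral_prod (fun z : ℝ × Pos d => ENNReal.ofReal (ρ z.1 z.2 * ‖v z.1 z.2‖ ^ 2))
      (aestronglyMeasurable_spaceTime (cρ.mul (hv.norm.pow 2))).aemeasurable.ennreal_ofReal).symm
  have iE : Integrable (fun z : ℝ × Pos d => ρ z.1 z.2 * ‖v z.1 z.2‖ ^ 2)
      (spaceTime (Pos d) t₀ t₁) := by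
    refine ⟨aestronglyMeasurable_spaceTime (cρ.mul (hv.norm.pow 2)), ?_⟩
    rw [hasFiniteIntegral_iff_ofReal (ae_spaceTime fun t ht x =>
      mul_nonneg (h.pos t ht x).le (sq_nonneg _)), ← hfub]
    exact lt_top_iff_ne_top.2 htop
  have iρ : Integrable (fun z : ℝ × Pos d => ρ z.1 z.2) (spaceTime (Pos d) t₀ t₁) := by
    refine ⟨aestronglyMeasurable_spaceTime cρ, ?_⟩
    rw [hasFiniteIntegral_iff_ofReal (ae_spaceTime fun t ht x => (h.pos t ht x).le),
      lintegral_prod (fun z : ℝ × Pos d => ENNReal.ofReal (ρ z.1 z.2))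
        (aestronglyMeasurable_spaceTime cρ).aemeasurable.ennreal_ofReal]
    calc ∫⁻ t in Set.Icc t₀ t₁, ∫⁻ q, ENNReal.ofReal (ρ t q)
        = ∫⁻ _ in Set.Icc t₀ t₁, 1 := by
          refine setLIntegral_congr_fun measurableSet_Icc fun t ht => ?_
          rw [← ofReal_integral_eq_lintegral_ofReal (integrable_of_integral_eq_one (h.mass t ht))
            (Eventually.of_forall fun x => (h.pos t ht x).le), h.mass t ht, ENNReal.ofReal_one]
      _ < ⊤ := by simp
  have hcur : Integrable (fun z : ℝ × Pos d => ρ z.1 z.2 * ‖v z.1 z.2‖)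
      (spaceTime (Pos d) t₀ t₁) := by
    refine (iρ.add iE).mono' (aestronglyMeasurable_spaceTime (cρ.mul hv.norm))
      (ae_spaceTime fun t ht x => ?_)
    have hm := (h.pos t ht x).le
    simp only [Pi.add_apply, norm_mul, norm_norm, Real.norm_of_nonneg hm]
    nlinarith [sq_nonneg (‖v t x‖ - 1), mul_nonneg hm (sq_nonneg (‖v t x‖ - 1)),
      mul_nonneg hm (sq_nonneg ‖v t x‖)]
  have l := hf.left_mem
  have r := hf.right_mem
  have key := hf.action_le (ContinuousLinearMap.id ℝ (Pos d)) (h.isContinuityEq hτ)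
    h.density_regular (fun t ht x => (h.pos t ht x).le) hv hcur
    (integrable_of_integral_eq_one (h.mass _ l)) (integrable_of_integral_eq_one (h.mass _ r))
    (fun g _ _ => by rw [h.initial]; rfl) (fun g _ _ => by rw [h.final]; rfl)
  exact key

end SmoluchowskiBound

/-! ### The cell problem as a potential flow -/

section CellProblem

variable {d : ℕ} {β τ t₀ t₁ : ℝ} {Uo Uf : Pos d → ℝ} {a s : ℝ → Pos d → ℝ}

theorem cellDensity_pos (hβ : 0 < β) (s : ℝ → Pos d → ℝ) (t : ℝ) (q : Pos d) :
    0 < cellDensity β s t q := by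
  unfold cellDensity; positivity

theorem IsC21.cellDensity (hs : IsC21 s) : IsC21 (cellDensity β s) :=
  hs.comp_left (Θ := fun y => (2 * Real.pi * β) ^ ((d : ℝ) / 2) * Real.exp (-β * y)) (by fun_prop)

theorem hasFDerivAt_cellDensity (hs : IsC21 s) (t : ℝ) (q : Pos d) :
    HasFDerivAt (cellDensity β s t) ((-β * cellDensity β s t q) • fderiv ℝ (s t) q) q := by
  have h := (((hs.differentiable t q).hasFDerivAt.const_mul (-β)).exp).const_mul
    ((2 * Real.pi * β) ^ ((d : ℝ) / 2))
  refine HasFDerivAt.congr_fderiv (f := cellDensity β s t) h ?_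
  rw [smul_smul, smul_smul]
  congr 1
  simp only [cellDensity]; ring

theorem gradient_cellDensity (hs : IsC21 s) (t : ℝ) (q : Pos d) :
    gradient (cellDensity β s t) q = (-β * cellDensity β s t q) • gradient (s t) q := by
  rw [gradient, (hasFDerivAt_cellDensity hs t q).fderiv, map_smul]; rfl

theorem dt_cellDensity (hs : IsC21 s) (t : ℝ) (q : Pos d) :
    dt (cellDensity β s) t q = -β * cellDensity β s t q * dt s t q := by
  have h := (((hs.hasDerivAt_time t q).const_mul (-β)).exp).const_mul
    ((2 * Real.pi * β) ^ ((d : ℝ) / 2))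
  refine (HasDerivAt.congr_deriv (f := fun s' => cellDensity β s s' q) h ?_).deriv
  simp only [cellDensity]; ring

theorem cellDensity_eq_marginalState (hβ : 0 < β) {U : Pos d → ℝ} {t : ℝ}
    (h : ∀ q, s t q = U q + d / β * Real.log (2 * Real.pi)) :
    cellDensity β s t = marginalState β U := by
  funext q
  have hp : (0 : ℝ) < 2 * Real.pi := by positivity
  have e1 : (2 * Real.pi * β) ^ ((d : ℝ) / 2)
      = (β / (2 * Real.pi)) ^ ((d : ℝ) / 2) * (2 * Real.pi) ^ (d : ℝ) := by
    have : (2 * Real.pi) ^ (d : ℝ) = ((2 * Real.pi) ^ (2 : ℝ)) ^ ((d : ℝ) / 2) := by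
      rw [← Real.rpow_mul hp.le]; congr 1; ring
    rw [this, ← Real.mul_rpow (by positivity) (by positivity), Real.rpow_two]
    congr 1
    field_simp
  have e2 : Real.exp (-β * (U q + d / β * Real.log (2 * Real.pi)))
      = Real.exp (-β * U q) * ((2 * Real.pi) ^ (d : ℝ))⁻¹ := by
    rw [Real.rpow_def_of_pos hp, ← Real.exp_neg, ← Real.exp_add]
    congr 1
    field_simp
    ring
  have hne : (2 * Real.pi) ^ (d : ℝ) ≠ 0 := (Real.rpow_pos_of_pos hp _).ne'
  rw [cellDensity, marginalState, h, e1, e2]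
  field_simp

/-- The velocity potential `-a / τ` of a solution of the cell problem. -/
def cellPotential (τ : ℝ) (a : ℝ → Pos d → ℝ) (t : ℝ) (q : Pos d) : ℝ := -τ⁻¹ * a t q

theorem gradient_cellPotential (ha : IsC21 a) (t : ℝ) (q : Pos d) :
    gradient (cellPotential τ a t) q = -τ⁻¹ • gradient (a t) q :=
  gradient_const_mul (ha.differentiable t q) _

theorem laplacian_const_mul {f : Pos d → ℝ} (hf : ContDiff ℝ 2 f) (c : ℝ) (q : Pos d) :
    Laplacian.laplacian (fun y => c * f y) q = c * Laplacian.laplacian f q :=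
  InnerProductSpace.laplacian_smul c hf.contDiffAt

namespace IsCellSolution

variable (h : IsCellSolution β τ t₀ t₁ Uo Uf a s) (ha : IsC21 a) (hs : IsC21 s)
include h ha hs

/-- The entropy equation of the cell problem is the continuity equation of its density. -/
theorem isTransported (hβ : 0 < β) (hτ : 0 < τ) :
    IsTransported t₀ t₁ (cellPotential τ a) (cellDensity β s) := by
  intro t ht q
  have h1 := h.entropy t ht q
  have e : Laplacian.laplacian (cellPotential τ a t) q = -τ⁻¹ * Laplacian.laplacian (a t) q :=
    laplacian_const_mul (ha.space t) _ q
  rw [dt_cellDensity hs, (hasFDerivAt_cellDensity hs t q).fderiv, e, gradient_cellPotential ha,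
    _root_.smul_apply, ← inner_gradient_left, inner_smul_right, smul_eq_mul,
    real_inner_comm]
  have h2 : dt s t q = τ⁻¹ * (inner ℝ (gradient (a t) q) (gradient (s t) q)
      - β⁻¹ * Laplacian.laplacian (a t) q) := by
    rw [eq_inv_mul_iff_mul_eq₀ hτ.ne']; linarith
  rw [h2]
  field_simp
  ring

/-- The value equation of the cell problem is the Hamilton-Jacobi equation of the velocity
potential. -/
theorem isPotentialFlow (hβ : 0 < β) (hτ : 0 < τ) (ht : t₀ < t₁)
    (hmass : ∫ q, marginalState β Uo q = 1)
    (hmom_o : Integrable (fun q => ‖q‖ ^ 2 * marginalState β Uo q))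
    (hmom_f : Integrable (fun q => ‖q‖ ^ 2 * marginalState β Uf q)) :
    IsPotentialFlow t₀ t₁ (cellPotential τ a) (cellDensity β s) where
  lt := ht
  potential := by
    refine ⟨ha.const_mul _, fun t ht x => ?_⟩
    have h1 := h.value t ht x
    have e : dt (cellPotential τ a) t x = -τ⁻¹ * dt a t x :=
      ((ha.hasDerivAt_time t x).const_mul _).deriv
    rw [gradient_cellPotential ha, e, norm_smul, mul_pow, Real.norm_eq_abs, sq_abs]
    field_simp
    linarith
  density_regular := hs.cellDensity
  transported := h.isTransported ha hs hβ hτ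
  pos t _ x := cellDensity_pos hβ s t x
  mass := by rw [cellDensity_eq_marginalState hβ h.initial]; exact hmass
  moment_initial := by rw [cellDensity_eq_marginalState hβ h.initial]; exact hmom_o
  moment_final := by rw [cellDensity_eq_marginalState hβ h.final]; exact hmom_f

theorem isLSTransition (hβ : 0 < β) (hτ : 0 < τ)
    (hf : IsPotentialFlow t₀ t₁ (cellPotential τ a) (cellDensity β s)) :
    IsLSTransition β τ t₀ t₁ (marginalState β Uo) (marginalState β Uf) (cellDensity β s)
      (fun t q => a t q + s t q) where
  density_regular := hs.cellDensity
  potential_regular := ha.add hs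
  pos t _ x := cellDensity_pos hβ s t x
  mass t ht := hf.mass_eq ht
  fokkerPlanck t ht q := by
    have hρ : IsC21 (cellDensity β s) := hs.cellDensity
    have dρ := hρ.differentiable t q
    have da := (ha.contDiff_gradient t).differentiable (by norm_num) q
    have ds := (hs.contDiff_gradient t).differentiable (by norm_num) q
    have e1 : gradient (fun y => a t y + s t y) = fun y => gradient (a t) y + gradient (s t) y :=
      funext fun y => gradient_add (ha.differentiable t y) (hs.differentiable t y)
    have e2 : Laplacian.laplacian (cellDensity β s t) q
        = -β * (fderiv ℝ (cellDensity β s t) q (gradient (s t) q)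
          + cellDensity β s t q * Laplacian.laplacian (s t) q) := by
      have e3 : gradient (cellDensity β s t)
          = fun y => (-β * cellDensity β s t y) • gradient (s t) y :=
        funext fun y => gradient_cellDensity hs t y
      rw [← divergence_gradient ((hρ.space t).differentiable_fderiv q), e3,
        divergence_smul (dρ.const_mul _) ds, fderiv_const_mul dρ,
        divergence_gradient ((hs.space t).differentiable_fderiv q),
        _root_.smul_apply, smul_eq_mul]
      ring
    have e4 : Laplacian.laplacian (cellPotential τ a t) q = -τ⁻¹ * Laplacian.laplacian (a t) q :=
      laplacian_const_mul (ha.space t) _ q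
    rw [e1, divergence_smul (X := fun y => gradient (a t) y + gradient (s t) y) dρ (da.fun_add ds),
      divergence_add da ds, e2, hf.transported t ht q, e4, gradient_cellPotential ha, map_add,
      map_smul, divergence_gradient ((ha.space t).differentiable_fderiv q),
      divergence_gradient ((hs.space t).differentiable_fderiv q), smul_eq_mul]
    field_simp
    ring
  initial := cellDensity_eq_marginalState hβ h.initial
  final := cellDensity_eq_marginalState hβ h.final

omit h ha hs in
theorem gradient_lsHelmholtz (hβ : 0 < β) (ha : IsC21 a) (t : ℝ) (q : Pos d) :
    gradient (lsHelmholtz β (cellDensity β s) (fun t q => a t q + s t q) t) q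
      = gradient (a t) q := by
  have e : lsHelmholtz β (cellDensity β s) (fun t q => a t q + s t q) t
      = fun y => a t y + β⁻¹ * Real.log ((2 * Real.pi * β) ^ ((d : ℝ) / 2)) := by
    funext y
    rw [lsHelmholtz, cellDensity, Real.log_mul (by positivity) (Real.exp_pos _).ne', Real.log_exp]
    field_simp
    ring
  rw [e, gradient_add (ha.differentiable t q) (differentiableAt_const _)]
  simp [gradient]

omit h hs in
/-- The kinetic action of the cell problem. -/
theorem lintegral_energy (hτ : 0 < τ) (hβ : 0 < β)
    (hf : IsPotentialFlow t₀ t₁ (cellPotential τ a) (cellDensity β s)) :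
    ENNReal.ofReal (β / τ) * (∫⁻ t in Set.Icc t₀ t₁, ∫⁻ q,
        ENNReal.ofReal (cellDensity β s t q * ‖gradient (a t) q‖ ^ 2))
      = ENNReal.ofReal (β * τ * ((t₁ - t₀) * ∫ q, ‖gradient (cellPotential τ a t₀) q‖ ^ 2
          ∂(densityMeasure (cellDensity β s t₀)))) := by
  have h0 : 0 ≤ t₁ - t₀ := sub_nonneg.2 hf.lt.le
  have e : ∀ t q, cellDensity β s t q * ‖gradient (a t) q‖ ^ 2
      = τ ^ 2 * (cellDensity β s t q * ‖gradient (cellPotential τ a t) q‖ ^ 2) := by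
    intro t q
    rw [gradient_cellPotential ha, norm_smul, mul_pow, Real.norm_eq_abs, sq_abs]
    field_simp
  simp only [e]
  rw [lintegral_lintegral_const_mul (sq_nonneg τ), setLIntegral_congr_fun measurableSet_Icc
    (fun t ht => hf.lintegral_sq_gradient ht), setLIntegral_const, Real.volume_Icc,
    ← ENNReal.ofReal_mul (integral_nonneg fun q => sq_nonneg _),
    ← ENNReal.ofReal_mul (sq_nonneg _), ← ENNReal.ofReal_mul (by positivity)]
  congr 1
  field_simp

theorem lsMinimum_eq (hβ : 0 < β) (hτ : 0 < τ)
    (hf : IsPotentialFlow t₀ t₁ (cellPotential τ a) (cellDensity β s)) :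
    lsMinimum β τ t₀ t₁ (marginalState β Uo) (marginalState β Uf)
      = ENNReal.ofReal (β * τ * ((t₁ - t₀) * ∫ q, ‖gradient (cellPotential τ a t₀) q‖ ^ 2
          ∂(densityMeasure (cellDensity β s t₀)))) := by
  refine le_antisymm ?_ ?_
  · have h1 : lsMinimum β τ t₀ t₁ (marginalState β Uo) (marginalState β Uf)
        ≤ lsEntropyProduction β τ t₀ t₁ (cellDensity β s) (fun t q => a t q + s t q) :=
      iInf_le_of_le _ (iInf_le_of_le _ (iInf_le _ (h.isLSTransition ha hs hβ hτ hf)))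
    refine h1.trans_eq ?_
    rw [← lintegral_energy ha hτ hβ hf, lsEntropyProduction]
    simp only [gradient_lsHelmholtz hβ ha]
  · refine le_iInf fun ρ => le_iInf fun H => le_iInf fun hH => ?_
    refine hf.le_lsEntropyProduction hβ hτ ?_
    rw [cellDensity_eq_marginalState hβ h.initial, cellDensity_eq_marginalState hβ h.final]
    exact hH

theorem lsMinimum_le_lkMinimum (hβ : 0 < β) (hτ : 0 < τ)
    (hf : IsPotentialFlow t₀ t₁ (cellPotential τ a) (cellDensity β s)) {lam : ℝ} (hlam : 0 < lam) :
    lsMinimum β τ t₀ t₁ (marginalState β Uo) (marginalState β Uf)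
      ≤ lkMinimum β τ t₀ t₁ (maxwellianState β lam Uo) (maxwellianState β lam Uf) := by
  rw [h.lsMinimum_eq ha hs hβ hτ hf]
  exact le_iInf fun m => le_iInf fun H => le_iInf fun hH =>
    hf.le_lkEntropyProduction hβ hτ hlam (cellDensity_eq_marginalState hβ h.initial)
      (cellDensity_eq_marginalState hβ h.final) hH

omit ha hs in
theorem transportCost_eq (hβ : 0 < β)
    (hf : IsPotentialFlow t₀ t₁ (cellPotential τ a) (cellDensity β s)) :
    transportCost (densityMeasure (marginalState β Uo)) (densityMeasure (marginalState β Uf))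
      = ENNReal.ofReal ((t₁ - t₀) ^ 2 * ∫ q, ‖gradient (cellPotential τ a t₀) q‖ ^ 2
          ∂(densityMeasure (cellDensity β s t₀))) := by
  rw [← cellDensity_eq_marginalState hβ h.initial, ← cellDensity_eq_marginalState hβ h.final]
  exact hf.transportCost_eq

/-- Every solution of the cell problem is an optimal Langevin-Smoluchowski transition and solves
the Monge-Ampère-Kantorovich transport problem. -/
theorem monge_ampere_kantorovich (hβ : 0 < β) (hτ : 0 < τ)
    (hf : IsPotentialFlow t₀ t₁ (cellPotential τ a) (cellDensity β s)) :
      IsLSTransition β τ t₀ t₁ (marginalState β Uo) (marginalState β Uf) (cellDensity β s)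
        (fun t q => a t q + s t q) ∧
      ENNReal.ofReal (β / τ) * (∫⁻ t in Set.Icc t₀ t₁, ∫⁻ q,
          ENNReal.ofReal (cellDensity β s t q * ‖gradient (a t) q‖ ^ 2))
        = lsMinimum β τ t₀ t₁ (marginalState β Uo) (marginalState β Uf) ∧
      lsMinimum β τ t₀ t₁ (marginalState β Uo) (marginalState β Uf) ≠ ⊤ ∧
      lsMinimum β τ t₀ t₁ (marginalState β Uo) (marginalState β Uf)
        = ENNReal.ofReal (β * τ / (t₁ - t₀)) * transportCost (densityMeasure (marginalState β Uo))
            (densityMeasure (marginalState β Uf)) ∧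
      (∀ t ∈ Set.Icc t₀ t₁, (densityMeasure (marginalState β Uo)).map
          (fun q => q - ((t - t₀) / τ) • gradient (a t₀) q) = densityMeasure (cellDensity β s t)) ∧
      ∫⁻ q, ENNReal.ofReal (‖((t₁ - t₀) / τ) • gradient (a t₀) q‖ ^ 2)
          ∂(densityMeasure (marginalState β Uo))
        = transportCost (densityMeasure (marginalState β Uo))
            (densityMeasure (marginalState β Uf)) ∧
      ConvexOn ℝ Set.univ (fun q => ‖q‖ ^ 2 / 2 - (t₁ - t₀) / τ * a t₀ q) ∧
      (∀ lam > 0, lsMinimum β τ t₀ t₁ (marginalState β Uo) (marginalState β Uf)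
        ≤ lkMinimum β τ t₀ t₁ (maxwellianState β lam Uo) (maxwellianState β lam Uf)) := by
  have h0 : 0 < t₁ - t₀ := sub_pos.2 hf.lt
  refine ⟨h.isLSTransition ha hs hβ hτ hf, ?_, ?_, ?_, ?_, ?_, ?_,
    fun lam hlam => h.lsMinimum_le_lkMinimum ha hs hβ hτ hf hlam⟩
  · rw [h.lsMinimum_eq ha hs hβ hτ hf, lintegral_energy ha hτ hβ hf]
  · rw [h.lsMinimum_eq ha hs hβ hτ hf]; exact ENNReal.ofReal_ne_top
  · rw [h.lsMinimum_eq ha hs hβ hτ hf, h.transportCost_eq hβ hf,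
      ← ENNReal.ofReal_mul (by positivity)]
    congr 1
    field_simp
  · intro t ht
    rw [← cellDensity_eq_marginalState hβ h.initial, ← hf.map_characteristic ht]
    congr 1
    funext q
    rw [characteristic, gradient_cellPotential ha, smul_smul, sub_eq_add_neg, ← neg_smul]
    congr 2
    ring
  · rw [h.transportCost_eq hβ hf, ← cellDensity_eq_marginalState hβ h.initial,
      ← integral_const_mul, ofReal_integral_eq_lintegral_ofReal
        (hf.integrable_sq_gradient.const_mul _) (Eventually.of_forall fun q => by positivity)]
    refine lintegral_congr fun q => ?_
    rw [gradient_cellPotential ha, norm_smul, norm_smul, mul_pow, mul_pow, Real.norm_eq_abs,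
      Real.norm_eq_abs, sq_abs, sq_abs]
    congr 1
    ring
  · have hc := hf.potential.convexOn hf.lt
    convert hc using 2
    rw [cellPotential]
    ring

end IsCellSolution

end CellProblem

/-! ### Second-order expansions in the scale parameter -/

section Expansions

variable {E : Type*} [NormedAddCommGroup E] [NormedSpace ℝ E]

/-- `f lam = a₀ + lam a₁ + lam² a₂ + o(lam²)` as `lam ↓ 0`. -/
def HasExpansion (f : ℝ → E) (a₀ a₁ a₂ : E) : Prop :=
  (fun l : ℝ => f l - (a₀ + l • a₁ + l ^ 2 • a₂)) =o[𝓝[>] 0] (fun l : ℝ => l ^ 2)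

namespace HasExpansion

variable {f g : ℝ → E} {a₀ a₁ a₂ b₀ b₁ b₂ : E}

theorem congr' (hf : HasExpansion f a₀ a₁ a₂) (h : f =ᶠ[𝓝[>] 0] g) : HasExpansion g a₀ a₁ a₂ :=
  IsLittleO.congr' hf (h.mono fun l hl => by simp only [hl]) EventuallyEq.rfl

theorem of_eq (hf : HasExpansion f a₀ a₁ a₂) (h : ∀ l, f l = g l) (h₀ : a₀ = b₀) (h₁ : a₁ = b₁)
    (h₂ : a₂ = b₂) : HasExpansion g b₀ b₁ b₂ := by
  rw [← h₀, ← h₁, ← h₂]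
  exact hf.congr' (Eventually.of_forall h)

theorem add (hf : HasExpansion f a₀ a₁ a₂) (hg : HasExpansion g b₀ b₁ b₂) :
    HasExpansion (fun l => f l + g l) (a₀ + b₀) (a₁ + b₁) (a₂ + b₂) :=
  (IsLittleO.add hf hg).congr_left fun l => by simp only [smul_add]; abel

theorem sub (hf : HasExpansion f a₀ a₁ a₂) (hg : HasExpansion g b₀ b₁ b₂) :
    HasExpansion (fun l => f l - g l) (a₀ - b₀) (a₁ - b₁) (a₂ - b₂) :=
  (IsLittleO.sub hf hg).congr_left fun l => by simp only [smul_sub]; abel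

theorem const_mul {f : ℝ → ℝ} {a₀ a₁ a₂ : ℝ} (hf : HasExpansion f a₀ a₁ a₂) (c : ℝ) :
    HasExpansion (fun l => c * f l) (c * a₀) (c * a₁) (c * a₂) :=
  (IsLittleO.const_mul_left hf c).congr_left fun l => by simp only [smul_eq_mul]; ring

theorem tendsto_sq : Tendsto (fun l : ℝ => l ^ 2) (𝓝[>] 0) (𝓝 0) := by
  have : Tendsto (fun l : ℝ => l ^ 2) (𝓝 0) (𝓝 (0 ^ 2)) := (continuous_pow 2).tendsto 0
  rw [zero_pow two_ne_zero] at this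
  exact this.mono_left nhdsWithin_le_nhds

theorem tendsto_id : Tendsto (fun l : ℝ => l) (𝓝[>] 0) (𝓝 0) :=
  tendsto_nhdsWithin_of_tendsto_nhds Filter.tendsto_id

theorem tendsto_poly (a₀ a₁ a₂ : E) :
    Tendsto (fun l : ℝ => a₀ + l • a₁ + l ^ 2 • a₂) (𝓝[>] 0) (𝓝 a₀) := by
  simpa using (tendsto_const_nhds.add (tendsto_id.smul_const a₁)).add (tendsto_sq.smul_const a₂)

theorem tendsto (hf : HasExpansion f a₀ a₁ a₂) : Tendsto f (𝓝[>] 0) (𝓝 a₀) := by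
  have h1 := (IsLittleO.trans_tendsto hf tendsto_sq).add (tendsto_poly a₀ a₁ a₂)
  simpa using h1

theorem pow_isLittleO {n : ℕ} (hn : 2 < n) :
    (fun l : ℝ => l ^ n) =o[𝓝[>] 0] (fun l : ℝ => l ^ 2) :=
  (isLittleO_pow_pow hn).mono nhdsWithin_le_nhds

theorem smul_self (hf : HasExpansion f a₀ a₁ a₂) : HasExpansion (fun l => l • f l) 0 a₀ a₁ := by
  have h1 : (fun l : ℝ => l • (f l - (a₀ + l • a₁ + l ^ 2 • a₂))) =o[𝓝[>] 0]
      (fun l : ℝ => (1 : ℝ) • l ^ 2) :=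
    IsBigO.smul_isLittleO (tendsto_id.isBigO_one ℝ) hf
  have h2 : (fun l : ℝ => l ^ 3 • a₂) =o[𝓝[>] 0] (fun l : ℝ => l ^ 2) := by
    have := (pow_isLittleO (n := 3) (by norm_num)).smul_isBigO
      (isBigO_const_const a₂ (one_ne_zero (α := ℝ)) (𝓝[>] (0 : ℝ)))
    simpa using this
  refine ((h1.congr_right fun l => one_smul _ _).add h2).congr_left fun l => ?_
  module

theorem sq_mul {f : ℝ → ℝ} {a₀ a₁ a₂ : ℝ} (hf : HasExpansion f a₀ a₁ a₂) :
    HasExpansion (fun l => l ^ 2 * f l) 0 0 a₀ :=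
  hf.smul_self.smul_self.congr' (Eventually.of_forall fun l => by simp only [smul_eq_mul]; ring)

theorem inner {F : Type*} [NormedAddCommGroup F] [InnerProductSpace ℝ F] {f g : ℝ → F}
    {a₀ a₁ a₂ b₀ b₁ b₂ : F}
    (hf : HasExpansion f a₀ a₁ a₂) (hg : HasExpansion g b₀ b₁ b₂) :
    HasExpansion (fun l => inner ℝ (f l) (g l)) (inner ℝ a₀ b₀) (inner ℝ a₀ b₁ + inner ℝ a₁ b₀)
      (inner ℝ a₀ b₂ + inner ℝ a₁ b₁ + inner ℝ a₂ b₀) := by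
  set P : ℝ → F := fun l => a₀ + l • a₁ + l ^ 2 • a₂ with hP
  set Q : ℝ → F := fun l => b₀ + l • b₁ + l ^ 2 • b₂ with hQ
  have aux : ∀ {u v : ℝ → F}, u =o[𝓝[>] 0] (fun l : ℝ => l ^ 2) → ∀ {c : F},
      Tendsto v (𝓝[>] 0) (𝓝 c) →
      (fun l => (Inner.inner ℝ (u l) (v l) : ℝ)) =o[𝓝[>] 0] (fun l : ℝ => l ^ 2) := by
    intro u v hu c hv
    have h1 : (fun l => (Inner.inner ℝ (u l) (v l) : ℝ)) =O[𝓝[>] 0] fun l => ‖u l‖ * ‖v l‖ :=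
      IsBigO.of_bound 1 (Eventually.of_forall fun l => by
        rw [one_mul, norm_mul, norm_norm, norm_norm]; exact norm_inner_le_norm _ _)
    have h2 := hu.norm_left.mul_isBigO (hv.isBigO_one ℝ).norm_left
    simp only [mul_one] at h2
    exact h1.trans_isLittleO h2
  have h1 := aux hf hg.tendsto
  have h2 := aux hg (tendsto_poly a₀ a₁ a₂)
  have h3 : (fun l : ℝ => l ^ 3 * (Inner.inner ℝ a₁ b₂ + Inner.inner ℝ a₂ b₁))
      =o[𝓝[>] 0] (fun l : ℝ => l ^ 2) := by
    have := (pow_isLittleO (n := 3) (by norm_num)).mul_isBigO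
      (isBigO_const_const (Inner.inner ℝ a₁ b₂ + Inner.inner ℝ a₂ b₁ : ℝ) (one_ne_zero (α := ℝ))
        (𝓝[>] (0 : ℝ)))
    simpa using this
  have h4 : (fun l : ℝ => l ^ 4 * (Inner.inner ℝ a₂ b₂ : ℝ))
      =o[𝓝[>] 0] (fun l : ℝ => l ^ 2) := by
    have := (pow_isLittleO (n := 4) (by norm_num)).mul_isBigO
      (isBigO_const_const (Inner.inner ℝ a₂ b₂ : ℝ) (one_ne_zero (α := ℝ)) (𝓝[>] (0 : ℝ)))
    simpa using this
  refine (((h1.add h2).add h3).add h4).congr_left fun l => ?_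
  simp only [inner_sub_left, inner_sub_right, inner_add_left, inner_add_right,
    real_inner_smul_left, real_inner_smul_right, smul_eq_mul, real_inner_comm a₀,
    real_inner_comm a₁, real_inner_comm a₂]
  ring

/-- A residual that tends to zero has vanishing coefficients up to the order `lam²`, after
multiplication with `lam²`. -/
theorem of_tendsto_zero {r : ℝ → ℝ} (hr : Tendsto r (𝓝[>] 0) (𝓝 0)) :
    HasExpansion (fun l => l ^ 2 * r l) 0 0 0 := by
  have h := (isBigO_refl (fun l : ℝ => l ^ 2) (𝓝[>] 0)).mul_isLittleO
    ((isLittleO_one_iff ℝ).2 hr)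
  simpa [HasExpansion] using h

theorem tendsto_zero {r : ℝ → ℝ} (h : HasExpansion (fun l => l ^ 2 * r l) 0 0 0) :
    Tendsto r (𝓝[>] 0) (𝓝 0) := by
  have h1 : (fun l => l ^ 2 * r l) =o[𝓝[>] 0] (fun l : ℝ => l ^ 2) := by
    simpa [HasExpansion] using h
  refine h1.tendsto_div_nhds_zero.congr' ?_
  filter_upwards [self_mem_nhdsWithin] with l hl
  have : l ≠ 0 := (Set.mem_Ioi.1 hl).ne'
  field_simp

theorem unique {f : ℝ → ℝ} {a₀ a₁ a₂ b₀ b₁ b₂ : ℝ} (hf : HasExpansion f a₀ a₁ a₂)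
    (hg : HasExpansion f b₀ b₁ b₂) : a₀ = b₀ ∧ a₁ = b₁ ∧ a₂ = b₂ := by
  have h := (IsLittleO.sub hg hf).tendsto_div_nhds_zero
  have h0 : a₀ - b₀ = 0 := by
    have h2 := h.mul tendsto_sq
    rw [mul_zero] at h2
    refine tendsto_nhds_unique ((tendsto_poly (a₀ - b₀) (a₁ - b₁) (a₂ - b₂)).congr' ?_) h2
    filter_upwards [self_mem_nhdsWithin] with l hl
    have : l ≠ 0 := (Set.mem_Ioi.1 hl).ne'
    field_simp; simp only [smul_eq_mul]; ring
  have h1 : a₁ - b₁ = 0 := by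
    have h2 := h.mul tendsto_id
    rw [mul_zero] at h2
    refine tendsto_nhds_unique ((tendsto_poly (a₁ - b₁) (a₂ - b₂) 0).congr' ?_) h2
    filter_upwards [self_mem_nhdsWithin] with l hl
    have : l ≠ 0 := (Set.mem_Ioi.1 hl).ne'
    field_simp; simp only [smul_eq_mul]; linear_combination (-1 : ℝ) * h0
  refine ⟨sub_eq_zero.1 h0, sub_eq_zero.1 h1, sub_eq_zero.1 ?_⟩
  refine tendsto_nhds_unique ((tendsto_poly (a₂ - b₂) 0 0).congr' ?_) h
  filter_upwards [self_mem_nhdsWithin] with l hl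
  have : l ≠ 0 := (Set.mem_Ioi.1 hl).ne'
  field_simp; simp only [smul_eq_mul]; linear_combination (-1 : ℝ) * h0 - l * h1

end HasExpansion

end Expansions

/-! ### The residuals of the extremal equations to second order -/

section Residuals

variable {d : ℕ} {β τ t : ℝ} {x : Phase d}

/-- First-order jets of `F lam` at `(t, q, lam p̃)`, and its Laplacian in the momentum, to second
order in `lam`; the derivatives in the momentum are taken with respect to `p̃`. -/
structure HasJetExpansion (F : ℝ → ℝ → Phase d → ℝ) (c : Fin 3 → ℝ → Phase d → ℝ) (t : ℝ)
    (x : Phase d) : Prop where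
  time : HasExpansion (fun l => dt (F l) t (x.1, l • x.2)) (dt (c 0) t x) (dt (c 1) t x)
    (dt (c 2) t x)
  gradQ : HasExpansion (fun l => gradQ (F l t) (x.1, l • x.2)) (gradQ (c 0 t) x) (gradQ (c 1 t) x)
    (gradQ (c 2 t) x)
  gradP : HasExpansion (fun l => l • gradP (F l t) (x.1, l • x.2)) (gradP (c 0 t) x)
    (gradP (c 1 t) x) (gradP (c 2 t) x)
  lapP : HasExpansion (fun l => l ^ 2 * lapP (F l t) (x.1, l • x.2)) (lapP (c 0 t) x)
    (lapP (c 1 t) x) (lapP (c 2 t) x)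

variable {S A V : ℝ → ℝ → Phase d → ℝ} {s a v : Fin 3 → ℝ → Phase d → ℝ}

namespace HasJetExpansion

/-- One derivative in the momentum costs a factor `lam⁻¹`, so that the Poisson bracket enters one
order later than the metric bracket. All residuals below are expanded after multiplication with
`lam²`, the weight of two derivatives in the momentum. -/
theorem poissonBracket (hA : HasJetExpansion A a t x) (hV : HasJetExpansion V v t x) :
    HasExpansion (fun l => l ^ 2 * poissonBracket (A l t) (V l t) (x.1, l • x.2)) 0
      (poissonBracket (a 0 t) (v 0 t) x)
      (poissonBracket (a 0 t) (v 1 t) x + poissonBracket (a 1 t) (v 0 t) x) := by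
  have h := ((hA.gradP.inner hV.gradQ).sub (hA.gradQ.inner hV.gradP)).smul_self
  refine h.of_eq (fun l => ?_) rfl rfl ?_ <;> simp only [_root_.poissonBracket,
    real_inner_smul_left, real_inner_smul_right, smul_eq_mul] <;> ring

theorem metricBracket (hA : HasJetExpansion A a t x) (hV : HasJetExpansion V v t x) :
    HasExpansion (fun l => l ^ 2 * metricBracket (A l t) (V l t) (x.1, l • x.2))
      (metricBracket (a 0 t) (v 0 t) x)
      (metricBracket (a 0 t) (v 1 t) x + metricBracket (a 1 t) (v 0 t) x)
      (metricBracket (a 0 t) (v 2 t) x + metricBracket (a 1 t) (v 1 t) x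
        + metricBracket (a 2 t) (v 0 t) x) :=
  (hA.gradP.inner hV.gradP).of_eq (fun l => by
    simp only [_root_.metricBracket, real_inner_smul_left, real_inner_smul_right]; ring) rfl rfl rfl

theorem wittenLaplacian (hS : HasJetExpansion S s t x) (hA : HasJetExpansion A a t x) :
    HasExpansion (fun l => l ^ 2 * wittenLaplacian β (S l t) (A l t) (x.1, l • x.2))
      (wittenLaplacian β (s 0 t) (a 0 t) x)
      (wittenLaplacian β (s 0 t) (a 1 t) x - β * _root_.metricBracket (s 1 t) (a 0 t) x)
      (wittenLaplacian β (s 0 t) (a 2 t) x - β * _root_.metricBracket (s 1 t) (a 1 t) x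
        - β * _root_.metricBracket (s 2 t) (a 0 t) x) := by
  have h := ((hS.metricBracket hA).const_mul (-β)).add hA.lapP
  refine h.of_eq (fun l => ?_) ?_ ?_ ?_ <;> simp only [_root_.wittenLaplacian] <;> ring

theorem valueResidual (hA : HasJetExpansion A a t x) (hV : HasJetExpansion V v t x) :
    HasExpansion (fun l => l ^ 2 * valueResidual τ (A l) (V l) t (x.1, l • x.2))
      (_root_.metricBracket (a 0 t) (a 0 t) x - _root_.metricBracket (a 0 t) (v 0 t) x)
      (_root_.poissonBracket (a 0 t) (v 0 t) x
        - (_root_.metricBracket (a 0 t) (v 1 t) x + _root_.metricBracket (a 1 t) (v 0 t) x)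
        + (_root_.metricBracket (a 0 t) (a 1 t) x + _root_.metricBracket (a 1 t) (a 0 t) x))
      (τ * dt (v 0) t x
        + (_root_.poissonBracket (a 0 t) (v 1 t) x + _root_.poissonBracket (a 1 t) (v 0 t) x)
        - (_root_.metricBracket (a 0 t) (v 2 t) x + _root_.metricBracket (a 1 t) (v 1 t) x
          + _root_.metricBracket (a 2 t) (v 0 t) x)
        + (_root_.metricBracket (a 0 t) (a 2 t) x + _root_.metricBracket (a 1 t) (a 1 t) x
          + _root_.metricBracket (a 2 t) (a 0 t) x)) := by
  have h := (((hV.time.const_mul τ).sq_mul.add (hA.poissonBracket hV)).sub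
    (hA.metricBracket hV)).add (hA.metricBracket hA)
  refine h.of_eq (fun l => ?_) ?_ ?_ ?_
  · simp only [_root_.valueResidual]; ring
  all_goals ring

theorem entropyResidual (hS : HasJetExpansion S s t x) (hA : HasJetExpansion A a t x) :
    HasExpansion (fun l => l ^ 2 * entropyResidual β τ (S l) (A l) t (x.1, l • x.2))
      (β⁻¹ * _root_.wittenLaplacian β (s 0 t) (a 0 t) x)
      (_root_.poissonBracket (a 0 t) (s 0 t) x + β⁻¹ * (_root_.wittenLaplacian β (s 0 t) (a 1 t) x
        - β * _root_.metricBracket (s 1 t) (a 0 t) x))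
      (τ * dt (s 0) t x
        + (_root_.poissonBracket (a 0 t) (s 1 t) x + _root_.poissonBracket (a 1 t) (s 0 t) x)
        + β⁻¹ * (_root_.wittenLaplacian β (s 0 t) (a 2 t) x
          - β * _root_.metricBracket (s 1 t) (a 1 t) x
          - β * _root_.metricBracket (s 2 t) (a 0 t) x)) := by
  have h := ((hS.time.const_mul τ).sq_mul.add (hA.poissonBracket hS)).add
    ((hS.wittenLaplacian (β := β) hA).const_mul β⁻¹)
  refine h.of_eq (fun l => ?_) ?_ ?_ ?_
  · simp only [_root_.entropyResidual]; ring
  all_goals ring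

theorem stationarityResidual (hS : HasJetExpansion S s t x) (hA : HasJetExpansion A a t x)
    (hV : HasJetExpansion V v t x) :
    HasExpansion (fun l => l ^ 2 * stationarityResidual β (S l) (A l) (V l) t (x.1, l • x.2))
      (β⁻¹ * _root_.wittenLaplacian β (s 0 t) (v 0 t) x
        - 2 * β⁻¹ * _root_.wittenLaplacian β (s 0 t) (a 0 t) x)
      (_root_.poissonBracket (s 0 t) (v 0 t) x
        + β⁻¹ * (_root_.wittenLaplacian β (s 0 t) (v 1 t) x
          - β * _root_.metricBracket (s 1 t) (v 0 t) x)
        - 2 * β⁻¹ * (_root_.wittenLaplacian β (s 0 t) (a 1 t) x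
          - β * _root_.metricBracket (s 1 t) (a 0 t) x))
      (_root_.poissonBracket (s 0 t) (v 1 t) x + _root_.poissonBracket (s 1 t) (v 0 t) x
        + β⁻¹ * (_root_.wittenLaplacian β (s 0 t) (v 2 t) x
          - β * _root_.metricBracket (s 1 t) (v 1 t) x
          - β * _root_.metricBracket (s 2 t) (v 0 t) x)
        - 2 * β⁻¹ * (_root_.wittenLaplacian β (s 0 t) (a 2 t) x
          - β * _root_.metricBracket (s 1 t) (a 1 t) x
          - β * _root_.metricBracket (s 2 t) (a 0 t) x)) := by
  have h := ((hS.poissonBracket hV).add ((hS.wittenLaplacian (β := β) hV).const_mul β⁻¹)).sub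
    ((hS.wittenLaplacian (β := β) hA).const_mul (2 * β⁻¹))
  refine h.of_eq (fun l => ?_) ?_ ?_ ?_
  · simp only [_root_.stationarityResidual]; ring
  all_goals ring

end HasJetExpansion

/-! ### Jets from two-scale expansions -/

theorem hasFDerivAt_rescale {f : Phase d → ℝ} {l : ℝ} {x : Phase d}
    (hf : DifferentiableAt ℝ f (x.1, l • x.2)) :
    HasFDerivAt (fun y : Phase d => f (y.1, l • y.2))
      ((fderiv ℝ f (x.1, l • x.2)).comp
        ((ContinuousLinearMap.fst ℝ (Pos d) (Pos d)).prod
          (l • ContinuousLinearMap.snd ℝ (Pos d) (Pos d)))) x :=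
  HasFDerivAt.comp (g := f) x hf.hasFDerivAt
    ((ContinuousLinearMap.fst ℝ (Pos d) (Pos d)).prod
      (l • ContinuousLinearMap.snd ℝ (Pos d) (Pos d))).hasFDerivAt

theorem gradP_rescale {f : Phase d → ℝ} {l : ℝ} {x : Phase d}
    (hf : DifferentiableAt ℝ f (x.1, l • x.2)) :
    gradP (fun y : Phase d => f (y.1, l • y.2)) x = l • gradP f (x.1, l • x.2) := by
  refine ext_inner_right ℝ fun w => ?_
  have h := hasFDerivAt_rescale hf
  rw [inner_gradP h.differentiableAt, h.fderiv, real_inner_smul_left, inner_gradP hf,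
    ← smul_eq_mul, ← map_smul]
  simp

theorem lapP_rescale {f : Phase d → ℝ} {l : ℝ} (hf : ContDiff ℝ 2 f) (x : Phase d) :
    lapP (fun y : Phase d => f (y.1, l • y.2)) x = l ^ 2 * lapP f (x.1, l • x.2) := by
  have hc : ContDiff ℝ 2 fun y : Phase d => f (y.1, l • y.2) := hf.comp (by fun_prop)
  have e : gradP (fun y : Phase d => f (y.1, l • y.2))
      = fun y => l • gradP f (y.1, l • y.2) :=
    funext fun y => gradP_rescale (hf.differentiable (by norm_num) _)
  have hG := (contDiff_gradP hf).differentiable (by norm_num)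
  have hs := hasFDerivAt_slice_right (hG (x.1, l • x.2))
  have hs2 : HasFDerivAt (fun p : Pos d => l • gradP f (x.1, l • p))
      (l • (((fderiv ℝ (gradP f) (x.1, l • x.2)).comp (.inr ℝ (Pos d) (Pos d))).comp
        (l • ContinuousLinearMap.id ℝ (Pos d)))) x.2 :=
    (HasFDerivAt.comp (g := fun p => gradP f (x.1, p)) x.2 hs
      (l • ContinuousLinearMap.id ℝ (Pos d)).hasFDerivAt).const_smul l
  rw [← divP_gradP hc, ← divP_gradP hf, e, divP, divergence, hs2.fderiv, divP, divergence,
    hs.fderiv, Finset.mul_sum]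
  refine Finset.sum_congr rfl fun i _ => ?_
  simp
  ring

/-- The regularity of a field at time `t` that is needed to differentiate an expansion. -/
def IsRegularAt (f : ℝ → Phase d → ℝ) (t : ℝ) : Prop :=
  (∀ x, DifferentiableAt ℝ (fun s => f s x) t) ∧ ContDiff ℝ 2 (f t)

theorem IsC21.isRegularAt {f : ℝ → Phase d → ℝ} (hf : IsC21 f) (t : ℝ) : IsRegularAt f t :=
  ⟨fun x => hf.time x t, hf.space t⟩

/-- The chain rule for `p = lam p̃` turns the expansion of the derivatives of the rescaled field
into one of its jets in the original variables. -/
theorem HasTwoScaleExpansion.hasJetExpansion {t₀ t₁ : ℝ} {F : ℝ → ℝ → Phase d → ℝ}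
    {c : Fin 3 → ℝ → Phase d → ℝ} (h : HasTwoScaleExpansion t₀ t₁ F c) {t : ℝ}
    (ht : t ∈ Set.Icc t₀ t₁) (hF : ∀ᶠ l in 𝓝[>] (0 : ℝ), IsRegularAt (F l) t) (x : Phase d) :
    HasJetExpansion F c t x := by
  have er : ∀ l t, expansionRemainder F c l t = fun y => F l t (y.1, l • y.2)
      - (c 0 t y + l * c 1 t y + l ^ 2 * c 2 t y) := by
    intro l t; funext y; simp [expansionRemainder, Fin.sum_univ_three]
  have hc := fun i => (h.regular i).space t
  have dc : ∀ i, DifferentiableAt ℝ (c i t) x := fun i => (hc i).differentiable (by norm_num) x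
  have hp : ∀ l, ContDiff ℝ 2 fun y => c 0 t y + l * c 1 t y + l ^ 2 * c 2 t y := fun l =>
    ((hc 0).add (contDiff_const.mul (hc 1))).add (contDiff_const.mul (hc 2))
  have dp : ∀ l, HasFDerivAt (fun y => c 0 t y + l * c 1 t y + l ^ 2 * c 2 t y)
      (fderiv ℝ (c 0 t) x + l • fderiv ℝ (c 1 t) x + l ^ 2 • fderiv ℝ (c 2 t) x) x := fun l =>
    ((dc 0).hasFDerivAt.add ((dc 1).hasFDerivAt.const_mul l)).add
      ((dc 2).hasFDerivAt.const_mul (l ^ 2))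
  have hR : ∀ l, IsRegularAt (F l) t → ContDiff ℝ 2 fun y : Phase d => F l t (y.1, l • y.2) :=
    fun l hl => hl.2.comp (by fun_prop)
  constructor
  · refine (h.time t ht x).congr' (hF.mono fun l hl => ?_) EventuallyEq.rfl
    have e1 := (hl.1 (x.1, l • x.2)).hasDerivAt
    have e2 := ((((h.regular 0).hasDerivAt_time t x).add
      (((h.regular 1).hasDerivAt_time t x).const_mul l))).add
      (((h.regular 2).hasDerivAt_time t x).const_mul (l ^ 2))
    have e3 := e1.sub e2
    simp only [dt, er]
    exact e3.deriv
  · refine (h.gradQ t ht x).congr' (hF.mono fun l hl => ?_) EventuallyEq.rfl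
    beta_reduce
    rw [er, gradQ_sub ((hR l hl).differentiable (by norm_num) x) (dp l).differentiableAt,
      gradQ_eq (dp l).differentiableAt, (dp l).fderiv]
    simp only [map_add, map_smul, gradQ_eq (dc _)]
    rfl
  · refine (h.gradP t ht x).congr' (hF.mono fun l hl => ?_) EventuallyEq.rfl
    beta_reduce
    rw [er, gradP_sub ((hR l hl).differentiable (by norm_num) x) (dp l).differentiableAt,
      gradP_rescale (hl.2.differentiable (by norm_num) _), gradP_eq (dp l).differentiableAt,
      (dp l).fderiv]
    simp only [map_add, map_smul, gradP_eq (dc _)]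
  · refine (h.lapP t ht x).congr' (hF.mono fun l hl => ?_) EventuallyEq.rfl
    have em : ∀ i (k : ℝ),
        _root_.lapP (fun y => k * c i t y) x = k * _root_.lapP (c i t) x := fun i k =>
      laplacian_const_mul (contDiff_slice_right (hc i) x.1) k x.2
    beta_reduce
    rw [er, lapP_sub (hR l hl) (hp l), lapP_rescale hl.2,
      lapP_add ((hc 0).add (contDiff_const.mul (hc 1))) (contDiff_const.mul (hc 2)),
      lapP_add (hc 0) (contDiff_const.mul (hc 1)), em, em]
    rfl

/-- An additive constant is not seen by the jets. -/
theorem HasJetExpansion.of_sub_const {F : ℝ → ℝ → Phase d → ℝ} {c : Fin 3 → ℝ → Phase d → ℝ}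
    {k : ℝ → ℝ} (h : HasJetExpansion (fun l t x => F l t x - k l) c t x)
    (hF : ∀ᶠ l in 𝓝[>] (0 : ℝ), ContDiff ℝ 2 (F l t)) : HasJetExpansion F c t x := by
  refine ⟨h.time.congr' (Eventually.of_forall fun l => ?_),
    h.gradQ.congr' (Eventually.of_forall fun l => ?_),
    h.gradP.congr' (Eventually.of_forall fun l => ?_), h.lapP.congr' (hF.mono fun l hl => ?_)⟩
  · simp only [dt, deriv_sub_const]
  · simp only [_root_.gradQ, gradient, fderiv_sub_const]
  · simp only [_root_.gradP, gradient, fderiv_sub_const]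
  · simp only
    rw [lapP_sub hl contDiff_const]
    simp [_root_.lapP]

end Residuals

/-! ### Polynomial fields in the momentum -/

section Polynomials

variable {d : ℕ}

theorem gradient_eq_of_hasFDerivAt {f : Pos d → ℝ} {p v : Pos d} {L : Pos d →L[ℝ] ℝ}
    (h : HasFDerivAt f L p) (hL : ∀ w, L w = inner ℝ v w) : gradient f p = v :=
  ext_inner_right ℝ fun w => by rw [inner_gradient_left, h.fderiv, hL]

theorem contDiff_inner_left (v : Pos d) : ContDiff ℝ 2 fun p : Pos d => inner ℝ p v :=
  contDiff_id.inner ℝ contDiff_const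

theorem contDiff_half_norm_sq : ContDiff ℝ 2 fun p : Pos d => ‖p‖ ^ 2 / 2 :=
  (contDiff_id.norm_sq ℝ).div_const 2

theorem gradient_inner_left (v p : Pos d) : gradient (fun p => inner ℝ p v) p = v :=
  gradient_eq_of_hasFDerivAt ((hasFDerivAt_id p).inner ℝ (hasFDerivAt_const v p)) fun w => by
    simp [real_inner_comm]

theorem gradient_half_norm_sq (p : Pos d) : gradient (fun p : Pos d => ‖p‖ ^ 2 / 2) p = p :=
  gradient_eq_of_hasFDerivAt (((hasStrictFDerivAt_norm_sq p).hasFDerivAt).mul_const (2⁻¹ : ℝ))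
    fun w => by simp

theorem gradient_quadratic (D : Pos d →L[ℝ] Pos d)
    (hD : ∀ v w, (inner ℝ (D v) w : ℝ) = inner ℝ v (D w)) (p : Pos d) :
    gradient (fun p => 2⁻¹ * inner ℝ p (D p)) p = D p :=
  gradient_eq_of_hasFDerivAt
    (((hasFDerivAt_id p).inner ℝ (D.hasFDerivAt (x := p))).const_mul (2⁻¹ : ℝ)) fun w => by
      simp [hD p w]
      rw [real_inner_comm, ← hD, real_inner_comm]
      ring

theorem laplacian_eq_of_gradient {f : Pos d → ℝ} (hf : ContDiff ℝ 2 f) {L : Pos d →L[ℝ] Pos d}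
    {c : Pos d} (h : ∀ p, gradient f p = L p + c) (p : Pos d) :
    Laplacian.laplacian f p = ∑ i, L (basisVec i) i := by
  have h1 : HasFDerivAt (fun p => L p + c) L p := L.hasFDerivAt.add_const c
  rw [← divergence_gradient (hf.differentiable_fderiv p), funext h, divergence, h1.fderiv]

theorem laplacian_inner_left (v p : Pos d) :
    Laplacian.laplacian (fun p => inner ℝ p v) p = 0 := by
  rw [laplacian_eq_of_gradient (contDiff_inner_left v) (L := 0) (c := v)
    fun p => by simp [gradient_inner_left]]
  simp

theorem laplacian_quadratic (D : Pos d →L[ℝ] Pos d)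
    (hD : ∀ v w, (inner ℝ (D v) w : ℝ) = inner ℝ v (D w)) (p : Pos d) :
    Laplacian.laplacian (fun p => 2⁻¹ * inner ℝ p (D p)) p = ∑ i, D (basisVec i) i := by
  have hc : ContDiff ℝ 2 fun p : Pos d => 2⁻¹ * inner ℝ p (D p) :=
    contDiff_const.mul (contDiff_id.inner ℝ D.contDiff)
  exact laplacian_eq_of_gradient hc (c := 0) (fun p => by rw [gradient_quadratic D hD, add_zero]) p

theorem symmetric_fderiv_gradient {f : Pos d → ℝ} (hf : ContDiff ℝ 2 f) (q v w : Pos d) :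
    (inner ℝ (fderiv ℝ (gradient f) q v) w : ℝ) = inner ℝ v (fderiv ℝ (gradient f) q w) := by
  rw [inner_fderiv_gradient (hf.differentiable_fderiv q), real_inner_comm,
    inner_fderiv_gradient (hf.differentiable_fderiv q)]
  exact (hf.contDiffAt.isSymmSndFDerivAt (by simp)) _ _

theorem sum_fderiv_gradient {f : Pos d → ℝ} (hf : ContDiff ℝ 2 f) (q : Pos d) :
    ∑ i, fderiv ℝ (gradient f) q (basisVec i) i = Laplacian.laplacian f q :=
  divergence_gradient (hf.differentiable_fderiv q)

theorem gradP_fst (f : Pos d → ℝ) (x : Phase d) : gradP (fun y => f y.1) x = 0 :=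
  gradient_fun_const x.2 (f x.1)

theorem lapP_fst (f : Pos d → ℝ) (x : Phase d) : lapP (fun y => f y.1) x = 0 := by
  simp [lapP]

/-- The position gradient of `p ⬝ ∂f(q)`. -/
theorem gradQ_inner_gradient {f : Pos d → ℝ} (hf : ContDiff ℝ 2 f) (x : Phase d) :
    gradQ (fun y => inner ℝ y.2 (gradient f y.1)) x = fderiv ℝ (gradient f) x.1 x.2 := by
  have hG : DifferentiableAt ℝ (gradient f) x.1 :=
    (contDiff_gradient hf (m := 1) (by norm_num)).differentiable (by norm_num) x.1
  exact gradient_eq_of_hasFDerivAt ((hasFDerivAt_const x.2 x.1).inner ℝ hG.hasFDerivAt) fun w => by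
    simp [symmetric_fderiv_gradient hf]

end Polynomials

/-! ### The two-scale fields of a solution of the cell problem -/

section Consistency

variable {d : ℕ} {β τ t₀ t₁ : ℝ} {Uo Uf : Pos d → ℝ} {a s : ℝ → Pos d → ℝ}

theorem twoScale_rescale (c : Fin 3 → ℝ → Phase d → ℝ) {l : ℝ} (hl : l ≠ 0) (t : ℝ)
    (x : Phase d) : expansionRemainder (twoScale c) c l t x = 0 := by
  simp [expansionRemainder, twoScale, smul_smul, inv_mul_cancel₀ hl]

theorem hasTwoScaleExpansion_twoScale {c : Fin 3 → ℝ → Phase d → ℝ} (hc : ∀ i, IsC21 (c i))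
    (t₀ t₁ : ℝ) : HasTwoScaleExpansion t₀ t₁ (twoScale c) c := by
  have e : ∀ᶠ l in 𝓝[>] (0 : ℝ), expansionRemainder (twoScale c) c l = fun _ _ => 0 := by
    filter_upwards [self_mem_nhdsWithin] with l hl
    funext t x
    exact twoScale_rescale c (Set.mem_Ioi.1 hl).ne' t x
  refine ⟨hc, ?_, ?_, ?_, ?_, ?_⟩ <;> intro t _ x
  · exact (isLittleO_zero _ _).congr' (e.mono fun l hl => by simp [hl]) EventuallyEq.rfl
  · exact (isLittleO_zero _ _).congr' (e.mono fun l hl => by simp [hl, dt]) EventuallyEq.rfl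
  · exact (isLittleO_zero _ _).congr' (e.mono fun l hl => by
      simp only [hl, gradQ, gradient_fun_const]) EventuallyEq.rfl
  · exact (isLittleO_zero _ _).congr' (e.mono fun l hl => by
      simp only [hl, gradP, gradient_fun_const]) EventuallyEq.rfl
  · exact (isLittleO_zero _ _).congr' (e.mono fun l hl => by simp [hl, lapP]) EventuallyEq.rfl

theorem IsC21.twoScale {c : Fin 3 → ℝ → Phase d → ℝ} (hc : ∀ i, IsC21 (c i)) (l : ℝ) :
    IsC21 (twoScale c l) := by
  have h : ∀ i : Fin 3,
      IsC21 fun t (x : Phase d) => l ^ (i : ℕ) * c i t (x.1, l⁻¹ • x.2) := fun i =>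
    ((hc i).comp_clm ((ContinuousLinearMap.fst ℝ (Pos d) (Pos d)).prod
      (l⁻¹ • ContinuousLinearMap.snd ℝ (Pos d) (Pos d)))).const_mul _
  have e : _root_.twoScale c l = fun t x => l ^ ((0 : Fin 3) : ℕ) * c 0 t (x.1, l⁻¹ • x.2)
      + l ^ ((1 : Fin 3) : ℕ) * c 1 t (x.1, l⁻¹ • x.2)
      + l ^ ((2 : Fin 3) : ℕ) * c 2 t (x.1, l⁻¹ • x.2) := by
    funext t x; rw [_root_.twoScale, Fin.sum_univ_three]
  rw [e]
  exact ((h 0).add (h 1)).add (h 2)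

/-- The entropy `‖p̃‖² / 2 + s` of the two-scale fields. -/
def cellEntropyFields (s : ℝ → Pos d → ℝ) : Fin 3 → ℝ → Phase d → ℝ :=
  ![fun t x => ‖x.2‖ ^ 2 / 2 + s t x.1, fun _ _ => 0, fun _ _ => 0]

/-- The energy `a - lam p̃ ⬝ ∂a + lam² p̃ ⬝ ∂²a p̃ / 2` of the two-scale fields: up to the orders
that are kept, it is the value of `a` at the position `q - lam p̃`. -/
def cellEnergyFields (a : ℝ → Pos d → ℝ) : Fin 3 → ℝ → Phase d → ℝ :=
  ![fun t x => a t x.1, fun t x => -1 * inner ℝ x.2 (gradient (a t) x.1),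
    fun t x => 2⁻¹ * inner ℝ x.2 (fderiv ℝ (gradient (a t)) x.1 x.2)]

/-- The value function `2 a + lam² p̃ ⬝ ∂²a p̃` of the two-scale fields. -/
def cellValueFields (a : ℝ → Pos d → ℝ) : Fin 3 → ℝ → Phase d → ℝ :=
  ![fun t x => 2 * a t x.1, fun _ _ => 0,
    fun t x => 2 * (2⁻¹ * inner ℝ x.2 (fderiv ℝ (gradient (a t)) x.1 x.2))]

theorem contDiff_joint_gradient (ha : ContDiff ℝ ∞ (fun z : ℝ × Pos d => a z.1 z.2)) :
    ContDiff ℝ ∞ (fun z : ℝ × Pos d => gradient (a z.1) z.2) := by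
  have h : ContDiff ℝ ∞ (fun z : ℝ × Pos d => fderiv ℝ (a z.1) z.2) := by
    refine ContDiff.fderiv (n := ∞) (m := ∞) (f := fun (z : ℝ × Pos d) => a z.1)
      (g := fun z => z.2) ?_ contDiff_snd (by simp)
    exact ha.comp ((contDiff_fst.comp contDiff_fst).prodMk contDiff_snd)
  exact (InnerProductSpace.toDual ℝ (Pos d)).symm.toContinuousLinearEquiv.contDiff.comp h

theorem contDiff_joint_hessian (ha : ContDiff ℝ ∞ (fun z : ℝ × Pos d => a z.1 z.2)) :
    ContDiff ℝ ∞ (fun z : ℝ × Pos d => fderiv ℝ (gradient (a z.1)) z.2) := by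
  refine ContDiff.fderiv (n := ∞) (m := ∞) (f := fun (z : ℝ × Pos d) => gradient (a z.1))
    (g := fun z => z.2) ?_ contDiff_snd (by simp)
  exact (contDiff_joint_gradient ha).comp ((contDiff_fst.comp contDiff_fst).prodMk contDiff_snd)

theorem three_le_infty : (3 : ℕ∞ω) ≤ ((⊤ : ℕ∞) : ℕ∞ω) :=
  WithTop.coe_le_coe.2 (le_top (a := (3 : ℕ∞)))

theorem isC21_cellEntropyFields (hs : ContDiff ℝ ∞ (fun z : ℝ × Pos d => s z.1 z.2)) (i : Fin 3) :
    IsC21 (cellEntropyFields s i) := by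
  refine isC21_of_joint ?_
  fin_cases i
  · have h1 : ContDiff ℝ 3 fun z : ℝ × Phase d => s z.1 z.2.1 :=
      (hs.of_le three_le_infty).comp (g := fun z : ℝ × Pos d => s z.1 z.2)
        (contDiff_fst.prodMk (contDiff_fst.comp contDiff_snd))
    have h2 : ContDiff ℝ 3 fun z : ℝ × Phase d => ‖z.2.2‖ ^ 2 / 2 :=
      ((contDiff_snd.comp contDiff_snd).norm_sq ℝ).div_const 2
    exact h2.add h1
  · exact contDiff_const
  · exact contDiff_const

theorem isC21_cellEnergyFields (ha : ContDiff ℝ ∞ (fun z : ℝ × Pos d => a z.1 z.2)) (i : Fin 3) :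
    IsC21 (cellEnergyFields a i) := by
  refine isC21_of_joint ?_
  have hπ : ContDiff ℝ 3 fun z : ℝ × Phase d => (z.1, z.2.1) :=
    contDiff_fst.prodMk (contDiff_fst.comp contDiff_snd)
  have hp : ContDiff ℝ 3 fun z : ℝ × Phase d => z.2.2 := contDiff_snd.comp contDiff_snd
  fin_cases i
  · exact (ha.of_le three_le_infty).comp hπ
  · exact contDiff_const.mul
      (hp.inner ℝ (((contDiff_joint_gradient ha).of_le three_le_infty).comp hπ))
  · exact contDiff_const.mul
      (hp.inner ℝ ((((contDiff_joint_hessian ha).of_le three_le_infty).comp hπ).clm_apply hp))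

theorem isC21_cellValueFields (ha : ContDiff ℝ ∞ (fun z : ℝ × Pos d => a z.1 z.2)) (i : Fin 3) :
    IsC21 (cellValueFields a i) := by
  fin_cases i
  · exact (isC21_cellEnergyFields ha 0).const_mul 2
  · exact isC21_of_joint contDiff_const
  · exact (isC21_cellEnergyFields ha 2).const_mul 2

/-- The additive constant in the boundary condition of the cell problem is the one that normalizes
the Maxwellian states. -/
theorem exp_twoScale_cellEntropyFields (hβ : 0 < β) {U : Pos d → ℝ} {t : ℝ}
    (h : ∀ q, s t q = U q + d / β * Real.log (2 * Real.pi)) {l : ℝ} (hl : 0 < l) (x : Phase d) :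
    (β / l) ^ d * Real.exp (-β * twoScale (cellEntropyFields s) l t x)
      = maxwellianState β l U x := by
  have hp : (0 : ℝ) < 2 * Real.pi := by positivity
  have e1 : twoScale (cellEntropyFields s) l t x
      = ‖x.2‖ ^ 2 / (2 * l ^ 2) + (U x.1 + d / β * Real.log (2 * Real.pi)) := by
    rw [twoScale, Fin.sum_univ_three]
    simp only [cellEntropyFields, Matrix.cons_val, h, norm_smul, norm_inv,
      Real.norm_of_nonneg hl.le]
    simp
    field_simp
  have e2 : Real.exp (-β * (‖x.2‖ ^ 2 / (2 * l ^ 2) + (U x.1 + d / β * Real.log (2 * Real.pi))))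
      = Real.exp (-β * ‖x.2‖ ^ 2 / (2 * l ^ 2) - β * U x.1) * ((2 * Real.pi) ^ d)⁻¹ := by
    rw [← Real.exp_log (pow_pos hp d), ← Real.exp_neg, ← Real.exp_add, Real.log_pow]
    congr 1
    field_simp
    ring
  rw [e1, e2, maxwellianState, show β / (2 * Real.pi * l) = β / l * (2 * Real.pi)⁻¹ by field_simp,
    mul_pow (β / l), inv_pow]
  ring

section Derivatives

variable {t : ℝ} {x : Phase d}

theorem gradP_cellEntropyFields : gradP (cellEntropyFields s 0 t) x = x.2 := by
  change gradient (fun p : Pos d => ‖p‖ ^ 2 / 2 + s t x.1) x.2 = x.2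
  rw [gradient_add (contDiff_half_norm_sq.differentiable (by norm_num) _) (by fun_prop),
    gradient_half_norm_sq, gradient_fun_const, add_zero]

theorem gradQ_cellEntropyFields (hs : IsC21 s) :
    gradQ (cellEntropyFields s 0 t) x = gradient (s t) x.1 := by
  change gradient (fun q => ‖x.2‖ ^ 2 / 2 + s t q) x.1 = _
  rw [gradient_add (by fun_prop) (hs.differentiable t x.1), gradient_fun_const, zero_add]

theorem gradP_cellEnergyFields_one :
    gradP (cellEnergyFields a 1 t) x = -gradient (a t) x.1 := by
  change gradient (fun p => -1 * inner ℝ p (gradient (a t) x.1)) x.2 = _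
  rw [gradient_const_mul ((contDiff_inner_left _).differentiable (by norm_num) _),
    gradient_inner_left, neg_one_smul]

theorem lapP_cellEnergyFields_one : lapP (cellEnergyFields a 1 t) x = 0 := by
  change Laplacian.laplacian (fun p => -1 * inner ℝ p (gradient (a t) x.1)) x.2 = _
  rw [laplacian_const_mul (contDiff_inner_left _), laplacian_inner_left, mul_zero]

theorem gradQ_cellEnergyFields_one (ha : IsC21 a) :
    gradQ (cellEnergyFields a 1 t) x = -fderiv ℝ (gradient (a t)) x.1 x.2 := by
  have hG : DifferentiableAt ℝ (gradient (a t)) x.1 :=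
    (ha.contDiff_gradient t).differentiable (by norm_num) x.1
  rw [← gradQ_inner_gradient (ha.space t), ← neg_one_smul ℝ]
  exact gradient_const_mul ((differentiableAt_const x.2).inner ℝ hG) (-1)

theorem gradP_cellEnergyFields_two (ha : IsC21 a) :
    gradP (cellEnergyFields a 2 t) x = fderiv ℝ (gradient (a t)) x.1 x.2 :=
  gradient_quadratic _ (symmetric_fderiv_gradient (ha.space t) x.1) x.2

theorem lapP_cellEnergyFields_two (ha : IsC21 a) :
    lapP (cellEnergyFields a 2 t) x = Laplacian.laplacian (a t) x.1 :=
  (laplacian_quadratic _ (symmetric_fderiv_gradient (ha.space t) x.1) x.2).trans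
    (sum_fderiv_gradient (ha.space t) x.1)

end Derivatives

/-- Every smooth solution of the cell problem generates an asymptotic solution of the extremal
equations. -/
theorem IsCellSolution.consistency (h : IsCellSolution β τ t₀ t₁ Uo Uf a s) (hβ : 0 < β)
    (ha : ContDiff ℝ ∞ (fun z : ℝ × Pos d => a z.1 z.2))
    (hs : ContDiff ℝ ∞ (fun z : ℝ × Pos d => s z.1 z.2)) {t : ℝ} (ht : t ∈ Set.Icc t₀ t₁)
    (x : Phase d) :
    Tendsto (fun l => valueResidual τ (twoScale (cellEnergyFields a) l)
        (twoScale (cellValueFields a) l) t (x.1, l • x.2)) (𝓝[>] 0) (𝓝 0) ∧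
      Tendsto (fun l => entropyResidual β τ (twoScale (cellEntropyFields s) l)
        (twoScale (cellEnergyFields a) l) t (x.1, l • x.2)) (𝓝[>] 0) (𝓝 0) ∧
      Tendsto (fun l => stationarityResidual β (twoScale (cellEntropyFields s) l)
        (twoScale (cellEnergyFields a) l) (twoScale (cellValueFields a) l) t (x.1, l • x.2))
        (𝓝[>] 0) (𝓝 0) := by
  have ha' : IsC21 a := isC21_of_joint (ha.of_le three_le_infty)
  have hs' : IsC21 s := isC21_of_joint (hs.of_le three_le_infty)
  have jet : ∀ {c : Fin 3 → ℝ → Phase d → ℝ}, (∀ i, IsC21 (c i)) →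
      HasJetExpansion (twoScale c) c t x := fun hc =>
    (hasTwoScaleExpansion_twoScale hc t₀ t₁).hasJetExpansion ht
      (Eventually.of_forall fun l => (IsC21.twoScale hc l).isRegularAt t) x
  have jS := jet (isC21_cellEntropyFields hs)
  have jA := jet (isC21_cellEnergyFields ha)
  have jV := jet (isC21_cellValueFields ha)
  have hA0P : gradP (cellEnergyFields a 0 t) x = 0 := gradP_fst _ _
  have hA0Q : gradQ (cellEnergyFields a 0 t) x = gradient (a t) x.1 := rfl
  have hA0L : lapP (cellEnergyFields a 0 t) x = 0 := lapP_fst _ _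
  have hV0P : gradP (cellValueFields a 0 t) x = 0 := gradP_fst (fun q => 2 * a t q) _
  have hV0Q : gradQ (cellValueFields a 0 t) x = (2 : ℝ) • gradient (a t) x.1 :=
    gradient_const_mul (ha'.differentiable t x.1) 2
  have hV0L : lapP (cellValueFields a 0 t) x = 0 := lapP_fst (fun q => 2 * a t q) _
  have hV0T : dt (cellValueFields a 0) t x = 2 * dt a t x.1 :=
    ((ha'.hasDerivAt_time t x.1).const_mul 2).deriv
  have hV1P : gradP (cellValueFields a 1 t) x = 0 := gradient_fun_const x.2 (0 : ℝ)
  have hV1Q : gradQ (cellValueFields a 1 t) x = 0 := gradient_fun_const x.1 (0 : ℝ)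
  have hV1L : lapP (cellValueFields a 1 t) x = 0 := lapP_fst (fun _ => 0) _
  have cA2 : ContDiff ℝ 2 fun p => cellEnergyFields a 2 t (x.1, p) :=
    contDiff_slice_right ((isC21_cellEnergyFields ha 2).space t) x.1
  have hV2P : gradP (cellValueFields a 2 t) x = (2 : ℝ) • gradP (cellEnergyFields a 2 t) x :=
    gradient_const_mul (cA2.differentiable (by norm_num) x.2) 2
  have hV2L : lapP (cellValueFields a 2 t) x = 2 * lapP (cellEnergyFields a 2 t) x :=
    laplacian_const_mul cA2 2 x.2
  have hS0T : dt (cellEntropyFields s 0) t x = dt s t x.1 :=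
    ((hs'.hasDerivAt_time t x.1).const_add (‖x.2‖ ^ 2 / 2)).deriv
  have hS1P : gradP (cellEntropyFields s 1 t) x = 0 := gradient_fun_const x.2 (0 : ℝ)
  have hS1Q : gradQ (cellEntropyFields s 1 t) x = 0 := gradient_fun_const x.1 (0 : ℝ)
  have hS2P : gradP (cellEntropyFields s 2 t) x = 0 := gradient_fun_const x.2 (0 : ℝ)
  have hval := h.value t ht x.1
  have hent := h.entropy t ht x.1
  -- what remains is that the nine coefficients of the three residuals vanish; the nontrivial ones
  -- are the last coefficients of the value and entropy equations, which are the cell problem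
  refine ⟨HasExpansion.tendsto_zero ((jA.valueResidual (τ := τ) jV).of_eq (fun _ => rfl) ?_ ?_ ?_),
    HasExpansion.tendsto_zero ((jS.entropyResidual (β := β) (τ := τ) jA).of_eq
      (fun _ => rfl) ?_ ?_ ?_),
    HasExpansion.tendsto_zero ((jS.stationarityResidual (β := β) jA jV).of_eq
      (fun _ => rfl) ?_ ?_ ?_)⟩ <;>
  simp only [poissonBracket, metricBracket, wittenLaplacian, hA0P, hA0Q, hA0L, hV0P, hV0Q, hV0L,
    hV0T, hV1P, hV1Q, hV1L, hV2P, hV2L, hS0T, hS1P, hS1Q, hS2P, gradP_cellEntropyFields,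
    gradQ_cellEntropyFields hs', gradP_cellEnergyFields_one, lapP_cellEnergyFields_one,
    gradQ_cellEnergyFields_one ha', gradP_cellEnergyFields_two ha', lapP_cellEnergyFields_two ha',
    inner_zero_left, inner_zero_right, inner_neg_left, inner_neg_right, real_inner_smul_right,
    mul_zero, sub_zero, add_zero, zero_add, zero_sub, neg_zero,
    real_inner_self_eq_norm_sq]
  · linarith
  · rw [real_inner_comm]
    field_simp
    ring
  · rw [real_inner_comm x.2]
    linear_combination hent + (-(inner ℝ x.2 (fderiv ℝ (gradient (a t)) x.1 x.2)))
      * (inv_mul_cancel₀ hβ.ne')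
  · field_simp
    ring
  · ring

end Consistency

/-! ### Maxwellian fibres -/

section Fibres

variable {d : ℕ} {β : ℝ}

theorem integrable_gaussian {b : ℝ} (hb : 0 < b) :
    Integrable fun p : Pos d => Real.exp (-b * ‖p‖ ^ 2) := by
  by_contra hn
  have h := GaussianFourier.integral_rexp_neg_mul_sq_norm (V := Pos d) hb
  rw [integral_undef hn] at h
  exact (Real.rpow_pos_of_pos (by positivity) _).ne h

theorem integrable_norm_pow_four_mul_gaussian {b : ℝ} (hb : 0 < b) :
    Integrable fun p : Pos d => ‖p‖ ^ 4 * Real.exp (-b * ‖p‖ ^ 2) := by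
  refine ((integrable_gaussian (d := d) (half_pos hb)).const_mul (8 / b ^ 2)).mono'
    (by fun_prop) (Eventually.of_forall fun p => ?_)
  rw [Real.norm_of_nonneg (by positivity)]
  have h1 := Real.quadratic_le_exp_of_nonneg (x := b / 2 * ‖p‖ ^ 2) (by positivity)
  have h2 : ‖p‖ ^ 4 ≤ 8 / b ^ 2 * Real.exp (b / 2 * ‖p‖ ^ 2) := by
    have h3 : (b / 2 * ‖p‖ ^ 2) ^ 2 / 2 ≤ Real.exp (b / 2 * ‖p‖ ^ 2) := by
      have : 0 ≤ b / 2 * ‖p‖ ^ 2 := by positivity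
      linarith
    rw [div_mul_eq_mul_div, le_div_iff₀ (by positivity)]
    linarith [show (b / 2 * ‖p‖ ^ 2) ^ 2 / 2 = ‖p‖ ^ 4 * b ^ 2 / 8 by ring]
  calc ‖p‖ ^ 4 * Real.exp (-b * ‖p‖ ^ 2)
      ≤ 8 / b ^ 2 * Real.exp (b / 2 * ‖p‖ ^ 2) * Real.exp (-b * ‖p‖ ^ 2) := by gcongr
    _ = 8 / b ^ 2 * Real.exp (-(b / 2) * ‖p‖ ^ 2) := by
      rw [mul_assoc, ← Real.exp_add]; congr 2; ring

/-- Square integrability is not affected by subtracting a quadratic polynomial on a Gaussian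
fibre. -/
theorem integrable_sq_sub_quadratic {f : Pos d → ℝ} (hf : Continuous f) {b c : ℝ} (hb : 0 < b)
    (hc : 0 < c) (D : Pos d →L[ℝ] Pos d) (v : Pos d)
    (hfw : Integrable fun p => f p ^ 2 * (c * Real.exp (-b * ‖p‖ ^ 2))) :
    Integrable fun p => (f p - (2⁻¹ * inner ℝ p (D p) - inner ℝ p v)) ^ 2
      * (c * Real.exp (-b * ‖p‖ ^ 2)) := by
  have hg := ((integrable_gaussian (d := d) hb).add
    (integrable_norm_pow_four_mul_gaussian (d := d) hb)).const_mul
      (c * (2 * (‖D‖ + 2 * ‖v‖) ^ 2))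
  refine ((hfw.const_mul 2).add hg).mono' ?_ (Eventually.of_forall fun p => ?_)
  · have h1 : Continuous fun p : Pos d => (inner ℝ p (D p) : ℝ) := continuous_id.inner D.continuous
    have h2 : Continuous fun p : Pos d => (inner ℝ p v : ℝ) := continuous_id.inner continuous_const
    exact Continuous.aestronglyMeasurable (by fun_prop)
  · rw [Real.norm_of_nonneg (by positivity)]
    simp only [Pi.add_apply]
    set E := Real.exp (-b * ‖p‖ ^ 2) with hE
    have hE0 : 0 < E := Real.exp_pos _
    set P := 2⁻¹ * inner ℝ p (D p) - inner ℝ p v with hP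
    have n0 := norm_nonneg p
    have hPle : |P| ≤ (‖D‖ + 2 * ‖v‖) * ((1 + ‖p‖ ^ 2) / 2) := by
      have h1 : |(inner ℝ p (D p) : ℝ)| ≤ ‖D‖ * ‖p‖ ^ 2 := by
        refine (abs_real_inner_le_norm _ _).trans ?_
        nlinarith [D.le_opNorm p]
      have h2 : |(inner ℝ p v : ℝ)| ≤ ‖p‖ * ‖v‖ := abs_real_inner_le_norm _ _
      have h3 : ‖p‖ * ‖v‖ ≤ (1 + ‖p‖ ^ 2) * ‖v‖ := by
        gcongr
        nlinarith [sq_nonneg (‖p‖ - 1)]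
      have h4 : |P| ≤ 2⁻¹ * |(inner ℝ p (D p) : ℝ)| + |(inner ℝ p v : ℝ)| := by
        refine (abs_sub _ _).trans ?_
        rw [abs_mul]; norm_num
      nlinarith [norm_nonneg D, norm_nonneg v]
    have hP2 : P ^ 2 ≤ (‖D‖ + 2 * ‖v‖) ^ 2 * (1 + ‖p‖ ^ 4) := by
      rw [← sq_abs]
      calc |P| ^ 2 ≤ ((‖D‖ + 2 * ‖v‖) * ((1 + ‖p‖ ^ 2) / 2)) ^ 2 := by gcongr
        _ = (‖D‖ + 2 * ‖v‖) ^ 2 * ((1 + ‖p‖ ^ 2) / 2) ^ 2 := by ring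
        _ ≤ _ := by
          gcongr
          nlinarith [sq_nonneg (‖p‖ ^ 2 - 1), sq_nonneg (‖p‖ ^ 2)]
    have h5 : (f p - P) ^ 2 ≤ 2 * f p ^ 2 + 2 * P ^ 2 := by nlinarith [sq_nonneg (f p + P)]
    calc (f p - P) ^ 2 * (c * E)
        ≤ (2 * f p ^ 2 + 2 * ((‖D‖ + 2 * ‖v‖) ^ 2 * (1 + ‖p‖ ^ 4))) * (c * E) := by
          gcongr; linarith
      _ = _ := by ring

/-- Solvability of the fibre equation with a quadratic right-hand side, and its solution: the
polynomial `⟪p, D p⟫ / 2 - ⟪p, v⟫` reproduces the right-hand side up to a constant, which is zero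
because it is the Witten Laplacian of a square integrable function; the rest is constant by the
Liouville theorem. -/
theorem fibre_solution (hβ : 0 < β) {f : Pos d → ℝ} (hf : ContDiff ℝ 2 f) {k e : ℝ}
    {D : Pos d →L[ℝ] Pos d} (hD : ∀ v w, (inner ℝ (D v) w : ℝ) = inner ℝ v (D w)) {v : Pos d}
    (h : ∀ p, witten β (fun p => ‖p‖ ^ 2 / 2 + k) f p
      = β * (-inner ℝ p (D p) + inner ℝ p v + e))
    (hfw : Integrable fun p => f p ^ 2 * Real.exp (-β * (‖p‖ ^ 2 / 2 + k))) :
    β * e = ∑ i, D (basisVec i) i ∧ ∀ p, gradient f p = D p - v := by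
  have cS : ContDiff ℝ 2 fun p : Pos d => ‖p‖ ^ 2 / 2 + k :=
    contDiff_half_norm_sq.add contDiff_const
  have cq : ContDiff ℝ 2 fun p : Pos d => 2⁻¹ * inner ℝ p (D p) :=
    contDiff_const.mul (contDiff_id.inner ℝ D.contDiff)
  have cl := contDiff_inner_left v
  have cPoly : ContDiff ℝ 2 fun p : Pos d => 2⁻¹ * inner ℝ p (D p) - inner ℝ p v := cq.sub cl
  have cg : ContDiff ℝ 2 fun p => f p - (2⁻¹ * inner ℝ p (D p) - inner ℝ p v) := hf.sub cPoly
  have dd : ∀ {g : Pos d → ℝ}, ContDiff ℝ 2 g → ∀ p, DifferentiableAt ℝ g p := fun hg p =>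
    hg.differentiable (by norm_num) p
  have gsub : ∀ {g₁ g₂ : Pos d → ℝ}, ContDiff ℝ 2 g₁ → ContDiff ℝ 2 g₂ → ∀ p,
      gradient (fun p => g₁ p - g₂ p) p = gradient g₁ p - gradient g₂ p := fun h₁ h₂ p => by
    simp only [gradient, fderiv_fun_sub (dd h₁ p) (dd h₂ p), map_sub]
  have hgS : ∀ p : Pos d, gradient (fun p => ‖p‖ ^ 2 / 2 + k) p = p := fun p => by
    rw [gradient_add (dd contDiff_half_norm_sq p) (differentiableAt_const _),
      gradient_half_norm_sq, gradient_fun_const, add_zero]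
  have hgg : ∀ p, gradient (fun p => f p - (2⁻¹ * inner ℝ p (D p) - inner ℝ p v)) p
      = gradient f p - (D p - v) := fun p => by
    rw [gsub hf cPoly, gsub cq cl, gradient_quadratic D hD, gradient_inner_left]
  have hlap : ∀ p, Laplacian.laplacian
      (fun p => f p - (2⁻¹ * inner ℝ p (D p) - inner ℝ p v)) p
      = Laplacian.laplacian f p - ∑ i, D (basisVec i) i := fun p => by
    have e1 := ContDiffAt.laplacian_sub hf.contDiffAt (x := p) cPoly.contDiffAt
    have e2 := ContDiffAt.laplacian_sub cq.contDiffAt (x := p) cl.contDiffAt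
    have e3 := laplacian_quadratic D hD p
    have e4 := laplacian_inner_left v p
    change Laplacian.laplacian (f - fun p => 2⁻¹ * inner ℝ p (D p) - inner ℝ p v) p = _
    rw [e1]
    change _ - Laplacian.laplacian ((fun p => 2⁻¹ * inner ℝ p (D p)) - fun p => inner ℝ p v) p = _
    rw [e2, e3, e4, sub_zero]
  have hw : ∀ p, witten β (fun p => ‖p‖ ^ 2 / 2 + k)
      (fun p => f p - (2⁻¹ * inner ℝ p (D p) - inner ℝ p v)) p
      = β * e - ∑ i, D (basisVec i) i := fun p => by
    have h1 := h p
    rw [witten, hgS] at h1 ⊢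
    rw [hgg, hlap, inner_sub_right, inner_sub_right]
    linear_combination h1
  have hE : ∀ p : Pos d, Real.exp (-β * (‖p‖ ^ 2 / 2 + k))
      = Real.exp (-β * k) * Real.exp (-(β / 2) * ‖p‖ ^ 2) := fun p => by
    rw [← Real.exp_add]; congr 1; ring
  have hw1 : Integrable fun p : Pos d => Real.exp (-β * (‖p‖ ^ 2 / 2 + k)) := by
    simp only [hE]
    exact (integrable_gaussian (half_pos hβ)).const_mul _
  have hgw : Integrable fun p => (f p - (2⁻¹ * inner ℝ p (D p) - inner ℝ p v)) ^ 2
      * Real.exp (-β * (‖p‖ ^ 2 / 2 + k)) := by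
    simp only [hE] at hfw ⊢
    exact integrable_sq_sub_quadratic hf.continuous (half_pos hβ) (Real.exp_pos _) D v hfw
  have h0 := eq_zero_of_witten_eq_const cS cg hw hw1 hgw
  refine ⟨sub_eq_zero.1 h0, fun p => ?_⟩
  have h1 := gradient_eq_zero_of_witten_eq_zero cS cg (fun p => (hw p).trans h0) hgw p
  rw [hgg] at h1
  exact sub_eq_zero.1 h1

/-- Continuous functions that agree on almost every fibre agree: a set of full measure is dense. -/
theorem eq_of_ae_eq_fibre {F : Type*} [TopologicalSpace F] [T2Space F] {g₁ g₂ : Phase d → F}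
    (h₁ : Continuous g₁) (h₂ : Continuous g₂) (h : ∀ᵐ q : Pos d, ∀ p, g₁ (q, p) = g₂ (q, p))
    (x : Phase d) : g₁ x = g₂ x := by
  have hc : IsClosed {q : Pos d | ∀ p, g₁ (q, p) = g₂ (q, p)} := by
    rw [Set.ofPred_forall]
    exact isClosed_iInter fun p => isClosed_eq (h₁.comp (by fun_prop)) (h₂.comp (by fun_prop))
  have hd : Dense {q : Pos d | ∀ p, g₁ (q, p) = g₂ (q, p)} := Measure.dense_of_ae h
  have hu := hc.closure_eq.symm.trans hd.closure_eq
  have hx : x.1 ∈ {q : Pos d | ∀ p, g₁ (q, p) = g₂ (q, p)} := hu ▸ Set.mem_univ _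
  exact hx x.2

/-- The fibre equation over every position: square integrability on phase space gives it on almost
every fibre, and the conclusions extend by continuity. -/
theorem fibrewise_solution (hβ : 0 < β) {S f : Phase d → ℝ} {s : Pos d → ℝ}
    (hS : ∀ x, S x = ‖x.2‖ ^ 2 / 2 + s x.1) (hf : ContDiff ℝ 2 f) {e : Pos d → ℝ}
    {D : Pos d → Pos d →L[ℝ] Pos d} {v : Pos d → Pos d} (he : Continuous e) (hDc : Continuous D)
    (hv : Continuous v) (hD : ∀ q v w, (inner ℝ (D q v) w : ℝ) = inner ℝ v (D q w))
    (h : ∀ x, wittenLaplacian β S f x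
      = β * (-inner ℝ x.2 (D x.1 x.2) + inner ℝ x.2 (v x.1) + e x.1))
    (hfw : Integrable fun x => f x ^ 2 * Real.exp (-β * S x)) :
    (∀ q, β * e q = ∑ i, D q (basisVec i) i) ∧ ∀ x, gradP f x = D x.1 x.2 - v x.1 := by
  have hae : ∀ᵐ q : Pos d, β * e q = ∑ i, D q (basisVec i) i ∧
      ∀ p, gradP f (q, p) = D q p - v q := by
    rw [Measure.volume_eq_prod] at hfw
    filter_upwards [hfw.prod_right_ae] with q hq
    have eS : (fun p => S (q, p)) = fun p => ‖p‖ ^ 2 / 2 + s q := funext fun p => hS (q, p)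
    refine fibre_solution hβ (contDiff_slice_right hf q) (k := s q) (hD q) (fun p => ?_) ?_
    · rw [← eS]; exact h (q, p)
    · simpa only [hS] using hq
  have hg := (contDiff_gradP hf).continuous
  constructor
  · intro q
    refine eq_of_ae_eq_fibre (g₁ := fun x : Phase d => β * e x.1)
      (g₂ := fun x : Phase d => ∑ i, D x.1 (basisVec i) i) (by fun_prop) ?_
      (hae.mono fun q hq p => hq.1) (q, 0)
    fun_prop
  · refine eq_of_ae_eq_fibre hg ?_ (hae.mono fun q hq p => hq.2 p)
    fun_prop

/-- A field whose momentum gradient does not depend on the momentum is affine in it. -/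
theorem gradP_eq_inner_of_gradP_eq {f : Phase d → ℝ} (hf : ContDiff ℝ 2 f) {v : Pos d → Pos d}
    (h : ∀ x, gradP f x = v x.1) (x : Phase d) : f x = inner ℝ x.2 (v x.1) + f (x.1, 0) := by
  have c1 := contDiff_slice_right hf x.1
  have c2 := contDiff_inner_left (v x.1)
  have hz : ∀ p, fderiv ℝ (fun p => f (x.1, p) - inner ℝ p (v x.1)) p = 0 := fun p => by
    have e := c1.differentiable (by norm_num) p
    have e2 := c2.differentiable (by norm_num) p
    refine ContinuousLinearMap.ext fun w => ?_
    rw [fderiv_fun_sub e e2, _root_.sub_apply, ← inner_gradient_left, ← inner_gradient_left,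
      gradient_inner_left]
    have := h (x.1, p)
    rw [gradP] at this
    simp [this]
  have := is_const_of_fderiv_eq_zero (𝕜 := ℝ) ((c1.sub c2).differentiable (by norm_num)) hz x.2 0
  simp at this
  linarith

end Fibres

/-! ### The solvability conditions of the first three orders -/

section Solvability

variable {d : ℕ} {β : ℝ}

theorem wittenLaplacian_sub_const_mul {S f g : Phase d → ℝ} (hf : ContDiff ℝ 2 f)
    (hg : ContDiff ℝ 2 g) (c : ℝ) (x : Phase d) :
    wittenLaplacian β S (fun y => f y - c * g y) x
      = wittenLaplacian β S f x - c * wittenLaplacian β S g x := by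
  have dg := (contDiff_slice_right hg x.1).differentiable (by norm_num) x.2
  have cg : ContDiff ℝ 2 fun y => c * g y := contDiff_const.mul hg
  have e1 : gradP (fun y => c * g y) x = c • gradP g x := gradient_const_mul dg c
  have e2 : lapP (fun y => c * g y) x = c * lapP g x :=
    laplacian_const_mul (contDiff_slice_right hg x.1) c x.2
  simp only [wittenLaplacian, metricBracket]
  rw [gradP_sub (hf.differentiable (by norm_num) x) (cg.differentiable (by norm_num) x),
    lapP_sub hf cg, e1, e2, inner_sub_right, real_inner_smul_right]
  ring

theorem integrable_sq_sub_const_mul {α : Type*} [MeasurableSpace α] {μ : Measure α}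
    {f g w : α → ℝ} (c : ℝ) (hw : ∀ x, 0 ≤ w x) (hf : Integrable (fun x => f x ^ 2 * w x) μ)
    (hg : Integrable (fun x => g x ^ 2 * w x) μ)
    (hm : AEStronglyMeasurable (fun x => (f x - c * g x) ^ 2 * w x) μ) :
    Integrable (fun x => (f x - c * g x) ^ 2 * w x) μ := by
  refine ((hf.const_mul 2).add (hg.const_mul (2 * c ^ 2))).mono' hm
    (Eventually.of_forall fun x => ?_)
  have := hw x
  rw [Real.norm_of_nonneg (by positivity)]
  simp only [Pi.add_apply]
  nlinarith [mul_nonneg this (sq_nonneg (f x + c * g x))]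

/-- The position gradient of a field that is affine in the momentum, with a gradient slope. -/
theorem gradQ_affine {f : Phase d → ℝ} {g k : Pos d → ℝ} {c : ℝ} (hg : ContDiff ℝ 2 g)
    (hk : Differentiable ℝ k) (h : ∀ x, f x = c * inner ℝ x.2 (gradient g x.1) + k x.1)
    (x : Phase d) :
    gradQ f x = c • fderiv ℝ (gradient g) x.1 x.2 + gradient k x.1 := by
  have hG : DifferentiableAt ℝ (gradient g) x.1 :=
    (contDiff_gradient hg (m := 1) (by norm_num)).differentiable (by norm_num) x.1
  have hi : DifferentiableAt ℝ (fun q => inner ℝ x.2 (gradient g q)) x.1 :=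
    (differentiableAt_const x.2).inner ℝ hG
  have e := gradQ_inner_gradient hg x
  rw [gradQ] at e
  rw [gradQ, funext fun q => h (q, x.2), gradient_add (hi.const_mul c) (hk x.1),
    gradient_const_mul hi, e]

/-- What the entropy and stationarity equations of the orders `0`, `1`, `2` say at a fixed time, for
a leading entropy that is Maxwellian in the momentum: the leading energy and value functions depend
on the position only, the first correction of the energy is linear in the momentum, the entropy
equation of the cell problem holds, and the gradient of the value is twice that of the energy. -/
theorem solvability_conditions (hβ : 0 < β) {s σ : Pos d → ℝ} (hs : ContDiff ℝ 2 s)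
    (hσ : Continuous σ) {S A V : Fin 3 → Phase d → ℝ}
    (hS : ∀ x, S 0 x = ‖x.2‖ ^ 2 / 2 + s x.1) (hA : ∀ i, ContDiff ℝ 2 (A i))
    (hV : ∀ i, ContDiff ℝ 2 (V i))
    (hAw : ∀ i, Integrable fun x => A i x ^ 2 * Real.exp (-β * S 0 x))
    (hVw : ∀ i, Integrable fun x => V i x ^ 2 * Real.exp (-β * S 0 x))
    (hE0 : ∀ x, β⁻¹ * wittenLaplacian β (S 0) (A 0) x = 0)
    (hE1 : ∀ x, poissonBracket (A 0) (S 0) x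
      + β⁻¹ * (wittenLaplacian β (S 0) (A 1) x - β * metricBracket (S 1) (A 0) x) = 0)
    (hE2 : ∀ x, σ x.1 + (poissonBracket (A 0) (S 1) x + poissonBracket (A 1) (S 0) x)
      + β⁻¹ * (wittenLaplacian β (S 0) (A 2) x - β * metricBracket (S 1) (A 1) x
        - β * metricBracket (S 2) (A 0) x) = 0)
    (hT0 : ∀ x, β⁻¹ * wittenLaplacian β (S 0) (V 0) x
      - 2 * β⁻¹ * wittenLaplacian β (S 0) (A 0) x = 0)
    (hT1 : ∀ x, poissonBracket (S 0) (V 0) x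
      + β⁻¹ * (wittenLaplacian β (S 0) (V 1) x - β * metricBracket (S 1) (V 0) x)
      - 2 * β⁻¹ * (wittenLaplacian β (S 0) (A 1) x - β * metricBracket (S 1) (A 0) x) = 0)
    (hT2 : ∀ x, poissonBracket (S 0) (V 1) x + poissonBracket (S 1) (V 0) x
      + β⁻¹ * (wittenLaplacian β (S 0) (V 2) x - β * metricBracket (S 1) (V 1) x
        - β * metricBracket (S 2) (V 0) x)
      - 2 * β⁻¹ * (wittenLaplacian β (S 0) (A 2) x - β * metricBracket (S 1) (A 1) x
        - β * metricBracket (S 2) (A 0) x) = 0) :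
    (∀ x, gradP (A 0) x = 0) ∧ (∀ x, gradP (V 0) x = 0) ∧
      (∀ x, gradP (A 1) x = -gradient (fun q => A 0 (q, 0)) x.1) ∧
      (∀ q, σ q = inner ℝ (gradient (fun q => A 0 (q, 0)) q) (gradient s q)
        - β⁻¹ * Laplacian.laplacian (fun q => A 0 (q, 0)) q) ∧
      ∀ q, gradient (fun q => V 0 (q, 0)) q = (2 : ℝ) • gradient (fun q => A 0 (q, 0)) q := by
  have hβi : β * β⁻¹ = 1 := mul_inv_cancel₀ hβ.ne'
  have ds : Differentiable ℝ s := hs.differentiable (by norm_num)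
  have hSP : ∀ x, gradP (S 0) x = x.2 := fun x => by
    have e : (fun p => S 0 (x.1, p)) = fun p => ‖p‖ ^ 2 / 2 + s x.1 :=
      funext fun p => hS (x.1, p)
    rw [gradP, e, gradient_add
      (contDiff_half_norm_sq.differentiable (by norm_num) _) (by fun_prop),
      gradient_half_norm_sq, gradient_fun_const, add_zero]
  have hSQ : ∀ x, gradQ (S 0) x = gradient s x.1 := fun x => by
    have e : (fun q => S 0 (q, x.2)) = fun q => ‖x.2‖ ^ 2 / 2 + s q :=
      funext fun q => hS (q, x.2)
    rw [gradQ, e, gradient_add (by fun_prop) (ds x.1),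
      gradient_fun_const, zero_add]
  have cS : Continuous (S 0) := by
    rw [funext hS]
    exact ((continuous_norm.comp continuous_snd).pow 2 |>.div_const 2).add
      (hs.continuous.comp continuous_fst)
  have cw : Continuous fun x => Real.exp (-β * S 0 x) := by fun_prop
  have hVAw : ∀ i, Integrable fun x => (V i x - 2 * A i x) ^ 2 * Real.exp (-β * S 0 x) := fun i =>
    integrable_sq_sub_const_mul 2 (fun x => (Real.exp_pos _).le) (hVw i) (hAw i)
      ((((hV i).continuous.sub (continuous_const.mul (hA i).continuous)).pow 2).mul
        cw).aestronglyMeasurable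
  have cVA : ∀ i, ContDiff ℝ 2 fun x => V i x - 2 * A i x := fun i =>
    (hV i).sub (contDiff_const.mul (hA i))
  have zD : ∀ (q v w : Pos d), (inner ℝ ((0 : Pos d →L[ℝ] Pos d) v) w : ℝ)
      = inner ℝ v ((0 : Pos d →L[ℝ] Pos d) w) := fun q v w => by simp
  -- order zero: on every fibre `A 0` and `V 0` are in the kernel of the Witten Laplacian
  have wA0 : ∀ x, wittenLaplacian β (S 0) (A 0) x = 0 := fun x => by
    linear_combination β * hE0 x - wittenLaplacian β (S 0) (A 0) x * hβi
  have wV0 : ∀ x, wittenLaplacian β (S 0) (V 0) x = 0 := fun x => by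
    linear_combination β * hT0 x - wittenLaplacian β (S 0) (V 0) x * hβi
      + 2 * (β * β⁻¹) * wA0 x
  have PA0 : ∀ x, gradP (A 0) x = 0 := fun x => by
    simpa using (fibrewise_solution hβ hS (hA 0) (e := fun _ => 0) (D := fun _ => 0)
      (v := fun _ => 0) continuous_const continuous_const continuous_const zD
      (fun x => by simpa using wA0 x) (hAw 0)).2 x
  have PV0 : ∀ x, gradP (V 0) x = 0 := fun x => by
    simpa using (fibrewise_solution hβ hS (hV 0) (e := fun _ => 0) (D := fun _ => 0)
      (v := fun _ => 0) continuous_const continuous_const continuous_const zD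
      (fun x => by simpa using wV0 x) (hVw 0)).2 x
  set A₀ : Pos d → ℝ := fun q => A 0 (q, 0) with hA₀
  set V₀ : Pos d → ℝ := fun q => V 0 (q, 0) with hV₀
  have eA0 : ∀ x, A 0 x = A₀ x.1 := fun x => by
    simpa using gradP_eq_inner_of_gradP_eq (hA 0) (v := fun _ => 0) PA0 x
  have eV0 : ∀ x, V 0 x = V₀ x.1 := fun x => by
    simpa using gradP_eq_inner_of_gradP_eq (hV 0) (v := fun _ => 0) PV0 x
  have cA₀ : ContDiff ℝ 2 A₀ := contDiff_slice_left (hA 0) 0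
  have cV₀ : ContDiff ℝ 2 V₀ := contDiff_slice_left (hV 0) 0
  have gA₀ := contDiff_gradient cA₀ (m := 1) (by norm_num)
  have gV₀ := contDiff_gradient cV₀ (m := 1) (by norm_num)
  have QA0 : ∀ x, gradQ (A 0) x = gradient A₀ x.1 := fun x => by
    rw [gradQ, funext fun q => eA0 (q, x.2)]
  have QV0 : ∀ x, gradQ (V 0) x = gradient V₀ x.1 := fun x => by
    rw [gradQ, funext fun q => eV0 (q, x.2)]
  -- order one: the sources are linear in the momentum, and so are `A 1` and `V 1 - 2 A 1`
  have wA1 : ∀ x, wittenLaplacian β (S 0) (A 1) x = β * inner ℝ x.2 (gradient A₀ x.1) := fun x => by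
    have h := hE1 x
    simp only [poissonBracket, metricBracket, PA0, QA0, hSP, inner_zero_left, inner_zero_right]
      at h
    rw [real_inner_comm] at h
    linear_combination β * h - wittenLaplacian β (S 0) (A 1) x * hβi
  have PA1 : ∀ x, gradP (A 1) x = -gradient A₀ x.1 := fun x => by
    simpa using (fibrewise_solution hβ hS (hA 1) (e := fun _ => 0) (D := fun _ => 0)
      (v := gradient A₀) continuous_const continuous_const gA₀.continuous zD
      (fun x => by simpa using wA1 x) (hAw 1)).2 x
  have wV1 : ∀ x, wittenLaplacian β (S 0) (fun y => V 1 y - 2 * A 1 y) x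
      = β * inner ℝ x.2 (-gradient V₀ x.1) := fun x => by
    have h := hT1 x
    simp only [poissonBracket, metricBracket, PA0, PV0, QV0, hSP, inner_zero_right] at h
    rw [wittenLaplacian_sub_const_mul (hV 1) (hA 1), inner_neg_right]
    linear_combination β * h - (wittenLaplacian β (S 0) (V 1) x
      - 2 * wittenLaplacian β (S 0) (A 1) x) * hβi
  have PVA1 : ∀ x, gradP (fun y => V 1 y - 2 * A 1 y) x = gradient V₀ x.1 := fun x => by
    simpa using (fibrewise_solution hβ hS (cVA 1) (e := fun _ => 0) (D := fun _ => 0)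
      (v := fun q => -gradient V₀ q) continuous_const continuous_const gV₀.continuous.neg zD
      (fun x => by simpa using wV1 x) (hVAw 1)).2 x
  set φ : Pos d → ℝ := fun q => V₀ q - 2 * A₀ q with hφ
  have cφ : ContDiff ℝ 2 φ := cV₀.sub (contDiff_const.mul cA₀)
  have gφ : ∀ q, gradient φ q = gradient V₀ q - (2 : ℝ) • gradient A₀ q := fun q => by
    have d1 := cV₀.differentiable (by norm_num) q
    have d2 := cA₀.differentiable (by norm_num) q
    rw [← gradient_const_mul d2 2]
    simp only [hφ, gradient, fderiv_fun_sub d1 (d2.const_mul 2), map_sub]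
  have PV1 : ∀ x, gradP (V 1) x = gradient φ x.1 := fun x => by
    have h := PVA1 x
    have d2 := (hA 1).differentiable (by norm_num) x
    have e2 : gradP (fun y => 2 * A 1 y) x = (2 : ℝ) • gradP (A 1) x :=
      gradient_const_mul ((contDiff_slice_right (hA 1) x.1).differentiable (by norm_num) x.2) 2
    rw [gradP_sub ((hV 1).differentiable (by norm_num) x) (d2.const_mul 2), e2, PA1 x] at h
    rw [gφ, ← h]
    module
  have eA1 : ∀ x, A 1 x = -1 * inner ℝ x.2 (gradient A₀ x.1) + A 1 (x.1, 0) := fun x => by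
    rw [gradP_eq_inner_of_gradP_eq (hA 1) (v := fun q => -gradient A₀ q) PA1 x, inner_neg_right]
    ring
  have eV1 : ∀ x, V 1 x = 1 * inner ℝ x.2 (gradient φ x.1) + V 1 (x.1, 0) := fun x => by
    rw [gradP_eq_inner_of_gradP_eq (hV 1) (v := gradient φ) PV1 x, one_mul]
  have cA1 : ContDiff ℝ 2 fun q => A 1 (q, 0) := contDiff_slice_left (hA 1) 0
  have cV1 : ContDiff ℝ 2 fun q => V 1 (q, 0) := contDiff_slice_left (hV 1) 0
  have QA1 := gradQ_affine cA₀ (cA1.differentiable (by norm_num)) eA1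
  have QV1 := gradQ_affine cφ (cV1.differentiable (by norm_num)) eV1
  have cs' := (contDiff_gradient hs (m := 1) (by norm_num)).continuous
  -- order two: the sources are quadratic in the momentum, and their Gaussian means have to vanish;
  -- `V 2 - 2 A 2` is used because the corrections `S 1`, `S 2` of the entropy then cancel
  have wA2 : ∀ x, wittenLaplacian β (S 0) (A 2) x
      = β * (-inner ℝ x.2 (fderiv ℝ (gradient A₀) x.1 x.2)
        + inner ℝ x.2 (gradient (fun q => A 1 (q, 0)) x.1)
        + (inner ℝ (gradient A₀ x.1) (gradient s x.1) - σ x.1)) := fun x => by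
    have h := hE2 x
    simp only [poissonBracket, metricBracket, PA0, QA0, PA1, QA1, hSP, hSQ, inner_zero_left,
      inner_zero_right, inner_neg_left, inner_neg_right, inner_add_left, real_inner_smul_left] at h
    rw [real_inner_comm (gradP (S 1) x), real_inner_comm x.2, real_inner_comm x.2] at h
    linear_combination β * h - (wittenLaplacian β (S 0) (A 2) x
      + β * inner ℝ (gradP (S 1) x) (gradient A₀ x.1)) * hβi
  obtain ⟨sA2, -⟩ := fibrewise_solution hβ hS (hA 2)
    (e := fun q => inner ℝ (gradient A₀ q) (gradient s q) - σ q)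
    (D := fun q => fderiv ℝ (gradient A₀) q) (v := gradient fun q => A 1 (q, 0))
    ((gA₀.continuous.inner cs').sub hσ) (gA₀.continuous_fderiv (by norm_num))
    (contDiff_gradient cA1 (m := 1) (by norm_num)).continuous
    (fun q => symmetric_fderiv_gradient cA₀ q) wA2 (hAw 2)
  have wV2 : ∀ x, wittenLaplacian β (S 0) (fun y => V 2 y - 2 * A 2 y) x
      = β * (-inner ℝ x.2 (fderiv ℝ (gradient φ) x.1 x.2)
        + inner ℝ x.2 (-gradient (fun q => V 1 (q, 0)) x.1)
        + inner ℝ (gradient s x.1) (gradient φ x.1)) := fun x => by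
    have h := hT2 x
    simp only [poissonBracket, metricBracket, PA0, PV0, QV0, PA1, PV1, QV1, hSP, hSQ,
      inner_zero_right, inner_neg_right, inner_add_right, one_smul] at h
    have h2 : inner ℝ (gradP (S 1) x) (gradient φ x.1)
        = inner ℝ (gradP (S 1) x) (gradient V₀ x.1)
          - 2 * inner ℝ (gradP (S 1) x) (gradient A₀ x.1) := by
      rw [gφ, inner_sub_right, real_inner_smul_right]
    rw [wittenLaplacian_sub_const_mul (hV 2) (hA 2), inner_neg_right]
    linear_combination β * h - (wittenLaplacian β (S 0) (V 2) x
      - 2 * wittenLaplacian β (S 0) (A 2) x - β * inner ℝ (gradP (S 1) x) (gradient φ x.1)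
      - 2 * β * inner ℝ (gradP (S 1) x) (gradient A₀ x.1)) * hβi + β * h2
  obtain ⟨sV2, -⟩ := fibrewise_solution hβ hS (cVA 2)
    (e := fun q => inner ℝ (gradient s q) (gradient φ q))
    (D := fun q => fderiv ℝ (gradient φ) q) (v := fun q => -gradient (fun q => V 1 (q, 0)) q)
    (cs'.inner (contDiff_gradient cφ (m := 1) (by norm_num)).continuous)
    ((contDiff_gradient cφ (m := 1) (by norm_num)).continuous_fderiv (by norm_num))
    (contDiff_gradient cV1 (m := 1) (by norm_num)).continuous.neg
    (fun q => symmetric_fderiv_gradient cφ q) wV2 (hVAw 2)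
  -- the mean of the stationarity equation says that `φ = V₀ - 2 A₀` is in the kernel of a Witten
  -- Laplacian, now on configuration space; it is square integrable because `V 0 - 2 A 0` is so at
  -- almost every fixed momentum
  have wφ : ∀ q, witten β s φ q = 0 := fun q => by
    have h := sV2 q
    rw [sum_fderiv_gradient cφ] at h
    rw [witten, ← h]
    ring
  have iφ : Integrable fun q => φ q ^ 2 * Real.exp (-β * s q) := by
    have h := hVAw 0
    rw [Measure.volume_eq_prod] at h
    obtain ⟨p, hp⟩ := h.prod_left_ae.exists
    refine (hp.mul_const (Real.exp (β * (‖p‖ ^ 2 / 2)))).congr (Eventually.of_forall fun q => ?_)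
    simp only [eA0, eV0, hS, hφ]
    rw [mul_assoc, ← Real.exp_add]
    congr 2
    ring
  refine ⟨PA0, PV0, PA1, fun q => ?_, fun q => ?_⟩
  · have h := sA2 q
    rw [sum_fderiv_gradient cA₀] at h
    rw [← h]
    linear_combination (inner ℝ (gradient A₀ q) (gradient s q) - σ q) * hβi
  · have h := gradient_eq_zero_of_witten_eq_zero hs cφ wφ iφ q
    rw [gφ] at h
    exact sub_eq_zero.1 h

end Solvability

/-! ### The cell problem as the solvability condition of the expansion -/

section Expansion

variable {d : ℕ} {β τ t₀ t₁ : ℝ} {Uo Uf : Pos d → ℝ}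

theorem HasTwoScaleExpansion.hasExpansion {F : ℝ → ℝ → Phase d → ℝ}
    {c : Fin 3 → ℝ → Phase d → ℝ} (h : HasTwoScaleExpansion t₀ t₁ F c) {t : ℝ}
    (ht : t ∈ Set.Icc t₀ t₁) (x : Phase d) :
    HasExpansion (fun l => F l t (x.1, l • x.2)) (c 0 t x) (c 1 t x) (c 2 t x) :=
  IsLittleO.congr_left (h.value t ht x) fun l => by
    simp [expansionRemainder, Fin.sum_univ_three]

namespace IsLKTransition

variable {mo mf : Phase d → ℝ} {m H : ℝ → Phase d → ℝ}

theorem isRegularAt_entropy (h : IsLKTransition β τ t₀ t₁ mo mf m H) (hβ : 0 < β) {t : ℝ}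
    (ht : t ∈ Set.Icc t₀ t₁) : IsRegularAt (microEntropy β m) t :=
  ⟨fun x => (hasDerivAt_microEntropy hβ (h.pos t ht x) h.density_regular).differentiableAt,
    h.contDiff_entropy hβ ht⟩

theorem isRegularAt_helmholtz (h : IsLKTransition β τ t₀ t₁ mo mf m H) (hβ : 0 < β) {t : ℝ}
    (ht : t ∈ Set.Icc t₀ t₁) : IsRegularAt (helmholtz β m H) t :=
  ⟨fun x => (h.hamiltonian_regular.time x t).sub ((h.isRegularAt_entropy hβ ht).1 x),
    h.contDiff_helmholtz hβ ht⟩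

end IsLKTransition

/-- In the rescaled momentum the entropy of a Maxwellian state depends on the scale by an additive
constant only. -/
theorem microEntropy_maxwellianState (hβ : 0 < β) {l : ℝ} (hl : 0 < l) {U : Pos d → ℝ}
    {m : ℝ → Phase d → ℝ} {t : ℝ} (hm : m t = maxwellianState β l U) (x : Phase d) :
    microEntropy β m t (x.1, l • x.2) - d / β * Real.log l
      = ‖x.2‖ ^ 2 / 2 + (U x.1 + d / β * Real.log (2 * Real.pi)) := by
  have hp : (0 : ℝ) < 2 * Real.pi := by positivity
  rw [microEntropy, hm, maxwellianState, Real.log_div (by positivity) (by positivity),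
    Real.log_mul (by positivity) (Real.exp_pos _).ne', Real.log_exp, Real.log_pow, Real.log_pow,
    Real.log_div hβ.ne' (by positivity), Real.log_mul hp.ne' hl.ne', norm_smul,
    Real.norm_of_nonneg hl.le]
  field_simp
  ring

variable {m H V : ℝ → ℝ → Phase d → ℝ} {S A V' : Fin 3 → ℝ → Phase d → ℝ}

namespace IsExtremalExpansion

variable (h : IsExtremalExpansion β τ t₀ t₁ Uo Uf m H V S A V')
include h

theorem jetA (hβ : 0 < β) {t : ℝ} (ht : t ∈ Set.Icc t₀ t₁) (x : Phase d) :
    HasJetExpansion (fun l => helmholtz β (m l) (H l)) A t x :=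
  h.expansionA.hasJetExpansion ht
    (h.transition.mono fun _ hl => hl.isRegularAt_helmholtz hβ ht) x

theorem jetV {t : ℝ} (ht : t ∈ Set.Icc t₀ t₁) (x : Phase d) : HasJetExpansion V V' t x :=
  h.expansionV.hasJetExpansion ht (h.costate_regular.mono fun _ hl => hl.isRegularAt t) x

theorem jetS (hβ : 0 < β) {t : ℝ} (ht : t ∈ Set.Icc t₀ t₁) (x : Phase d) :
    HasJetExpansion (fun l => microEntropy β (m l)) S t x := by
  refine HasJetExpansion.of_sub_const (k := fun l => d / β * Real.log l)
    (h.expansionS.hasJetExpansion ht (h.transition.mono fun l hl => ?_) x)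
    (h.transition.mono fun l hl => hl.contDiff_entropy hβ ht)
  obtain ⟨h1, h2⟩ := hl.isRegularAt_entropy hβ ht
  exact ⟨fun x => (h1 x).sub_const _, h2.sub contDiff_const⟩

/-- The leading entropy inherits the Maxwellian profile of a boundary state. -/
theorem entropy_boundary (hβ : 0 < β) {U : Pos d → ℝ} {t : ℝ} (ht : t ∈ Set.Icc t₀ t₁)
    (hm : ∀ᶠ l in 𝓝[>] (0 : ℝ), m l t = maxwellianState β l U) (x : Phase d) :
    S 0 t x = ‖x.2‖ ^ 2 / 2 + (U x.1 + d / β * Real.log (2 * Real.pi)) := by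
  refine tendsto_nhds_unique (h.expansionS.hasExpansion ht x).tendsto
    (tendsto_const_nhds.congr' ?_)
  filter_upwards [hm, self_mem_nhdsWithin] with l hl h0
  exact (microEntropy_maxwellianState hβ h0 hl x).symm

theorem entropy_maxwellian (hβ : 0 < β) (h01 : t₀ < t₁)
    (hprof : ∀ t ∈ Set.Icc t₀ t₁, ∀ q p : Pos d,
      S 0 t (q, p) - S 0 t (q, 0) = S 0 t₀ (q, p) - S 0 t₀ (q, 0))
    {t : ℝ} (ht : t ∈ Set.Icc t₀ t₁) (x : Phase d) :
    S 0 t x = ‖x.2‖ ^ 2 / 2 + S 0 t (x.1, 0) := by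
  have h1 := hprof t ht x.1 x.2
  have hb := h.entropy_boundary hβ (Set.left_mem_Icc.2 h01.le)
    (h.transition.mono fun l hl => hl.initial)
  rw [hb (x.1, x.2), hb (x.1, 0)] at h1
  simp at h1
  linarith

/-- The time derivative of the leading entropy does not depend on the momentum. The Maxwellian form
is known on `[t₀, t₁]` only, which determines the derivative at the end points as well. -/
theorem dt_entropy (hβ : 0 < β) (h01 : t₀ < t₁)
    (hprof : ∀ t ∈ Set.Icc t₀ t₁, ∀ q p : Pos d,
      S 0 t (q, p) - S 0 t (q, 0) = S 0 t₀ (q, p) - S 0 t₀ (q, 0))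
    {t : ℝ} (ht : t ∈ Set.Icc t₀ t₁) (x : Phase d) :
    dt (S 0) t x = dt (S 0) t (x.1, 0) := by
  have h1 := ((h.expansionS.regular 0).hasDerivAt_time t x).hasDerivWithinAt (s := Set.Icc t₀ t₁)
  have h2 := (((h.expansionS.regular 0).hasDerivAt_time t (x.1, 0)).const_add
    (‖x.2‖ ^ 2 / 2)).hasDerivWithinAt (s := Set.Icc t₀ t₁)
  exact (uniqueDiffOn_Icc h01 t ht).eq_deriv _
    (h1.congr (fun t' ht' => (h.entropy_maxwellian hβ h01 hprof ht' x).symm)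
      (h.entropy_maxwellian hβ h01 hprof ht x).symm) h2 |>.trans rfl

/-- The leading orders of an extremal expansion solve the cell problem. The potential `a` is half of
the leading value function, which differs from the leading energy by a function of time; the value
equation fixes the time derivative of the former only. -/
theorem leading_order (hβ : 0 < β) (h01 : t₀ < t₁)
    (hprof : ∀ t ∈ Set.Icc t₀ t₁, ∀ q p : Pos d,
      S 0 t (q, p) - S 0 t (q, 0) = S 0 t₀ (q, p) - S 0 t₀ (q, 0)) :
    ∃ (a s : ℝ → Pos d → ℝ) (c : ℝ → ℝ), IsC21 a ∧ IsC21 s ∧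
      IsCellSolution β τ t₀ t₁ Uo Uf a s ∧
      ∀ t ∈ Set.Icc t₀ t₁, ∀ x : Phase d,
        S 0 t x = ‖x.2‖ ^ 2 / 2 + s t x.1 ∧
        A 0 t x = a t x.1 + c t ∧
        V' 0 t x = 2 * a t x.1 ∧
        gradP (A 1 t) x = -gradient (a t) x.1 := by
  have rS := h.expansionS.regular
  have rA := h.expansionA.regular
  have rV := h.expansionV.regular
  set s : ℝ → Pos d → ℝ := fun t q => S 0 t (q, 0) with hs
  set a : ℝ → Pos d → ℝ := fun t q => 2⁻¹ * V' 0 t (q, 0) with ha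
  have cs : IsC21 s := (rS 0).comp_clm (.inl ℝ (Pos d) (Pos d))
  have cV : IsC21 fun t q => V' 0 t (q, (0 : Pos d)) := (rV 0).comp_clm (.inl ℝ (Pos d) (Pos d))
  have ca : IsC21 a := cV.const_mul 2⁻¹
  have cA : IsC21 fun t q => A 0 t (q, (0 : Pos d)) := (rA 0).comp_clm (.inl ℝ (Pos d) (Pos d))
  have value_orders : ∀ t ∈ Set.Icc t₀ t₁, ∀ x, _ := fun t ht x =>
    ((h.jetA hβ ht x).valueResidual (τ := τ) (h.jetV ht x)).unique
      (HasExpansion.of_tendsto_zero (h.value t ht x))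
  have stationarity_orders : ∀ t ∈ Set.Icc t₀ t₁, ∀ x, _ := fun t ht x =>
    ((h.jetS hβ ht x).stationarityResidual (β := β) (h.jetA hβ ht x) (h.jetV ht x)).unique
      (HasExpansion.of_tendsto_zero (h.stationarity t ht x))
  have entropy_orders : ∀ t ∈ Set.Icc t₀ t₁, ∀ x, _ := fun t ht x =>
    ((h.jetS hβ ht x).entropyResidual (β := β) (τ := τ) (h.jetA hβ ht x)).unique
      (HasExpansion.of_tendsto_zero (tendsto_const_nhds.congr'
        (h.transition.mono fun l hl => (hl.entropyResidual_eq_zero hβ ht (x.1, l • x.2)).symm)))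
  have key : ∀ t ∈ Set.Icc t₀ t₁, _ := fun t ht => solvability_conditions hβ (cs.space t)
    (σ := fun q => τ * dt s t q)
    (continuous_const.mul (cs.continuous_dt.comp (continuous_const.prodMk continuous_id)))
    (S := fun i => S i t) (A := fun i => A i t) (V := fun i => V' i t)
    (h.entropy_maxwellian hβ h01 hprof ht) (fun i => (rA i).space t) (fun i => (rV i).space t)
    (fun i => h.square_integrableA i t ht) (fun i => h.square_integrableV i t ht)
    (fun x => (entropy_orders t ht x).1) (fun x => (entropy_orders t ht x).2.1)
    (fun x => by
      have := (entropy_orders t ht x).2.2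
      rw [h.dt_entropy hβ h01 hprof ht x] at this
      exact this)
    (fun x => (stationarity_orders t ht x).1) (fun x => (stationarity_orders t ht x).2.1)
    (fun x => (stationarity_orders t ht x).2.2)
  have ga : ∀ t ∈ Set.Icc t₀ t₁, ∀ q,
      gradient (fun q => A 0 t (q, 0)) q = gradient (a t) q := fun t ht q => by
    have e : gradient (a t) q = (2⁻¹ : ℝ) • gradient (fun q => V' 0 t (q, (0 : Pos d))) q :=
      gradient_const_mul (cV.differentiable t q) _
    rw [e, (key t ht).2.2.2.2 q, smul_smul]
    norm_num
  have eA : ∀ t ∈ Set.Icc t₀ t₁, ∀ q, A 0 t (q, 0) = a t q + (A 0 t (0, 0) - a t 0) := by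
    intro t ht q
    have dA := cA.differentiable t
    have da := ca.differentiable t
    have hz : ∀ q, fderiv ℝ (fun q => A 0 t (q, 0) - a t q) q = 0 := fun q => by
      refine ContinuousLinearMap.ext fun w => ?_
      rw [fderiv_fun_sub (dA q) (da q), _root_.sub_apply, ← inner_gradient_left,
        ← inner_gradient_left, ga t ht q]
      simp
    have := is_const_of_fderiv_eq_zero (𝕜 := ℝ) (dA.sub da) hz q 0
    simp only [Pi.sub_apply] at this
    linarith
  have la : ∀ t ∈ Set.Icc t₀ t₁, ∀ q,
      Laplacian.laplacian (fun q => A 0 t (q, 0)) q = Laplacian.laplacian (a t) q :=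
    fun t ht q => by
      rw [← divergence_gradient ((cA.space t).differentiable_fderiv q),
        ← divergence_gradient ((ca.space t).differentiable_fderiv q), funext (ga t ht)]
  refine ⟨a, s, fun t => A 0 t (0, 0) - a t 0, ca, cs, ⟨?_, ?_, ?_, ?_⟩,
    fun t ht x => ⟨?_, ?_, ?_, ?_⟩⟩
  · -- the second order of the value equation, at zero momentum
    intro t ht q
    obtain ⟨k1, k2, k3, -, k5⟩ := key t ht
    have e := (value_orders t ht (q, 0)).2.2
    have QA : gradQ (A 0 t) (q, 0) = gradient (a t) q := ga t ht q
    have QV : gradQ (V' 0 t) (q, 0) = (2 : ℝ) • gradient (a t) q := by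
      rw [← ga t ht q]; exact k5 q
    have ht' : dt a t q = 2⁻¹ * dt (V' 0) t (q, 0) :=
      (((rV 0).hasDerivAt_time t (q, 0)).const_mul 2⁻¹).deriv
    simp only [poissonBracket, metricBracket, k1, k2, k3, QA, QV, ga t ht, inner_zero_left,
      inner_zero_right, inner_neg_left, inner_neg_right, real_inner_smul_right,
      real_inner_self_eq_norm_sq] at e
    rw [ht']
    linarith
  · intro t ht q
    have e := (key t ht).2.2.2.1 q
    rw [ga t ht, la t ht] at e
    linarith
  · intro q
    have := h.entropy_boundary hβ (Set.left_mem_Icc.2 h01.le)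
      (h.transition.mono fun l hl => hl.initial) (q, 0)
    simpa using this
  · intro q
    have := h.entropy_boundary hβ (Set.right_mem_Icc.2 h01.le)
      (h.transition.mono fun l hl => hl.final) (q, 0)
    simpa using this
  · exact h.entropy_maxwellian hβ h01 hprof ht x
  · have e := gradP_eq_inner_of_gradP_eq ((rA 0).space t) (v := fun _ => 0) (key t ht).1 x
    rw [e, eA t ht x.1]
    simp
  · have e := gradP_eq_inner_of_gradP_eq ((rV 0).space t) (v := fun _ => 0) (key t ht).2.1 x
    rw [e, inner_zero_right, zero_add]
    simp only [ha]
    ring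
  · rw [← ga t ht]; exact (key t ht).2.2.1 x

end IsExtremalExpansion

end Expansion

/-! ### Expansion of the entropy production -/

section EnergyExpansion

variable {d : ℕ}

/-- The change of variables `p = l p̃` under a positive integrand. -/
theorem lintegral_rescale {l : ℝ} (hl : 0 < l) {F : Phase d → ℝ≥0∞} (hF : Measurable F) :
    ∫⁻ x, F x = ∫⁻ x : Phase d, ENNReal.ofReal (l ^ d) * F (x.1, l • x.2) := by
  have hm : Measurable fun x : Phase d => F (x.1, l • x.2) := hF.comp (by fun_prop)
  rw [Measure.volume_eq_prod, lintegral_prod _ hF.aemeasurable,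
    lintegral_prod _ (hm.const_mul _).aemeasurable]
  refine lintegral_congr fun q => ?_
  have hq : Measurable fun p => F (q, p) := hF.comp measurable_prodMk_left
  have h1 := lintegral_map (μ := (volume : Measure (Pos d))) hq (measurable_const_smul l)
  rw [Measure.map_addHaar_smul _ hl.ne', finrank_euclideanSpace_fin, lintegral_smul_measure,
    abs_of_pos (by positivity), smul_eq_mul] at h1
  simp only
  rw [lintegral_const_mul (f := fun p => F (q, l • p)) _ (hq.comp (measurable_const_smul l)), ← h1,
    ← mul_assoc, ← ENNReal.ofReal_mul (by positivity), mul_inv_cancel₀ (by positivity),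
    ENNReal.ofReal_one, one_mul]

/-- The momentum integral of the Maxwellian density `β^d exp (-β (‖p̃‖² / 2 + s))`. -/
theorem lintegral_maxwellian_eq_cellDensity {β : ℝ} (hβ : 0 < β) {s k : Pos d → ℝ}
    (hs : Continuous s) (hk : Continuous k) :
    ∫⁻ x : Phase d, ENNReal.ofReal
        (β ^ d * Real.exp (-β * (‖x.2‖ ^ 2 / 2 + s x.1)) * k x.1)
      = ∫⁻ q, ENNReal.ofReal (cellDensity β (fun _ => s) 0 q * k q) := by
  have hG : ∫ p : Pos d, β ^ d * Real.exp (-(β / 2) * ‖p‖ ^ 2)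
      = (2 * Real.pi * β) ^ ((d : ℝ) / 2) := by
    rw [integral_const_mul, GaussianFourier.integral_rexp_neg_mul_sq_norm (by positivity),
      finrank_euclideanSpace_fin, ← Real.rpow_natCast, show (d : ℝ) = 2 * (d / 2) by ring,
      Real.rpow_mul hβ.le, show 2 * ((d : ℝ) / 2) / 2 = d / 2 by ring,
      ← Real.mul_rpow (by positivity) (by positivity)]
    congr 1
    rw [Real.rpow_two]
    field_simp
  rw [Measure.volume_eq_prod, lintegral_prod _ (by fun_prop)]
  refine lintegral_congr fun q => ?_
  have e : ∀ p : Pos d, ENNReal.ofReal (β ^ d * Real.exp (-β * (‖p‖ ^ 2 / 2 + s q)) * k q)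
      = ENNReal.ofReal (β ^ d * Real.exp (-(β / 2) * ‖p‖ ^ 2))
        * ENNReal.ofReal (Real.exp (-β * s q) * k q) := fun p => by
    rw [← ENNReal.ofReal_mul (by positivity), show -β * (‖p‖ ^ 2 / 2 + s q)
      = -(β / 2) * ‖p‖ ^ 2 + -β * s q by ring, Real.exp_add]
    congr 1
    ring
  simp only [e]
  rw [lintegral_mul_const _ (by fun_prop), ← ofReal_integral_eq_lintegral_ofReal
    ((integrable_gaussian (by positivity : 0 < β / 2)).const_mul _)
    (Eventually.of_forall fun p => by positivity), hG, ← ENNReal.ofReal_mul (by positivity),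
    cellDensity]
  congr 1
  ring

/-- Splitting of the energy density `M ‖G‖²` around `M₀ ‖g‖²`, with weight `l` in Young's
inequality. -/
theorem mul_sq_norm_le_split {E : Type*} [NormedAddCommGroup E] {l M M₀ : ℝ} (hl : 0 < l)
    (hM : 0 ≤ M) (G g : E) :
    M * ‖G‖ ^ 2 ≤ (1 + l) * (M₀ * ‖g‖ ^ 2) + ((1 + l) * (|M - M₀| * ‖g‖ ^ 2)
      + (1 + l⁻¹) * (M * ‖G - g‖ ^ 2)) := by
  have h1 : ‖G‖ ≤ ‖g‖ + ‖G - g‖ := by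
    simpa using norm_add_le g (G - g)
  have h2 : ‖G‖ ^ 2 ≤ (1 + l) * ‖g‖ ^ 2 + (1 + l⁻¹) * ‖G - g‖ ^ 2 := by
    have h3 : 0 ≤ l⁻¹ * (l * ‖g‖ - ‖G - g‖) ^ 2 := by positivity
    have h4 : l⁻¹ * (l * ‖g‖ - ‖G - g‖) ^ 2
        = l * ‖g‖ ^ 2 - 2 * ‖g‖ * ‖G - g‖ + l⁻¹ * ‖G - g‖ ^ 2 := by
      field_simp
      ring
    nlinarith [pow_le_pow_left₀ (norm_nonneg G) h1 2]
  have h5 : M ≤ M₀ + |M - M₀| := by linarith [le_abs_self (M - M₀)]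
  calc M * ‖G‖ ^ 2 ≤ M * ((1 + l) * ‖g‖ ^ 2 + (1 + l⁻¹) * ‖G - g‖ ^ 2) := by gcongr
    _ = (1 + l) * (M * ‖g‖ ^ 2) + (1 + l⁻¹) * (M * ‖G - g‖ ^ 2) := by ring
    _ ≤ (1 + l) * ((M₀ + |M - M₀|) * ‖g‖ ^ 2) + (1 + l⁻¹) * (M * ‖G - g‖ ^ 2) := by gcongr
    _ = _ := by ring

/-- Iterated space-time integrals of a sum of densities that are continuous over the time
interval. -/
theorem lintegral_lintegral_le_add_add {t₀ t₁ : ℝ} {F f g k : ℝ → Phase d → ℝ}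
    (hF : ContinuousOn (fun z : ℝ × Phase d => F z.1 z.2) (Set.Icc t₀ t₁ ×ˢ Set.univ))
    (hf : ContinuousOn (fun z : ℝ × Phase d => f z.1 z.2) (Set.Icc t₀ t₁ ×ˢ Set.univ))
    (hg : ContinuousOn (fun z : ℝ × Phase d => g z.1 z.2) (Set.Icc t₀ t₁ ×ˢ Set.univ))
    (hk : ContinuousOn (fun z : ℝ × Phase d => k z.1 z.2) (Set.Icc t₀ t₁ ×ˢ Set.univ))
    (h : ∀ t ∈ Set.Icc t₀ t₁, ∀ x, F t x ≤ f t x + (g t x + k t x)) :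
    ∫⁻ t in Set.Icc t₀ t₁, ∫⁻ x, ENNReal.ofReal (F t x)
      ≤ (∫⁻ t in Set.Icc t₀ t₁, ∫⁻ x, ENNReal.ofReal (f t x))
        + ((∫⁻ t in Set.Icc t₀ t₁, ∫⁻ x, ENNReal.ofReal (g t x))
        + ∫⁻ t in Set.Icc t₀ t₁, ∫⁻ x, ENNReal.ofReal (k t x)) := by
  have e : ∀ u : ℝ → Phase d → ℝ,
      ContinuousOn (fun z : ℝ × Phase d => u z.1 z.2) (Set.Icc t₀ t₁ ×ˢ Set.univ) →
      AEMeasurable (fun z : ℝ × Phase d => ENNReal.ofReal (u z.1 z.2))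
        (spaceTime (Phase d) t₀ t₁) := fun u hu =>
    (aestronglyMeasurable_spaceTime hu).aemeasurable.ennreal_ofReal
  rw [← lintegral_prod _ (e F hF), ← lintegral_prod _ (e f hf), ← lintegral_prod _ (e g hg),
    ← lintegral_prod _ (e k hk), ← lintegral_add_left' (e g hg), ← lintegral_add_left' (e f hf)]
  refine lintegral_mono_ae (ae_spaceTime fun t ht x => ?_)
  exact (ENNReal.ofReal_le_ofReal (h t ht x)).trans
    (ENNReal.ofReal_add_le.trans (add_le_add le_rfl ENNReal.ofReal_add_le))

variable {β τ t₀ t₁ : ℝ} {Uo Uf : Pos d → ℝ} {m H V : ℝ → ℝ → Phase d → ℝ}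
  {S A V' : Fin 3 → ℝ → Phase d → ℝ}

/-- The energy density in the variables `(q, p̃)`. -/
theorem IsLKTransition.lintegral_energy_rescale {mo mf : Phase d → ℝ} {m H : ℝ → Phase d → ℝ}
    (h : IsLKTransition β τ t₀ t₁ mo mf m H) (hβ : 0 < β) {l : ℝ} (hl : 0 < l) :
    ∫⁻ t in Set.Icc t₀ t₁, ∫⁻ x, ENNReal.ofReal (m t x * ‖gradP (helmholtz β m H t) x‖ ^ 2)
      = ∫⁻ t in Set.Icc t₀ t₁, ∫⁻ x : Phase d, ENNReal.ofReal (l ^ d * m t (x.1, l • x.2)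
          * ‖gradP (helmholtz β m H t) (x.1, l • x.2)‖ ^ 2) := by
  refine setLIntegral_congr_fun measurableSet_Icc fun t ht => ?_
  have hc : Continuous fun x => gradP (helmholtz β m H t) x := by
    rw [← continuousOn_univ]
    exact (h.continuousOn_gradients hβ).2.comp (continuous_const.prodMk continuous_id).continuousOn
      fun x _ => ⟨ht, trivial⟩
  have hm := (h.density_regular.space t).continuous
  rw [lintegral_rescale hl (by fun_prop)]
  refine lintegral_congr fun x => ?_
  rw [← ENNReal.ofReal_mul (by positivity), mul_assoc]

/-- The entropy production of an expansion that is uniform in energy norm: to leading order it is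
the action of the limiting position marginal, because `∂_p A` tends to `-∂_q a`, which does not
depend on the momentum. -/
theorem IsExtremalExpansion.lkEntropyProduction_le
    (h : IsExtremalExpansion β τ t₀ t₁ Uo Uf m H V S A V')
    (hE : IsEnergyUniform β t₀ t₁ m H S A) (hβ : 0 < β) (hτ : 0 < τ) {a s : ℝ → Pos d → ℝ}
    (ha : IsC21 a) (hs : IsC21 s)
    (hS : ∀ t ∈ Set.Icc t₀ t₁, ∀ x, S 0 t x = ‖x.2‖ ^ 2 / 2 + s t x.1)
    (hA : ∀ t ∈ Set.Icc t₀ t₁, ∀ x, gradP (A 1 t) x = -gradient (a t) x.1)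
    (hfin : ∫⁻ t in Set.Icc t₀ t₁, ∫⁻ q,
      ENNReal.ofReal (cellDensity β s t q * ‖gradient (a t) q‖ ^ 2) ≠ ⊤) :
    ∃ C : ℝ, ∀ᶠ lam in 𝓝[>] (0 : ℝ), lkEntropyProduction β τ t₀ t₁ (m lam) (H lam)
      ≤ ENNReal.ofReal (β / τ) * (∫⁻ t in Set.Icc t₀ t₁, ∫⁻ q,
          ENNReal.ofReal (cellDensity β s t q * ‖gradient (a t) q‖ ^ 2))
        + ENNReal.ofReal (C * lam) := by
  obtain ⟨C₁, h1⟩ := hE.momentum_gradient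
  obtain ⟨C₂, h2⟩ := hE.density
  set L := ∫⁻ t in Set.Icc t₀ t₁, ∫⁻ q,
      ENNReal.ofReal (cellDensity β s t q * ‖gradient (a t) q‖ ^ 2) with hL
  -- for `l < 1` the errors are `l L`, `(1 + l) C₂ l ≤ 2 C₂ l` and `(1 + 1 / l) C₁ l² ≤ 2 C₁ l`
  refine ⟨β / τ * (L.toReal + (2 * |C₂| + 2 * |C₁|)), ?_⟩
  filter_upwards [h1, h2, h.transition, self_mem_nhdsWithin,
    nhdsWithin_le_nhds (Iio_mem_nhds one_pos)] with l h1 h2 hT hl hl1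
  have hl : 0 < l := hl
  have hl1 : l < 1 := hl1
  have hβτ : 0 ≤ β / τ := by positivity
  have hL0 : ∫⁻ t in Set.Icc t₀ t₁, ∫⁻ x : Phase d, ENNReal.ofReal
      (β ^ d * Real.exp (-β * S 0 t x) * ‖gradP (A 1 t) x‖ ^ 2) = L := by
    refine setLIntegral_congr_fun measurableSet_Icc fun t ht => ?_
    simp only [hS t ht, hA t ht, norm_neg]
    exact lintegral_maxwellian_eq_cellDensity hβ (s := s t) (hs.space t).continuous
      (k := fun q => ‖gradient (a t) q‖ ^ 2) ((ha.contDiff_gradient t).continuous.norm.pow 2)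
  have hr : Continuous fun z : ℝ × Phase d => (z.1, (z.2.1, l • z.2.2)) := by fun_prop
  have cG := (hT.continuousOn_gradients hβ).2.comp hr.continuousOn
    (s := Set.Icc t₀ t₁ ×ˢ Set.univ) fun z hz => ⟨hz.1, trivial⟩
  have cM : Continuous fun z : ℝ × Phase d => l ^ d * m l z.1 (z.2.1, l • z.2.2) :=
    continuous_const.mul (hT.density_regular.continuous.comp hr)
  have cg : Continuous fun z : ℝ × Phase d => gradP (A 1 z.1) z.2 :=
    (h.expansionA.regular 1).continuous_gradP
  have cM₀ : Continuous fun z : ℝ × Phase d => β ^ d * Real.exp (-β * S 0 z.1 z.2) := by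
    have := (h.expansionS.regular 0).continuous
    fun_prop
  have key := lintegral_lintegral_le_add_add (t₀ := t₀) (t₁ := t₁)
    (F := fun t x => l ^ d * m l t (x.1, l • x.2)
      * ‖gradP (helmholtz β (m l) (H l) t) (x.1, l • x.2)‖ ^ 2)
    (f := fun t x => (1 + l) * (β ^ d * Real.exp (-β * S 0 t x) * ‖gradP (A 1 t) x‖ ^ 2))
    (g := fun t x => (1 + l) * (|l ^ d * m l t (x.1, l • x.2) - β ^ d * Real.exp (-β * S 0 t x)|
      * ‖gradP (A 1 t) x‖ ^ 2))
    (k := fun t x => (1 + l⁻¹) * (l ^ d * m l t (x.1, l • x.2)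
      * ‖gradP (helmholtz β (m l) (H l) t) (x.1, l • x.2) - gradP (A 1 t) x‖ ^ 2))
    (cM.continuousOn.mul (cG.norm.pow 2))
    (continuous_const.mul (cM₀.mul (cg.norm.pow 2))).continuousOn
    (continuous_const.mul ((cM.sub cM₀).abs.mul (cg.norm.pow 2))).continuousOn
    (continuousOn_const.mul (cM.continuousOn.mul ((cG.sub cg.continuousOn).norm.pow 2)))
    fun t ht x => mul_sq_norm_le_split hl
      (mul_nonneg (by positivity) (hT.pos t ht _).le) _ _
  rw [lintegral_lintegral_const_mul (by positivity),
    lintegral_lintegral_const_mul (by positivity),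
    lintegral_lintegral_const_mul (by positivity), hL0,
    ← hT.lintegral_energy_rescale hβ hl] at key
  have b1 : ENNReal.ofReal (1 + l) * L ≤ L + ENNReal.ofReal (l * L.toReal) := by
    rw [ENNReal.ofReal_add zero_le_one hl.le, ENNReal.ofReal_one, add_mul, one_mul,
      ENNReal.ofReal_mul hl.le, ENNReal.ofReal_toReal hfin]
  have b2 : ENNReal.ofReal (1 + l) * ENNReal.ofReal (C₂ * l) ≤ ENNReal.ofReal (2 * |C₂| * l) := by
    rw [← ENNReal.ofReal_mul (by positivity)]
    refine ENNReal.ofReal_le_ofReal ?_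
    calc (1 + l) * (C₂ * l) ≤ (1 + l) * (|C₂| * l) := by gcongr; exact le_abs_self _
      _ ≤ 2 * (|C₂| * l) := by gcongr; linarith
      _ = _ := by ring
  have b3 : ENNReal.ofReal (1 + l⁻¹) * ENNReal.ofReal (C₁ * l ^ 2)
      ≤ ENNReal.ofReal (2 * |C₁| * l) := by
    rw [← ENNReal.ofReal_mul (by positivity)]
    refine ENNReal.ofReal_le_ofReal ?_
    calc (1 + l⁻¹) * (C₁ * l ^ 2) ≤ (1 + l⁻¹) * (|C₁| * l ^ 2) := by gcongr; exact le_abs_self _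
      _ = (1 + l) * (|C₁| * l) := by field_simp; ring
      _ ≤ 2 * (|C₁| * l) := by gcongr; linarith
      _ = _ := by ring
  have total : ∫⁻ t in Set.Icc t₀ t₁, ∫⁻ x, ENNReal.ofReal
      (m l t x * ‖gradP (helmholtz β (m l) (H l) t) x‖ ^ 2)
      ≤ L + ENNReal.ofReal ((L.toReal + (2 * |C₂| + 2 * |C₁|)) * l) := by
    refine key.trans ((add_le_add (b1.trans le_rfl) (add_le_add
      ((mul_le_mul_right h2 _).trans b2) ((mul_le_mul_right h1 _).trans b3))).trans_eq ?_)
    rw [← ENNReal.ofReal_add (by positivity) (by positivity), add_assoc,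
      ← ENNReal.ofReal_add (by positivity) (by positivity)]
    congr 2
    ring
  refine (mul_le_mul_right total _).trans_eq ?_
  rw [mul_add, ← ENNReal.ofReal_mul hβτ, ← mul_assoc (β / τ)]

end EnergyExpansion

end

theorem mainTheorem5 (d : ℕ) (β τ t₀ t₁ : ℝ) (hβ : 0 < β) (hτ : 0 < τ) (ht : t₀ < t₁)
    (Uo Uf : Pos d → ℝ)
    (hmass_o : ∫ q, marginalState β Uo q = 1) (hmass_f : ∫ q, marginalState β Uf q = 1)
    (hmom_o : Integrable (fun q => ‖q‖ ^ 2 * marginalState β Uo q))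
    (hmom_f : Integrable (fun q => ‖q‖ ^ 2 * marginalState β Uf q)) :
    -- (1) the multiscale expansion of the extremal equations
    (∀ (m H V : ℝ → ℝ → Phase d → ℝ) (S A V' : Fin 3 → ℝ → Phase d → ℝ),
      IsExtremalExpansion β τ t₀ t₁ Uo Uf m H V S A V' →
      (∀ t ∈ Set.Icc t₀ t₁, ∀ q p : Pos d,
        S 0 t (q, p) - S 0 t (q, 0) = S 0 t₀ (q, p) - S 0 t₀ (q, 0)) →
      ∃ (a s : ℝ → Pos d → ℝ) (c : ℝ → ℝ), IsC21 a ∧ IsC21 s ∧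
        IsCellSolution β τ t₀ t₁ Uo Uf a s ∧
        (∀ t ∈ Set.Icc t₀ t₁, ∀ q p : Pos d,
          S 0 t (q, p) = ‖p‖ ^ 2 / 2 + s t q ∧
          A 0 t (q, p) = a t q + c t ∧
          V' 0 t (q, p) = 2 * a t q ∧
          A 1 t (q, p) = -inner ℝ p (gradient (a t) q) + A 1 t (q, 0)) ∧
        (IsEnergyUniform β t₀ t₁ m H S A →
          ∃ C : ℝ, ∀ᶠ lam in 𝓝[>] (0 : ℝ),
            lsMinimum β τ t₀ t₁ (marginalState β Uo) (marginalState β Uf)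
              ≤ lkMinimum β τ t₀ t₁ (maxwellianState β lam Uo) (maxwellianState β lam Uf) ∧
            lkMinimum β τ t₀ t₁ (maxwellianState β lam Uo) (maxwellianState β lam Uf)
              ≤ lkEntropyProduction β τ t₀ t₁ (m lam) (H lam) ∧
            lkEntropyProduction β τ t₀ t₁ (m lam) (H lam)
              ≤ ENNReal.ofReal (β / τ) * (∫⁻ t in Set.Icc t₀ t₁, ∫⁻ q,
                  ENNReal.ofReal (cellDensity β s t q * ‖gradient (a t) q‖ ^ 2))
                + ENNReal.ofReal (C * lam))) ∧
    -- (2) the cell problem is a Monge-Ampere-Kantorovich transport problem, and its cost is the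
    -- Langevin-Smoluchowski minimum
    (∀ a s : ℝ → Pos d → ℝ, IsC21 a → IsC21 s → IsCellSolution β τ t₀ t₁ Uo Uf a s →
      IsLSTransition β τ t₀ t₁ (marginalState β Uo) (marginalState β Uf) (cellDensity β s)
        (fun t q => a t q + s t q) ∧
      ENNReal.ofReal (β / τ) * (∫⁻ t in Set.Icc t₀ t₁, ∫⁻ q,
          ENNReal.ofReal (cellDensity β s t q * ‖gradient (a t) q‖ ^ 2))
        = lsMinimum β τ t₀ t₁ (marginalState β Uo) (marginalState β Uf) ∧
      lsMinimum β τ t₀ t₁ (marginalState β Uo) (marginalState β Uf) ≠ ⊤ ∧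
      lsMinimum β τ t₀ t₁ (marginalState β Uo) (marginalState β Uf)
        = ENNReal.ofReal (β * τ / (t₁ - t₀)) * transportCost (densityMeasure (marginalState β Uo))
            (densityMeasure (marginalState β Uf)) ∧
      (∀ t ∈ Set.Icc t₀ t₁, (densityMeasure (marginalState β Uo)).map
          (fun q => q - ((t - t₀) / τ) • gradient (a t₀) q) = densityMeasure (cellDensity β s t)) ∧
      ∫⁻ q, ENNReal.ofReal (‖((t₁ - t₀) / τ) • gradient (a t₀) q‖ ^ 2)
          ∂(densityMeasure (marginalState β Uo))
        = transportCost (densityMeasure (marginalState β Uo))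
            (densityMeasure (marginalState β Uf)) ∧
      ConvexOn ℝ Set.univ (fun q => ‖q‖ ^ 2 / 2 - (t₁ - t₀) / τ * a t₀ q) ∧
      (∀ lam > 0, lsMinimum β τ t₀ t₁ (marginalState β Uo) (marginalState β Uf)
        ≤ lkMinimum β τ t₀ t₁ (maxwellianState β lam Uo) (maxwellianState β lam Uf))) ∧
    -- (3) conversely, every smooth solution of the cell problem is the leading order, Maxwellian in
    -- the momentum, of an asymptotic solution of the extremal equations with the boundary states
    (∀ a s : ℝ → Pos d → ℝ, ContDiff ℝ ∞ (fun z : ℝ × Pos d => a z.1 z.2) →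
      ContDiff ℝ ∞ (fun z : ℝ × Pos d => s z.1 z.2) → IsCellSolution β τ t₀ t₁ Uo Uf a s →
      ∃ S A V' : Fin 3 → ℝ → Phase d → ℝ,
        (∀ t x, S 0 t x = ‖x.2‖ ^ 2 / 2 + s t x.1 ∧ S 1 t x = 0 ∧ S 2 t x = 0) ∧
        (∀ t x, A 0 t x = a t x.1) ∧
        (∀ t x, A 1 t x = -inner ℝ x.2 (gradient (a t) x.1)) ∧
        (∀ t x, V' 0 t x = 2 * a t x.1) ∧
        (∀ lam > 0, ∀ x,
          (β / lam) ^ d * Real.exp (-β * twoScale S lam t₀ x) = maxwellianState β lam Uo x ∧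
          (β / lam) ^ d * Real.exp (-β * twoScale S lam t₁ x) = maxwellianState β lam Uf x) ∧
        (∀ t ∈ Set.Icc t₀ t₁, ∀ x : Phase d,
          Tendsto (fun lam => valueResidual τ (twoScale A lam) (twoScale V' lam) t
            (x.1, lam • x.2)) (𝓝[>] 0) (𝓝 0) ∧
          Tendsto (fun lam => entropyResidual β τ (twoScale S lam) (twoScale A lam) t
            (x.1, lam • x.2)) (𝓝[>] 0) (𝓝 0) ∧
          Tendsto (fun lam => stationarityResidual β (twoScale S lam) (twoScale A lam)
            (twoScale V' lam) t (x.1, lam • x.2)) (𝓝[>] 0) (𝓝 0))) := by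
  refine ⟨?_, ?_, ?_⟩
  · intro m H V S A V' h hprof
    obtain ⟨a, s, c, ha, hs, hcell, hlead⟩ := h.leading_order hβ ht hprof
    refine ⟨a, s, c, ha, hs, hcell, fun t htt q p => ?_, fun hE => ?_⟩
    · obtain ⟨e1, e2, e3, -⟩ := hlead t htt (q, p)
      refine ⟨e1, e2, e3, ?_⟩
      have e4 := gradP_eq_inner_of_gradP_eq ((h.expansionA.regular 1).space t)
        (v := fun q => -gradient (a t) q) (fun x => (hlead t htt x).2.2.2) (q, p)
      rwa [inner_neg_right] at e4
    · have hf := hcell.isPotentialFlow ha hs hβ hτ ht hmass_o hmom_o hmom_f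
      obtain ⟨-, e, hfin, -⟩ := hcell.monge_ampere_kantorovich ha hs hβ hτ hf
      rw [← e] at hfin
      obtain ⟨C, hC⟩ := h.lkEntropyProduction_le hE hβ hτ ha hs
        (fun t htt x => (hlead t htt x).1) (fun t htt x => (hlead t htt x).2.2.2)
        (fun hL => hfin (by rw [hL, ENNReal.mul_top (by simpa using div_pos hβ hτ)]))
      refine ⟨C, ?_⟩
      filter_upwards [hC, h.transition, self_mem_nhdsWithin] with lam hC hT hlam
      exact ⟨hcell.lsMinimum_le_lkMinimum ha hs hβ hτ hf hlam,
        iInf_le_of_le _ (iInf_le_of_le _ (iInf_le _ hT)), hC⟩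
  · intro a s ha hs hcell
    exact hcell.monge_ampere_kantorovich ha hs hβ hτ
      (hcell.isPotentialFlow ha hs hβ hτ ht hmass_o hmom_o hmom_f)
  · intro a s ha hs hcell
    refine ⟨cellEntropyFields s, cellEnergyFields a, cellValueFields a,
      fun t x => ⟨rfl, rfl, rfl⟩, fun t x => rfl, fun t x => neg_one_mul _, fun t x => rfl,
      fun lam hlam x => ⟨exp_twoScale_cellEntropyFields hβ hcell.initial hlam x,
        exp_twoScale_cellEntropyFields hβ hcell.final hlam x⟩,
      fun t htt x => hcell.consistency hβ ha hs htt x⟩
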